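/- **Setting.** Let $M,N$ be smooth manifolds of dimension $m$, $h:M\to N$ and $\eta:N\to M$ diffeomorphisms, and $(F,\nu,N)$ a smooth real vector bundle of rank $r$ with a generalized Lie algebroid structure: a vector bundle morphism $\rho:F\to TM$ over $\eta$ and a Lie bracket $[\,,]_{F,h}$ on $\Gamma(F)$ with $[s,ft]=f[s,t]+\Gamma(Th\circ\rho,h\circ\eta)(s)(f)\,t$ and such that $\Gamma(Th\circ\rho,h\circ\eta):\Gamma(F)\to\Gamma(TN)$ is a Lie algebra morphism. Let $E\to M$ be a vector bundle identified with $F$ by a vector bundle isomorphism over $h$ (the identity if $h=\mathrm{Id}$ and $E=F$), and let $\pi:E^*\to M$ be its dual bundle. For a local frame $t_a$ of $F$ let $[t_a,t_b]=L^c_{ab}t_c$, let $p_a$ be the fibre coordinates on $E^*$ belonging to the corresponding frame of $E$, and let $\rho_a^i\circ h\,\partial_i$ be the local vector field on $M$ that is $h$-related to $\Gamma(Th\circ\rho,h\circ\eta)(t_a)$. The generalized tangent bundle $(\rho,\eta)TE^*\subset \pi^*(h^*F)\oplus TE^*$ is spanned by $\tilde\partial_a=T_a\oplus(\rho_a^i\circ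 h\circ\pi)\partial_i$, where $T_a=t_a\circ h\circ\pi$, and by $\dot\partial^a=0\oplus\partial/\partial p_a$; its anchor $\tilde\rho$ is the projection to $TE^*$, and its bracket is the Lie algebroid bracket that restricts to the Lie bracket of vector fields on the $TE^*$-component and has $F$-component given by $[T_a,T_b]=(L^c_{ab}\circ h\circ\pi)T_c$ and the Leibniz rule for $\tilde\rho$. The vertical subbundle is spanned by the $\dot\partial^a$. Let a $(\rho,\eta)$-connection be given, that is, a smooth bundle projection of $(\rho,\eta)TE^*$ onto the vertical subbundle; its kernel is the horizontal subbundle, and $\delta_a$ is the horizontal section with $F$-component $T_a$. Let $(d\tilde z^a,\delta\tilde p_a)$ be the dual base of $(\delta_a,\dot\partial^a)$. A *distinguished linear $(\rho,\eta)$-connection* is a covariant derivative $D$ on the sections of $(\rho,\eta)TE^*$, along sections of $(\rho,\eta)TE^*$ acting on functions through $\tilde\rho$, that preserves the horizontal and the vertical subbundle. It is *normal on the components* $(H^a_{bc},V_b^{ac})$ if in the adapted bases $$D_{\delta_c}\delta_b=H^a_{bc}\,\delta_a,\qquad D_{\delta_c}\dot\partial^a=-H^a_{bc}\,\dot\partial^b,\qquad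 D_{\dot\partial^c}\delta_b=-V_b^{ac}\,\delta_a,\qquad D_{\dot\partial^c}\dot\partial^a=V_b^{ac}\,\dot\partial^b .$$ **Theorem 6.1.** Let $g=g^{ab}\,dp_a\otimes dp_b$ be a (pseudo)metrical structure (a smooth symmetric nondegenerate tensor field) on the vertical subbundle, $(\tilde g_{ab})=(g^{ab})^{-1}$, and let the (pseudo)metrical structure $G$ on $(\rho,\eta)TE^*$ be determined by $g$, that is, $G=\tilde g_{ab}\,d\tilde z^a\otimes d\tilde z^b+g^{ab}\,\delta\tilde p_a\otimes\delta\tilde p_b$. Then the local functions $$H^a_{bc}=\tfrac12 g^{ae}\Big(\tilde\rho(\delta_b)\tilde g_{ec}+\tilde\rho(\delta_c)\tilde g_{be}-\tilde\rho(\delta_e)\tilde g_{bc}-\tilde g_{cd}L^d_{be}\circ h\circ\pi+\tilde g_{bd}L^d_{ec}\circ h\circ\pi-\tilde g_{ed}L^d_{bc}\circ h\circ\pi\Big),$$ $$V_b^{ac}=\tfrac12\tilde g_{be}\Big(\tilde\rho(\dot\partial^c)g^{ea}+\tilde\rho(\dot\partial^a)g^{ec}-\tilde\rho(\dot\partial^e)g^{ac}\Big)$$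 are the components, in all adapted frames, of one (globally defined) normal distinguished linear $(\rho,\eta)$-connection $D$. Its torsion $T(X,Y)=D_XY-D_YX-[X,Y]$ has vanishing $\mathcal H(\mathcal{HH})$- and $\mathcal V(\mathcal{VV})$-components, and $D_XG=0$ for all $X$; thus $(\rho,\eta)TE^*$ becomes a generalized Hamilton $(\rho,\eta)$-space. -/

import Mathlib

open Bundle
open scoped Manifold ContDiff

noncomputable section

namespace GenHamilton

/-- Model space of the base manifolds. -/
abbrev BaseModel (m : ℕ) : Type := EuclideanSpace ℝ (Fin m)

/-- Model fibre of the vector bundles of rank `r`. -/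
abbrev FibModel (r : ℕ) : Type := EuclideanSpace ℝ (Fin r)

/-- Model fibre of the dual bundles. -/
abbrev DualModel (r : ℕ) : Type := FibModel r →L[ℝ] ℝ

/-- The derivative of the function `f` at the point `x` along the tangent vector `v`. -/
def dirDeriv {EX HX : Type*} [NormedAddCommGroup EX] [NormedSpace ℝ EX] [TopologicalSpace HX]
    (I : ModelWithCorners ℝ EX HX) {X : Type*} [TopologicalSpace X] [ChartedSpace HX X]
    (f : X → ℝ) (x : X) (v : TangentSpace I x) : ℝ :=
  mfderiv I 𝓘(ℝ, ℝ) f x v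

section Algebroid

variable {m r : ℕ}
  {M : Type*} [TopologicalSpace M] [ChartedSpace (BaseModel m) M] [IsManifold (𝓡 m) ∞ M]
  {N : Type*} [TopologicalSpace N] [ChartedSpace (BaseModel m) N] [IsManifold (𝓡 m) ∞ N]
  (h : M ≃ₘ^∞⟮𝓡 m, 𝓡 m⟯ N) (η : N ≃ₘ^∞⟮𝓡 m, 𝓡 m⟯ M)
  (F : N → Type*) [TopologicalSpace (TotalSpace (FibModel r) F)]
  [∀ y, AddCommGroup (F y)] [∀ y, Module ℝ (F y)] [∀ y, TopologicalSpace (F y)]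
  [FiberBundle (FibModel r) F] [VectorBundle ℝ (FibModel r) F]

variable {F} in
/-- The action on a function `f` on `N` of the vector field `Γ(Th ∘ ρ, h ∘ η)(s)` of `N`, for a
section `s` of `F`. With `y = h (η κ)`, the value of this vector field at `y` is `Th (ρ (s κ))`;
hence its action on `f` at `y` is the derivative of `f ∘ h` at `η κ` along `ρ (s κ)`. -/
def anchorAct (ρ : ∀ κ : N, F κ →ₗ[ℝ] TangentSpace (𝓡 m) (η κ)) (s : ∀ κ, F κ) (f : N → ℝ)
    (y : N) : ℝ :=
  dirDeriv (𝓡 m) (f ∘ h) (η (η.symm (h.symm y)))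
    (ρ (η.symm (h.symm y)) (s (η.symm (h.symm y))))

variable (r) in
/-- A generalized Lie algebroid `((F, ν, N), [ , ]_{F,h}, (ρ, η))`, where `h : M → N` and
`η : N → M` are diffeomorphisms and `(ρ, η)` is a vector bundle morphism from `F` to `TM`.
The bracket is an operation on the smooth sections of `F`. -/
structure GenLieAlgebroid where
  /-- the fibrewise linear map `ρ` over `η` -/
  ρ : ∀ κ : N, F κ →ₗ[ℝ] TangentSpace (𝓡 m) (η κ)
  ρ_smooth : ContMDiff ((𝓡 m).prod 𝓘(ℝ, FibModel r)) (𝓡 m).tangent ∞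
    (fun v : TotalSpace (FibModel r) F => (⟨η v.1, ρ v.1 v.2⟩ : TangentBundle (𝓡 m) M))
  /-- the bracket -/
  bracket : Cₛ^∞⟮𝓡 m; FibModel r, F⟯ → Cₛ^∞⟮𝓡 m; FibModel r, F⟯ → Cₛ^∞⟮𝓡 m; FibModel r, F⟯
  bracket_add : ∀ s t t', bracket s (t + t') = bracket s t + bracket s t'
  bracket_smul : ∀ (c : ℝ) s t, bracket s (c • t) = c • bracket s t
  bracket_skew : ∀ s t, bracket s t = - bracket t s
  jacobi : ∀ s t w,
    bracket s (bracket t w) + bracket t (bracket w s) + bracket w (bracket s t) = 0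
  /-- Leibniz rule: `[s, f t] = f [s, t] + Γ(Th ∘ ρ, h ∘ η)(s)(f) t`. -/
  leibniz : ∀ (s t ft : Cₛ^∞⟮𝓡 m; FibModel r, F⟯) (f : N → ℝ), ContMDiff (𝓡 m) 𝓘(ℝ, ℝ) ∞ f →
    (∀ y, ft y = f y • t y) →
    ∀ y, bracket s ft y = f y • bracket s t y + anchorAct h η ρ s f y • t y
  /-- `Γ(Th ∘ ρ, h ∘ η)` is a morphism of Lie algebras to the vector fields of `N`, which are
  written as derivations of the smooth functions. -/
  anchor_bracket : ∀ (s t : Cₛ^∞⟮𝓡 m; FibModel r, F⟯) (f : N → ℝ),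
    ContMDiff (𝓡 m) 𝓘(ℝ, ℝ) ∞ f → ∀ y, anchorAct h η ρ (bracket s t) f y
      = anchorAct h η ρ s (anchorAct h η ρ t f) y - anchorAct h η ρ t (anchorAct h η ρ s f) y

variable (r) in
/-- An isomorphism `E → F` of vector bundles over the diffeomorphism `h : M → N`; it is what
`E = F` means when `E` lives over `M` and `F` over `N` (take the identity if `h = Id` and `E`, `F`
are literally equal). The inverse of a smooth fibrewise isomorphism over a diffeomorphism is
automatically smooth. -/
structure BundleIso
    (E : M → Type*) [TopologicalSpace (TotalSpace (FibModel r) E)]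
    [∀ x, AddCommGroup (E x)] [∀ x, Module ℝ (E x)] [∀ x, TopologicalSpace (E x)]
    [FiberBundle (FibModel r) E] [VectorBundle ℝ (FibModel r) E] where
  /-- the isomorphism `E_x → F_{h x}` -/
  equiv : ∀ x : M, E x ≃L[ℝ] F (h x)
  smooth : ContMDiff ((𝓡 m).prod 𝓘(ℝ, FibModel r)) ((𝓡 m).prod 𝓘(ℝ, FibModel r)) ∞
    (fun v : TotalSpace (FibModel r) E =>
      (⟨h v.1, equiv v.1 v.2⟩ : TotalSpace (FibModel r) F))

end Algebroid

section Dual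

variable (m : ℕ) {r : ℕ}
  {M : Type*} [TopologicalSpace M] [ChartedSpace (BaseModel m) M]
  (E : M → Type*) [TopologicalSpace (TotalSpace (FibModel r) E)]
  [∀ x, AddCommGroup (E x)] [∀ x, Module ℝ (E x)] [∀ x, TopologicalSpace (E x)]
  [FiberBundle (FibModel r) E] [VectorBundle ℝ (FibModel r) E]

/-- The fibre `E*_x` of the dual bundle. -/
abbrev DualFib (x : M) : Type _ := E x →L[ℝ] Bundle.Trivial M ℝ x

variable (r) in
/-- The total space of the dual bundle `E*`. -/
abbrev DualTot : Type _ := TotalSpace (DualModel r) (DualFib E)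

variable (r) in
/-- The model with corners of the manifold `E*`. -/
abbrev DualI : ModelWithCorners ℝ (BaseModel m × DualModel r)
    (ModelProd (BaseModel m) (DualModel r)) :=
  (𝓡 m).prod 𝓘(ℝ, DualModel r)

/-- The projection `E* → M`. -/
def dualProj : DualTot r E → M := fun u => u.1

variable {E}

/-- The vertical lift of `φ ∈ E*_x` at `u ∈ E*_x`: the velocity at `τ = 0` of the curve
`τ ↦ u + τ φ` in the fibre `E*_x`, a vector of `T_u E*`. -/
def vertVec (u : DualTot r E) (φ : DualFib E u.1) : TangentSpace (DualI m r) u :=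
  (mfderiv 𝓘(ℝ, ℝ) (DualI m r) (fun τ : ℝ => (⟨u.1, u.2 + τ • φ⟩ : DualTot r E)) 0 (1 : ℝ) :)

theorem mfderiv_dualProj_curve (u₀ : M) (c : ℝ → DualTot r E) (hc : ∀ τ, (c τ).1 = u₀)
    [ContMDiffVectorBundle ∞ (FibModel r) E (𝓡 m)]
    (u : DualTot r E) (hu : c 0 = u) :
    mfderiv (DualI m r) (𝓡 m) (dualProj E) u
      ((mfderiv 𝓘(ℝ, ℝ) (DualI m r) c 0 (1 : ℝ) :) : TangentSpace (DualI m r) u) = 0 := by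
  subst hu
  by_cases hd : MDifferentiableAt 𝓘(ℝ, ℝ) (DualI m r) c 0
  · have hp : MDifferentiableAt (DualI m r) (𝓡 m) (dualProj E) (c 0) :=
      (Bundle.contMDiff_proj (n := 1) (DualFib E) (IB := 𝓡 m)).mdifferentiable (by simp) (c 0)
    have h1 := mfderiv_comp_apply (0 : ℝ) hp hd (1 : ℝ)
    have h2 : dualProj E ∘ c = fun _ => u₀ := funext hc
    rw [h2, mfderiv_const] at h1
    exact h1.symm
  · rw [mfderiv_zero_of_not_mdifferentiableAt hd]
    exact ContinuousLinearMap.map_zero _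

theorem dualProj_vertVec [ContMDiffVectorBundle ∞ (FibModel r) E (𝓡 m)]
    (u : DualTot r E) (φ : DualFib E u.1) :
    mfderiv (DualI m r) (𝓡 m) (dualProj E) u (vertVec m u φ) = 0 :=
  mfderiv_dualProj_curve m u.1 (fun τ : ℝ => (⟨u.1, u.2 + τ • φ⟩ : DualTot r E))
    (fun _ => rfl) u (by simp)

end Dual

section Tangent

variable {m r : ℕ}
  {M : Type*} [TopologicalSpace M] [ChartedSpace (BaseModel m) M] [IsManifold (𝓡 m) ∞ M]
  {N : Type*} [TopologicalSpace N] [ChartedSpace (BaseModel m) N] [IsManifold (𝓡 m) ∞ N]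
  {h : M ≃ₘ^∞⟮𝓡 m, 𝓡 m⟯ N} {η : N ≃ₘ^∞⟮𝓡 m, 𝓡 m⟯ M}
  {E : M → Type*} [TopologicalSpace (TotalSpace (FibModel r) E)]
  [∀ x, AddCommGroup (E x)] [∀ x, Module ℝ (E x)] [∀ x, TopologicalSpace (E x)]
  [FiberBundle (FibModel r) E] [VectorBundle ℝ (FibModel r) E]
  [ContMDiffVectorBundle ∞ (FibModel r) E (𝓡 m)]
  {F : N → Type*} [TopologicalSpace (TotalSpace (FibModel r) F)]
  [∀ y, AddCommGroup (F y)] [∀ y, Module ℝ (F y)] [∀ y, TopologicalSpace (F y)]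
  [FiberBundle (FibModel r) F] [VectorBundle ℝ (FibModel r) F]

/-- The pull back by `h` of the anchored section `ρ s`, the vector field
`(s^α ρ^i_α ∘ h) ∂/∂x^i` on `M`. It is the vector field that is `h`-related to
`Γ(Th ∘ ρ, h ∘ η)(s)`, so that at `x` it is `ρ (s (η⁻¹ x))`, a tangent vector at
`η (η⁻¹ x) = x`. -/
def GenLieAlgebroid.anchorField (A : GenLieAlgebroid r h η F) (s : ∀ κ, F κ) (x : M) :
    TangentSpace (𝓡 m) x :=
  (A.ρ (η.symm x) (s (η.symm x)) :)

theorem GenLieAlgebroid.anchorField_add (A : GenLieAlgebroid r h η F) (s t : ∀ κ, F κ) (x : M) :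
    A.anchorField (s + t) x = A.anchorField s x + A.anchorField t x :=
  (A.ρ (η.symm x)).map_add _ _

theorem GenLieAlgebroid.anchorField_smul (A : GenLieAlgebroid r h η F) (c : ℝ) (s : ∀ κ, F κ)
    (x : M) : A.anchorField (c • s) x = c • A.anchorField s x :=
  (A.ρ (η.symm x)).map_smul _ _

theorem GenLieAlgebroid.anchorField_zero (A : GenLieAlgebroid r h η F) (x : M) :
    A.anchorField 0 x = 0 :=
  (A.ρ (η.symm x)).map_zero

variable (E) in
/-- The fibre at `u ∈ E*` of the generalized tangent bundle `(ρ, η)TE*`, inside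
`(π* (h* F))_u ⊕ T_u E*`. It is generated by the values of
`s ∘ h ∘ π ⊕ (any lift of the pulled back anchor of s)`, `s` a section of `F`, and of
`0 ⊕ (vertical vector)`: in coordinates, by `T_α ⊕ (ρ^i_α ∘ h ∘ π) ∂_i` and `0 ⊕ ∂^a`. -/
def GT (A : GenLieAlgebroid r h η F) (u : DualTot r E) :
    Submodule ℝ (F (h u.1) × TangentSpace (DualI m r) u) where
  carrier := {p | ∃ s : Cₛ^∞⟮𝓡 m; FibModel r, F⟯, s (h u.1) = p.1 ∧
    mfderiv (DualI m r) (𝓡 m) (dualProj E) u p.2 = A.anchorField s u.1}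
  add_mem' := by
    rintro p q ⟨s, hs, hs'⟩ ⟨t, ht, ht'⟩
    refine ⟨s + t, ?_, ?_⟩
    · simp [hs, ht]
    · rw [ContMDiffSection.coe_add, A.anchorField_add, ← hs', ← ht']
      exact ContinuousLinearMap.map_add _ _ _
  zero_mem' := by
    refine ⟨0, by simp, ?_⟩
    rw [ContMDiffSection.coe_zero, A.anchorField_zero]
    exact ContinuousLinearMap.map_zero _
  smul_mem' := by
    rintro c p ⟨s, hs, hs'⟩
    refine ⟨c • s, ?_, ?_⟩
    · simp [hs]
    · rw [ContMDiffSection.coe_smul, A.anchorField_smul, ← hs']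
      exact ContinuousLinearMap.map_smul _ _ _

variable {A : GenLieAlgebroid r h η F}

/-- The component in `F_{h (π u)}` of a vector of `(ρ, η)TE*` at `u`, that is, its image under
the tangent `(ρ, η)`-application. -/
def zPart (u : DualTot r E) : GT E A u →ₗ[ℝ] F (h u.1) :=
  (LinearMap.fst ℝ _ _).comp (GT E A u).subtype

/-- The component in `T_u E*` of a vector of `(ρ, η)TE*` at `u`, that is, the anchor `ρ̃`. -/
def wPart (u : DualTot r E) : GT E A u →ₗ[ℝ] TangentSpace (DualI m r) u :=
  (LinearMap.snd ℝ _ _).comp (GT E A u).subtype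

variable (A) in
/-- The vertical subspace `V(ρ, η)TE*` at `u`: the kernel of the tangent `(ρ, η)`-application. -/
def Vert (u : DualTot r E) : Submodule ℝ (GT E A u) := LinearMap.ker (zPart u)

variable (A) in
/-- The vertical lift `E*_{π u} → V(ρ, η)TE*_u`, `p_a s^a ↦ p_a ∂^a`. -/
def vertLift (u : DualTot r E) (φ : DualFib E u.1) : Vert A u :=
  ⟨⟨(0, vertVec m u φ), 0, by simp, by
    rw [ContMDiffSection.coe_zero, A.anchorField_zero]
    exact dualProj_vertVec m u φ⟩, rfl⟩

variable (E A) in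
/-- Sections of `(ρ, η)TE*`, without regularity. -/
abbrev RawSection : Type _ := ∀ u : DualTot r E, GT E A u

/-- Smoothness at a point of a section of `(ρ, η)TE*`, as a subbundle of
`π* (h* F) ⊕ TE*`. -/
def SmoothAt (X : RawSection E A) (u : DualTot r E) : Prop :=
  ContMDiffAt (DualI m r) ((𝓡 m).prod 𝓘(ℝ, FibModel r)) ∞
    (fun v => (⟨h v.1, zPart v (X v)⟩ : TotalSpace (FibModel r) F)) u ∧
  ContMDiffAt (DualI m r) (DualI m r).tangent ∞
    (fun v => (⟨v, wPart v (X v)⟩ : TangentBundle (DualI m r) (DualTot r E))) u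

/-- Smooth sections of `(ρ, η)TE*`. -/
def Smooth (X : RawSection E A) : Prop := ∀ u, SmoothAt X u

/-- The derivative `Γ(ρ̃, Id)(X)(f)` of a function `f` on `E*` along a section of `(ρ, η)TE*`. -/
def act (X : RawSection E A) (f : DualTot r E → ℝ) (u : DualTot r E) : ℝ :=
  dirDeriv (DualI m r) f u (wPart u (X u))

variable (E A) in
/-- A `(ρ, η)`-connection: a smooth vector bundle morphism
`(ρ, η)Γ : (ρ, η)TE* → V(ρ, η)TE*` that splits the inclusion of the vertical subbundle. -/
structure Connection where
  /-- the projection onto the vertical subbundle -/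
  proj : ∀ u : DualTot r E, GT E A u →ₗ[ℝ] GT E A u
  proj_mem : ∀ u X, proj u X ∈ Vert A u
  proj_of_mem : ∀ u X, X ∈ Vert A u → proj u X = X
  smooth : ∀ (X : RawSection E A) (u), SmoothAt X u → SmoothAt (fun v => proj v (X v)) u

/-- The horizontal subspace at `u`: the kernel of the connection. -/
def Connection.Hor (C : Connection E A) (u : DualTot r E) : Submodule ℝ (GT E A u) :=
  LinearMap.ker (C.proj u)

/-- A local frame `t_a` of `F` over `h(U)` with the dual frame `s^a` of `E*` over `U` (the frames
of `E` and `F` correspond to each other under the identification `E = F`) and the horizontal part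
`δ_a` of the adapted base: `δ_a` is the horizontal section with
`F`-component `T_a = t_a ∘ h ∘ π`. Local frames are restrictions of global sections; near any
point every smooth local frame is of this form. -/
structure AdaptedFrame (Φ : BundleIso r h F E) (C : Connection E A) where
  U : Set M
  isOpen_U : IsOpen U
  t : Fin r → Cₛ^∞⟮𝓡 m; FibModel r, F⟯
  s : Fin r → Cₛ^∞⟮𝓡 m; DualModel r, DualFib E⟯
  dual : ∀ x ∈ U, ∀ a b, s a x ((Φ.equiv x).symm (t b (h x))) = if a = b then (1 : ℝ) else 0
  δ : Fin r → RawSection E A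
  zPart_δ : ∀ a u, zPart u (δ a u) = t a (h u.1)
  δ_mem : ∀ a u, δ a u ∈ C.Hor u

namespace AdaptedFrame

variable {Φ : BundleIso r h F E} {C : Connection E A} (fr : AdaptedFrame Φ C)

/-- The vertical part `∂^a` of the adapted base. -/
def vdot (a : Fin r) : RawSection E A := fun u => vertLift A u (fr.s a u.1)

/-- The components `Z^a` of a section with respect to `T_a`. -/
def zCoord (X : RawSection E A) (a : Fin r) (u : DualTot r E) : ℝ :=
  fr.s a u.1 ((Φ.equiv u.1).symm (zPart u (X u)))

/-- The structure functions `L^c_{ab} ∘ h ∘ π`, where `[t_a, t_b] = L^c_{ab} t_c`. -/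
def L (c a b : Fin r) (u : DualTot r E) : ℝ :=
  fr.s c u.1 ((Φ.equiv u.1).symm (A.bracket (fr.t a) (fr.t b) (h u.1)))

/-- The Lie algebroid bracket of two sections of `(ρ, η)TE*`, at points over `U`: the Lie bracket
of vector fields on the component in `TE*`, and on the component in `π* (h* F)` the extension of
`[T_a, T_b] = (L^c_{ab} ∘ h ∘ π) T_c` by the Leibniz rule for the anchor `ρ̃`. -/
def bracket (X Y : RawSection E A) (u : DualTot r E) :
    F (h u.1) × TangentSpace (DualI m r) u :=
  (∑ c, ((∑ a, ∑ b, fr.zCoord X a u * fr.zCoord Y b u * fr.L c a b u)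
      + act X (fr.zCoord Y c) u - act Y (fr.zCoord X c) u) • fr.t c (h u.1),
    VectorField.mlieBracket (DualI m r) (fun v => wPart v (X v)) (fun v => wPart v (Y v)) u)

end AdaptedFrame

/-- A (pseudo)metrical structure
`G = g_{ab} dz^a ⊗ dz^b + g^{ab} δp_a ⊗ δp_b` on `(ρ, η)TE*`: a smooth symmetric tensor field
for which the horizontal and the vertical subbundles are orthogonal, and which is nondegenerate
on each of them. -/
structure PseudoMetric (C : Connection E A) where
  form : ∀ u : DualTot r E, GT E A u →ₗ[ℝ] GT E A u →ₗ[ℝ] ℝ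
  symm : ∀ u X Y, form u X Y = form u Y X
  orth : ∀ u, ∀ X ∈ C.Hor u, ∀ Y ∈ Vert A u, form u X Y = 0
  nondeg_hor : ∀ u, ∀ X ∈ C.Hor u, (∀ Y ∈ C.Hor u, form u X Y = 0) → X = 0
  nondeg_vert : ∀ u, ∀ X ∈ Vert A u, (∀ Y ∈ Vert A u, form u X Y = 0) → X = 0
  smooth : ∀ (X Y : RawSection E A) (u), SmoothAt X u → SmoothAt Y u →
    ContMDiffAt (DualI m r) 𝓘(ℝ, ℝ) ∞ (fun v => form v (X v) (Y v)) u

variable (E A) in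
/-- A (pseudo)metrical structure `g = g^{ab} dp_a ⊗ dp_b` on the vertical subbundle. -/
structure VertPseudoMetric where
  form : ∀ u : DualTot r E, Vert A u →ₗ[ℝ] Vert A u →ₗ[ℝ] ℝ
  symm : ∀ u X Y, form u X Y = form u Y X
  nondeg : ∀ u X, (∀ Y, form u X Y = 0) → X = 0
  smooth : ∀ (X Y : ∀ u : DualTot r E, Vert A u) (u), SmoothAt (fun v => (X v : GT E A v)) u →
    SmoothAt (fun v => (Y v : GT E A v)) u →
    ContMDiffAt (DualI m r) 𝓘(ℝ, ℝ) ∞ (fun v => form v (X v) (Y v)) u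

namespace AdaptedFrame

variable {Φ : BundleIso r h F E} {C : Connection E A} (fr : AdaptedFrame Φ C)

/-- The components `g^{ab}`. -/
def gUp (g : VertPseudoMetric E A) (a b : Fin r) (u : DualTot r E) : ℝ :=
  g.form u (vertLift A u (fr.s a u.1)) (vertLift A u (fr.s b u.1))

/-- The entries `g̃_{ab}` of the inverse of the matrix `(g^{ab})`. -/
def gDown (g : VertPseudoMetric E A) (a b : Fin r) (u : DualTot r E) : ℝ :=
  (Matrix.of fun i j => fr.gUp g i j u)⁻¹ a b

/-- The functions `H^a_{bc}` of the generalized connection of Levi-Civita type. -/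
def leviCivitaH (g : VertPseudoMetric E A) (a b c : Fin r) (u : DualTot r E) : ℝ :=
  (1 / 2) * ∑ e, fr.gUp g a e u *
    (act (fr.δ b) (fr.gDown g e c) u + act (fr.δ c) (fr.gDown g b e) u
      - act (fr.δ e) (fr.gDown g b c) u
      - ∑ d, fr.gDown g c d u * fr.L d b e u
      + ∑ d, fr.gDown g b d u * fr.L d e c u
      - ∑ d, fr.gDown g e d u * fr.L d b c u)

/-- The functions `V_b^{ac}` of the generalized connection of Levi-Civita type. -/
def leviCivitaV (g : VertPseudoMetric E A) (b a c : Fin r) (u : DualTot r E) : ℝ :=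
  (1 / 2) * ∑ e, fr.gDown g b e u *
    (act (fr.vdot c) (fr.gUp g e a) u + act (fr.vdot a) (fr.gUp g e c) u
      - act (fr.vdot e) (fr.gUp g a c) u)

end AdaptedFrame

/-- The (pseudo)metrical structure `G` is determined by the vertical (pseudo)metrical structure
`g`: `G = g̃_{ab} dz^a ⊗ dz^b + g^{ab} δp_a ⊗ δp_b` in all adapted frames, with
`(g̃_{ab}) = (g^{ab})⁻¹`. -/
def PseudoMetric.IsDeterminedBy {C : Connection E A} (G : PseudoMetric C) (Φ : BundleIso r h F E)
    (g : VertPseudoMetric E A) : Prop :=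
  ∀ (fr : AdaptedFrame Φ C) (u : DualTot r E), u.1 ∈ fr.U → ∀ a b,
    G.form u (fr.δ a u) (fr.δ b u) = fr.gDown g a b u ∧
    G.form u (fr.vdot a u) (fr.vdot b u) = fr.gUp g a b u

/-- A distinguished linear `(ρ, η)`-connection: a covariant derivative on the smooth sections of
`(ρ, η)TE*` that preserves the horizontal and the vertical subbundles by parallelism. (Values of
`D` at sections that are not smooth are irrelevant.) -/
structure DLinearConnection (C : Connection E A) where
  D : RawSection E A → RawSection E A → RawSection E A
  smooth : ∀ X Y, Smooth X → Smooth Y → Smooth (D X Y)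
  add_left : ∀ X X' Y, Smooth X → Smooth X' → Smooth Y → D (X + X') Y = D X Y + D X' Y
  smul_left : ∀ (f : DualTot r E → ℝ) X Y, ContMDiff (DualI m r) 𝓘(ℝ, ℝ) ∞ f → Smooth X →
    Smooth Y → D (fun u => f u • X u) Y = fun u => f u • D X Y u
  add_right : ∀ X Y Y', Smooth X → Smooth Y → Smooth Y' → D X (Y + Y') = D X Y + D X Y'
  leibniz : ∀ (f : DualTot r E → ℝ) X Y, ContMDiff (DualI m r) 𝓘(ℝ, ℝ) ∞ f → Smooth X →
    Smooth Y → D X (fun u => f u • Y u) = fun u => f u • D X Y u + act X f u • Y u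
  hor : ∀ X Y, Smooth X → Smooth Y → (∀ u, Y u ∈ C.Hor u) → ∀ u, D X Y u ∈ C.Hor u
  vert : ∀ X Y, Smooth X → Smooth Y → (∀ u, Y u ∈ Vert A u) → ∀ u, D X Y u ∈ Vert A u

namespace DLinearConnection

variable {C : Connection E A} (𝒟 : DLinearConnection C)

/-- `H^α_{βγ}`, `H^a_{bγ}`, `V^{αc}_β`, `V_b^{ac}` are the components of the distinguished linear
connection in the adapted frame:
`D_{δ_γ} δ_β = H^α_{βγ} δ_α`, `D_{δ_γ} ∂^a = - H^a_{bγ} ∂^b`,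
`D_{∂^c} δ_β = - V_β^{αc} δ_α`, `D_{∂^c} ∂^a = V_b^{ac} ∂^b`.
The signs are those for which a normal connection makes the horizontal bundle `≅ π* E` and the
vertical bundle `≅ π* E*` dual to each other, independently of the frame. -/
def HasComponents {Φ : BundleIso r h F E} (fr : AdaptedFrame Φ C)
    (H H' V V' : Fin r → Fin r → Fin r → DualTot r E → ℝ) : Prop :=
  ∀ u : DualTot r E, u.1 ∈ fr.U →
    (∀ b c, 𝒟.D (fr.δ c) (fr.δ b) u = ∑ a, H a b c u • fr.δ a u) ∧
    (∀ a c, 𝒟.D (fr.δ c) (fr.vdot a) u = - ∑ b, H' a b c u • fr.vdot b u) ∧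
    (∀ b c, 𝒟.D (fr.vdot c) (fr.δ b) u = - ∑ a, V b a c u • fr.δ a u) ∧
    (∀ a c, 𝒟.D (fr.vdot c) (fr.vdot a) u = ∑ b, V' b a c u • fr.vdot b u)

/-- In the adapted frame, the connection is normal on the components `(H, V)`. -/
def HasNormalComponents {Φ : BundleIso r h F E} (fr : AdaptedFrame Φ C)
    (H V : Fin r → Fin r → Fin r → DualTot r E → ℝ) : Prop :=
  𝒟.HasComponents fr H H V V

/-- `D_X G = 0` for all `X`. -/
def IsMetric (G : PseudoMetric C) : Prop :=
  ∀ X Y Z, Smooth X → Smooth Y → Smooth Z → ∀ u,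
    act X (fun v => G.form v (Y v) (Z v)) u
      = G.form u (𝒟.D X Y u) (Z u) + G.form u (Y u) (𝒟.D X Z u)

/-- The torsion `T(X, Y) = D_X Y - D_Y X - [X, Y]` at points over the domain of the frame. -/
def torsion {Φ : BundleIso r h F E} (fr : AdaptedFrame Φ C) (X Y : RawSection E A)
    (u : DualTot r E) : F (h u.1) × TangentSpace (DualI m r) u :=
  (𝒟.D X Y u : F (h u.1) × TangentSpace (DualI m r) u) - (𝒟.D Y X u).1 - fr.bracket X Y u

/-- The `H(HH)`-torsion vanishes: the horizontal component of `T(X, Y)`, which is determined by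
its component in `F`, is zero for horizontal `X`, `Y`. -/
def HHHTorsionFree (Φ : BundleIso r h F E) : Prop :=
  ∀ (fr : AdaptedFrame Φ C) (X Y : RawSection E A), Smooth X → Smooth Y →
    (∀ u, X u ∈ C.Hor u) → (∀ u, Y u ∈ C.Hor u) →
    ∀ u : DualTot r E, u.1 ∈ fr.U → (𝒟.torsion fr X Y u).1 = 0

/-- The `V(VV)`-torsion vanishes: `T(X, Y) = 0` for vertical `X`, `Y` (it is vertical). -/
def VVVTorsionFree (Φ : BundleIso r h F E) : Prop :=
  ∀ (fr : AdaptedFrame Φ C) (X Y : RawSection E A), Smooth X → Smooth Y →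
    (∀ u, X u ∈ Vert A u) → (∀ u, Y u ∈ Vert A u) →
    ∀ u : DualTot r E, u.1 ∈ fr.U → 𝒟.torsion fr X Y u = 0

/-- With the connection `𝒟` and the metric `G`, `(ρ, η)TE*` is a generalized Hamilton
`(ρ, η)`-space: it is `(ρ, η)`-(pseudo)metrizable through `𝒟` and `G`, and `G` is determined by
the vertical (pseudo)metrical structure `g`. -/
def IsGenHamiltonSpace (G : PseudoMetric C) (Φ : BundleIso r h F E) (g : VertPseudoMetric E A) :
    Prop :=
  𝒟.IsMetric G ∧ G.IsDeterminedBy Φ g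

end DLinearConnection

end Tangent

end GenHamilton

end

/-! The connection is the Levi-Civita connection of a metric, transplanted to `(ρ, η)TE*`.

Over the domain of an adapted frame the given `H` and `V` define a covariant derivative (`cov`)
with the connection form `ω = H - V` (`conn`), acting by `ω` on the components along the `δ_a` and
by `-ωᵀ` on the components along the `∂^a`. Normality means exactly that the same form acts on
both parts, so that the pairing of the horizontal bundle `≅ π* E` with the vertical bundle
`≅ π* E*` is parallel (`actAt_pair`). The formula for `H` is the Koszul formula along the horizontal
directions: it makes `g̃` parallel along the `δ_c` and the `H(HH)`-torsion vanish. The formula for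
`V` does the same for `g`, the `∂^c` and the `V(VV)`-torsion. Since `g̃` is the inverse of `g` and
the two representations `ω` and `-ωᵀ` are dual, each of `g` and `g̃` is parallel as soon as the
other is (`act_gUp_of_gDown`, `act_gDown_of_gUp`), which gives `D G = 0` in all directions
(`act_metric`, `actAt_form`).

What remains is that the local definitions agree on overlaps (`cov_eq`). The transformation laws
of `H` and `V` are not computed. Instead, the difference of the covariant derivatives of two
adapted frames is a tensor, and it is enough to see that it vanishes on the base of one of the
frames. On three horizontal, and on three vertical, vectors it is symmetric in the first two
arguments, because both derivatives have the same torsion, and antisymmetric in the last two,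
because both are metric; so it is zero, as in the proof that the Levi-Civita connection is unique
(`cov_δ_δ_eq`, `cov_vdot_vdot_eq`). The mixed components then vanish because both derivatives
preserve the same pairing (`cov_vdot_δ_eq`, `cov_δ_vdot_eq`).

The torsion argument needs the bracket of the algebroid in different frames to be the same: for
sections that come from `F` its `F`-component is the pull back of the bracket of `F`
(`bracket_fst`). This uses that the anchor of a section `s` of `F` at `x` depends on `s (h x)`
only, although by definition it is `ρ (s (η⁻¹ x))`; it is forced by the Leibniz rule and the skew
symmetry of the bracket (`anchorField_eq_zero`).
-/

noncomputable section

set_option linter.unusedSectionVars false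

namespace GenHamilton

open Filter Topology

/-! ### Directional derivatives on manifolds -/

section DirDeriv

variable {EX HX : Type*} [NormedAddCommGroup EX] [NormedSpace ℝ EX] [TopologicalSpace HX]
  {I : ModelWithCorners ℝ EX HX} {X : Type*} [TopologicalSpace X] [ChartedSpace HX X]
  {x : X} {f g : X → ℝ}

theorem dirDeriv_congr (hfg : f =ᶠ[𝓝 x] g) (v : TangentSpace I x) :
    dirDeriv I f x v = dirDeriv I g x v := by
  exact congrArg (fun L : EX →L[ℝ] ℝ => L v) (hfg.mfderiv_eq (I := I) (I' := 𝓘(ℝ, ℝ)))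

@[simp] theorem dirDeriv_vec_zero : dirDeriv I f x 0 = 0 := by
  exact map_zero (mfderiv I 𝓘(ℝ, ℝ) f x)

theorem dirDeriv_vec_add (v w : TangentSpace I x) :
    dirDeriv I f x (v + w) = dirDeriv I f x v + dirDeriv I f x w := by
  exact map_add (mfderiv I 𝓘(ℝ, ℝ) f x) v w

theorem dirDeriv_vec_smul (c : ℝ) (v : TangentSpace I x) :
    dirDeriv I f x (c • v) = c * dirDeriv I f x v := by
  exact map_smul (mfderiv I 𝓘(ℝ, ℝ) f x) c v

theorem dirDeriv_const (c : ℝ) (v : TangentSpace I x) : dirDeriv I (fun _ => c) x v = 0 := by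
  unfold dirDeriv
  rw [mfderiv_const]
  rfl

theorem dirDeriv_add (hf : MDifferentiableAt I 𝓘(ℝ, ℝ) f x) (hg : MDifferentiableAt I 𝓘(ℝ, ℝ) g x)
    (v : TangentSpace I x) :
    dirDeriv I (fun y => f y + g y) x v = dirDeriv I f x v + dirDeriv I g x v := by
  have h := (hf.hasMFDerivAt.add hg.hasMFDerivAt).mfderiv
  exact congrArg (fun L : EX →L[ℝ] ℝ => L v) h

theorem dirDeriv_mul (hf : MDifferentiableAt I 𝓘(ℝ, ℝ) f x) (hg : MDifferentiableAt I 𝓘(ℝ, ℝ) g x)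
    (v : TangentSpace I x) :
    dirDeriv I (fun y => f y * g y) x v = f x * dirDeriv I g x v + g x * dirDeriv I f x v := by
  have h := (hf.hasMFDerivAt.mul hg.hasMFDerivAt).mfderiv
  exact congrArg (fun L : EX →L[ℝ] ℝ => L v) h

theorem mdifferentiableAt_sum {ι : Type*} (s : Finset ι) {F : ι → X → ℝ}
    (hF : ∀ i ∈ s, MDifferentiableAt I 𝓘(ℝ, ℝ) (F i) x) :
    MDifferentiableAt I 𝓘(ℝ, ℝ) (fun y => ∑ i ∈ s, F i y) x := by
  classical
  induction s using Finset.induction_on with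
  | empty => simpa using mdifferentiableAt_const
  | insert i s hi ih =>
    simp only [Finset.sum_insert hi]
    exact (hF i (Finset.mem_insert_self _ _)).add
      (ih fun j hj => hF j (Finset.mem_insert_of_mem hj))

theorem dirDeriv_sum {ι : Type*} (s : Finset ι) {F : ι → X → ℝ}
    (hF : ∀ i ∈ s, MDifferentiableAt I 𝓘(ℝ, ℝ) (F i) x) (v : TangentSpace I x) :
    dirDeriv I (fun y => ∑ i ∈ s, F i y) x v = ∑ i ∈ s, dirDeriv I (F i) x v := by
  classical
  induction s using Finset.induction_on with
  | empty => simpa using dirDeriv_const (I := I) 0 v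
  | insert i s hi ih =>
    simp only [Finset.sum_insert hi]
    rw [dirDeriv_add (hF i (Finset.mem_insert_self _ _))
      (mdifferentiableAt_sum s fun j hj => hF j (Finset.mem_insert_of_mem hj)),
      ih fun j hj => hF j (Finset.mem_insert_of_mem hj)]

/-- Chain rule for a map between manifolds followed by a function. -/
theorem dirDeriv_comp {EY HY : Type*} [NormedAddCommGroup EY] [NormedSpace ℝ EY]
    [TopologicalSpace HY] {J : ModelWithCorners ℝ EY HY} {Y : Type*} [TopologicalSpace Y]
    [ChartedSpace HY Y] {f : Y → ℝ} {φ : X → Y}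
    (hf : MDifferentiableAt J 𝓘(ℝ, ℝ) f (φ x)) (hφ : MDifferentiableAt I J φ x)
    (v : TangentSpace I x) :
    dirDeriv I (f ∘ φ) x v = dirDeriv J f (φ x) (mfderiv I J φ x v) := by
  unfold dirDeriv
  exact mfderiv_comp_apply x hf hφ v

/-- The entries of the inverse of a matrix of smooth functions are smooth. -/
theorem contMDiffAt_matrix_inv {ι : Type*} [Fintype ι] [DecidableEq ι] {x₀ : X}
    {S : X → Matrix ι ι ℝ} (hS : ∀ i j, ContMDiffAt I 𝓘(ℝ, ℝ) ∞ (fun x => S x i j) x₀)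
    (h0 : IsUnit (S x₀)) (i j : ι) : ContMDiffAt I 𝓘(ℝ, ℝ) ∞ (fun x => (S x)⁻¹ i j) x₀ := by
  have hdet : ∀ {T : X → Matrix ι ι ℝ},
      (∀ i j, ContMDiffAt I 𝓘(ℝ, ℝ) ∞ (fun x => T x i j) x₀) →
      ContMDiffAt I 𝓘(ℝ, ℝ) ∞ (fun x => (T x).det) x₀ := by
    intro T hT
    simp only [Matrix.det_apply']
    exact contMDiffAt_finsetSum fun σ _ => contMDiffAt_const.mul
      (contMDiffAt_finsetProd fun k _ => hT _ _)
  simp only [Matrix.inv_def, Matrix.smul_apply, Ring.inverse_eq_inv', Matrix.adjugate_apply,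
    smul_eq_mul]
  refine ContMDiffAt.mul ?_ (hdet ?_)
  · refine (contDiffAt_inv ℝ ?_).contMDiffAt.comp x₀ (hdet hS)
    exact ((Matrix.isUnit_iff_isUnit_det _).1 h0).ne_zero
  · intro k l
    simp only [Matrix.updateRow_apply]
    split_ifs
    · exact contMDiffAt_const
    · exact hS _ _

end DirDeriv

section Smooth

variable {EX HX : Type*} [NormedAddCommGroup EX] [NormedSpace ℝ EX] [TopologicalSpace HX]
  {I : ModelWithCorners ℝ EX HX} {X : Type*} [TopologicalSpace X] [ChartedSpace HX X]
  [IsManifold I ∞ X]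
  {EY HY : Type*} [NormedAddCommGroup EY] [NormedSpace ℝ EY] [TopologicalSpace HY]
  {J : ModelWithCorners ℝ EY HY} {Y : Type*} [TopologicalSpace Y] [ChartedSpace HY Y]
  [IsManifold J ∞ Y]
  {EP HP : Type*} [NormedAddCommGroup EP] [NormedSpace ℝ EP] [TopologicalSpace HP]
  {K : ModelWithCorners ℝ EP HP} {P : Type*} [TopologicalSpace P] [ChartedSpace HP P]
  [IsManifold K ∞ P]

/-- The derivative of a family of maps `f p : X → Y`, smooth jointly in the parameter `p`, along
a smoothly varying tangent vector. -/
theorem contMDiffAt_mfderiv_family {p₀ : P} {f : P → X → Y} {c : P → X}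
    (hf : ContMDiffAt (K.prod I) J ∞ (Function.uncurry f) (p₀, c p₀))
    (hc : ContMDiffAt K I ∞ c p₀)
    {v : ∀ p, TangentSpace I (c p)}
    (hv : ContMDiffAt K I.tangent ∞ (fun p => (⟨c p, v p⟩ : TangentBundle I X)) p₀) :
    ContMDiffAt K J.tangent ∞
      (fun p => (⟨f p (c p), mfderiv I J (f p) (c p) (v p)⟩ : TangentBundle J Y)) p₀ := by
  have : IsManifold I 1 X := .of_le (n := ∞) (by simp)
  have : IsManifold J 1 Y := .of_le (n := ∞) (by simp)
  have : IsManifold K 1 P := .of_le (n := ∞) (by simp)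
  have : IsManifold I (∞ + 1) X := by simpa
  have : IsManifold J (∞ + 1) Y := by simpa
  have h1 := ContMDiffAt.mfderiv (m := ∞) f c hf hc (by simp)
  refine ContMDiffAt.clm_apply_of_inCoordinates h1 hv ?_
  exact hf.comp p₀ (contMDiffAt_id.prodMk hc)

/-- The derivative of a smooth function along a smooth vector field is smooth. -/
theorem contMDiffAt_dirDeriv {x₀ : X} {f : X → ℝ} (hf : ContMDiffAt I 𝓘(ℝ, ℝ) ∞ f x₀)
    {v : ∀ x, TangentSpace I x}
    (hv : ContMDiffAt I I.tangent ∞ (fun x => (⟨x, v x⟩ : TangentBundle I X)) x₀) :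
    ContMDiffAt I 𝓘(ℝ, ℝ) ∞ (fun x => dirDeriv I f x (v x)) x₀ := by
  have h := contMDiffAt_mfderiv_family (K := I) (p₀ := x₀) (f := fun _ : X => f) (c := id)
    (hf.comp (x₀, x₀) contMDiffAt_snd) contMDiffAt_id hv
  exact (contMDiff_snd_tangentBundle_modelSpace ℝ 𝓘(ℝ, ℝ)).contMDiffAt.comp x₀ h

/-- The bracket of vector fields acts on functions as the commutator of derivations. -/
theorem dirDeriv_mlieBracket [FiniteDimensional ℝ EX] {x₀ : X} {f : X → ℝ}
    (hf : ContMDiffAt I 𝓘(ℝ, ℝ) ∞ f x₀)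
    {V W : ∀ x, TangentSpace I x}
    (hV : ContMDiffAt I I.tangent ∞ (fun x => (⟨x, V x⟩ : TangentBundle I X)) x₀)
    (hW : ContMDiffAt I I.tangent ∞ (fun x => (⟨x, W x⟩ : TangentBundle I X)) x₀) :
    dirDeriv I f x₀ (VectorField.mlieBracket I V W x₀)
      = dirDeriv I (fun x => dirDeriv I f x (W x)) x₀ (V x₀)
        - dirDeriv I (fun x => dirDeriv I f x (V x)) x₀ (W x₀) := by
  have : IsManifold I 1 X := .of_le (n := ∞) (by simp)
  have : IsManifold I 2 X := .of_le (n := ∞) (by norm_cast)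
  have : IsManifold I (minSmoothness ℝ 2) X := by simpa
  have : IsManifold I (minSmoothness ℝ 3) X := by
    simp only [minSmoothness_of_isRCLikeNormedField]
    exact .of_le (n := ∞) (by norm_cast)
  have : IsManifold I (∞ + 1) X := by simpa
  have : CompleteSpace EX := FiniteDimensional.complete ℝ EX
  rcases subsingleton_or_nontrivial EX with hE | hE
  · have h0 : ∀ (x : X) (v : TangentSpace I x), v = 0 := fun x v => hE.elim (v : EX) 0
    rw [h0 x₀ (VectorField.mlieBracket I V W x₀), h0 x₀ (V x₀), h0 x₀ (W x₀)]
    simp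
  obtain ⟨z, hz⟩ := exists_ne (0 : EX)
  -- A local field `Z` with `Z x₀ ≠ 0`. The Jacobi identities for `V, W, f Z` and `V, W, Z` differ
  -- by `([V, W] f - V (W f) + W (V f)) Z`.
  obtain ⟨Z, hZ0, hZ⟩ : ∃ Z : ∀ x, TangentSpace I x, Z x₀ ≠ 0 ∧
      ContMDiffAt I I.tangent ∞ (fun x => (⟨x, Z x⟩ : TangentBundle I X)) x₀ :=
    ⟨FiberBundle.extend EX (E := TangentSpace I) (x := x₀) z,
      fun h0 => hz
        ((FiberBundle.extend_apply_self EX (E := TangentSpace I) (x := x₀) z).symm.trans h0),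
      FiberBundle.contMDiffAt_extend I EX (V := TangentSpace I) (x := x₀) z⟩
  have md : ∀ {U : ∀ x, TangentSpace I x},
      ContMDiffAt I I.tangent ∞ (fun x => (⟨x, U x⟩ : TangentBundle I X)) x₀ →
      ∀ᶠ y in 𝓝 x₀, MDifferentiableAt I I.tangent (fun x => (⟨x, U x⟩ : TangentBundle I X)) y := by
    intro U hU
    have h1 : ContMDiffAt I I.tangent 1 (fun x => (⟨x, U x⟩ : TangentBundle I X)) x₀ :=
      hU.of_le (by simp)
    exact ((contMDiffAt_iff_contMDiffAt_nhds (by simp)).1 h1).mono fun y hy =>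
      hy.mdifferentiableAt (by simp)
  have mf : ∀ᶠ y in 𝓝 x₀, MDifferentiableAt I 𝓘(ℝ, ℝ) f y := by
    have h1 : ContMDiffAt I 𝓘(ℝ, ℝ) 1 f x₀ := hf.of_le (by simp)
    exact ((contMDiffAt_iff_contMDiffAt_nhds (by simp)).1 h1).mono fun y hy =>
      hy.mdifferentiableAt (by simp)
  have lift2 : ∀ {U : ∀ x, TangentSpace I x},
      ContMDiffAt I I.tangent ∞ (fun x => (⟨x, U x⟩ : TangentBundle I X)) x₀ →
      ContMDiffAt I I.tangent (minSmoothness ℝ 2) (fun x => (⟨x, U x⟩ : TangentBundle I X)) x₀ :=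
    fun hU => hU.of_le (by simp only [minSmoothness_of_isRCLikeNormedField]; norm_cast)
  have br : ∀ {U U' : ∀ x, TangentSpace I x},
      ContMDiffAt I I.tangent ∞ (fun x => (⟨x, U x⟩ : TangentBundle I X)) x₀ →
      ContMDiffAt I I.tangent ∞ (fun x => (⟨x, U' x⟩ : TangentBundle I X)) x₀ →
      ContMDiffAt I I.tangent ∞
        (fun x => (⟨x, VectorField.mlieBracket I U U' x⟩ : TangentBundle I X)) x₀ :=
    fun hU hU' => ContMDiffAt.mlieBracket_vectorField (m := ⊤) (n := ⊤) hU hU' (by simp)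
  have first : ∀ {U : ∀ x, TangentSpace I x}, VectorField.mlieBracket I U (f • Z)
      =ᶠ[𝓝 x₀] (fun x => dirDeriv I f x (U x)) • Z + f • VectorField.mlieBracket I U Z := by
    intro U
    filter_upwards [md hZ, mf] with y hy hfy
    exact VectorField.mlieBracket_smul_right hfy hy
  have second : ∀ {U U' : ∀ x, TangentSpace I x},
      ContMDiffAt I I.tangent ∞ (fun x => (⟨x, U x⟩ : TangentBundle I X)) x₀ →
      VectorField.mlieBracket I U' (VectorField.mlieBracket I U (f • Z)) x₀
        = dirDeriv I (fun x => dirDeriv I f x (U x)) x₀ (U' x₀) • Z x₀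
          + dirDeriv I f x₀ (U x₀) • VectorField.mlieBracket I U' Z x₀
          + (dirDeriv I f x₀ (U' x₀) • VectorField.mlieBracket I U Z x₀
          + f x₀ • VectorField.mlieBracket I U' (VectorField.mlieBracket I U Z) x₀) := by
    intro U U' hU
    have hUf := (contMDiffAt_dirDeriv hf hU).mdifferentiableAt (by simp)
    have hUZ := (md (br hU hZ)).self_of_nhds
    rw [EventuallyEq.rfl.mlieBracket_vectorField_eq first, VectorField.mlieBracket_add_right
      (hUf.smul_section (md hZ).self_of_nhds) (mf.self_of_nhds.smul_section hUZ),
      VectorField.mlieBracket_smul_right hUf (md hZ).self_of_nhds,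
      VectorField.mlieBracket_smul_right mf.self_of_nhds hUZ]
    rfl
  have hfZ : ContMDiffAt I I.tangent ∞ (fun x => (⟨x, (f • Z) x⟩ : TangentBundle I X)) x₀ :=
    hf.smul_section hZ
  have j1 := VectorField.leibniz_identity_mlieBracket_apply (lift2 hV) (lift2 hW) (lift2 hfZ)
  have j2 := VectorField.leibniz_identity_mlieBracket_apply (lift2 hV) (lift2 hW) (lift2 hZ)
  rw [second hW, second hV, first.self_of_nhds, Pi.add_apply, Pi.smul_apply', Pi.smul_apply',
    j2] at j1
  have j3 : (dirDeriv I f x₀ (VectorField.mlieBracket I V W x₀)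
      - (dirDeriv I (fun x => dirDeriv I f x (W x)) x₀ (V x₀)
        - dirDeriv I (fun x => dirDeriv I f x (V x)) x₀ (W x₀))) • Z x₀ = 0 := by
    rw [smul_add] at j1
    rw [sub_smul, sub_smul]
    linear_combination (norm := module) (-1 : ℝ) • j1
  exact sub_eq_zero.1 ((smul_eq_zero.1 j3).resolve_right hZ0)

end Smooth

/-! ### Extension of local functions and sections -/

section Extension

variable {EX HX : Type*} [NormedAddCommGroup EX] [NormedSpace ℝ EX] [FiniteDimensional ℝ EX]
  [TopologicalSpace HX]
  {I : ModelWithCorners ℝ EX HX} {X : Type*} [TopologicalSpace X] [ChartedSpace HX X]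
  [IsManifold I ∞ X] [T2Space X]

theorem exists_smooth_cutoff {x : X} {U : Set X} (hU : U ∈ 𝓝 x) :
    ∃ χ : X → ℝ, ContMDiff I 𝓘(ℝ, ℝ) ∞ χ ∧ χ =ᶠ[𝓝 x] 1 ∧ tsupport χ ⊆ U := by
  obtain ⟨f, -, hf⟩ := (SmoothBumpFunction.nhds_basis_tsupport (I := I) x).mem_iff.1 hU
  exact ⟨f, f.contMDiff, f.eventuallyEq_one, hf⟩

/-- A function that is smooth near a point agrees near this point with a global one. -/
theorem exists_smooth_extension {x : X} {U : Set X} (hU : IsOpen U) (hx : x ∈ U) {f : X → ℝ}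
    (hf : ContMDiffOn I 𝓘(ℝ, ℝ) ∞ f U) :
    ∃ F : X → ℝ, ContMDiff I 𝓘(ℝ, ℝ) ∞ F ∧ F =ᶠ[𝓝 x] f := by
  obtain ⟨χ, h1, h2, h3⟩ := exists_smooth_cutoff (I := I) (hU.mem_nhds hx)
  refine ⟨fun y => χ y • f y, contMDiff_of_tsupport fun y hy => ?_, ?_⟩
  · have hyU : y ∈ U := h3 (tsupport_smul_subset_left χ f hy)
    exact h1.contMDiffAt.smul ((hf y hyU).contMDiffAt (hU.mem_nhds hyU))
  · filter_upwards [h2] with y hy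
    simp [hy]

/-- A tangent vector that annihilates all smooth functions is zero. -/
theorem eq_zero_of_dirDeriv_eq_zero {x : X} {v : TangentSpace I x}
    (hv : ∀ f : X → ℝ, ContMDiff I 𝓘(ℝ, ℝ) ∞ f → dirDeriv I f x v = 0) : v = 0 := by
  have hI : IsManifold I 1 X := .of_le (n := ∞) (by simp)
  have hinv := isInvertible_mfderiv_extChartAt (I := I) (mem_extChartAt_source (I := I) x)
  obtain ⟨L, hL⟩ := hinv
  have key : mfderiv I 𝓘(ℝ, EX) (extChartAt I x) x v = 0 := by
    refine (SeparatingDual.eq_zero_iff_forall_dual_eq_zero (R := ℝ) (V := EX) _).2 fun ℓ => ?_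
    have hsm : ContMDiffOn I 𝓘(ℝ, ℝ) ∞ (ℓ ∘ extChartAt I x) (chartAt HX x).source :=
      ℓ.contMDiff.comp_contMDiffOn contMDiffOn_extChartAt
    obtain ⟨f, hf, hfe⟩ := exists_smooth_extension (chartAt HX x).open_source
      (mem_chart_source HX x) hsm
    have h1 := hv f hf
    rw [dirDeriv_congr hfe, dirDeriv_comp (J := 𝓘(ℝ, EX))
      ℓ.differentiableAt.mdifferentiableAt (mdifferentiableAt_extChartAt (mem_chart_source HX x))]
      at h1
    rw [← h1, dirDeriv, mfderiv_eq_fderiv, ℓ.fderiv]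
    rfl
  rw [← hL] at key
  exact L.injective (key.trans (map_zero L).symm)

variable {FV : Type*} [NormedAddCommGroup FV] [NormedSpace ℝ FV] {V : X → Type*}
  [TopologicalSpace (TotalSpace FV V)] [∀ x, AddCommGroup (V x)] [∀ x, Module ℝ (V x)]
  [∀ x, TopologicalSpace (V x)] [FiberBundle FV V] [VectorBundle ℝ FV V]

/-- A section that is smooth near a point agrees near this point with a global one. -/
theorem exists_section_extension {x : X} {U : Set X} (hU : IsOpen U) (hx : x ∈ U)
    {s : ∀ x, V x}
    (hs : ContMDiffOn I (I.prod 𝓘(ℝ, FV)) ∞ (fun y => (⟨y, s y⟩ : TotalSpace FV V)) U) :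
    ∃ S : Cₛ^∞⟮I; FV, V⟯, ∀ᶠ y in 𝓝 x, S y = s y := by
  obtain ⟨χ, h1, h2, h3⟩ := exists_smooth_cutoff (I := I) (hU.mem_nhds hx)
  refine ⟨⟨χ • s, h1.contMDiffOn.smul_section_of_tsupport hU h3 hs⟩, ?_⟩
  filter_upwards [h2] with y hy
  change χ y • s y = s y
  simp [hy]

/-- There is a smooth section with a prescribed value at a point. -/
theorem exists_section_apply_eq [ContMDiffVectorBundle ∞ FV V I] (x : X) (v : V x) :
    ∃ S : Cₛ^∞⟮I; FV, V⟯, S x = v := by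
  obtain ⟨U, hU, hs⟩ := FiberBundle.exists_contMDiffOn_extend (k := ∞) I FV v
  obtain ⟨S, hS⟩ := exists_section_extension isOpen_interior (mem_interior_iff_mem_nhds.2 hU)
    (hs.mono interior_subset)
  exact ⟨S, hS.self_of_nhds.trans (FiberBundle.extend_apply_self FV v)⟩

end Extension

/-! ### Smooth families of vectors of a bundle -/

section Families

variable {EX HX : Type*} [NormedAddCommGroup EX] [NormedSpace ℝ EX] [TopologicalSpace HX]
  {I : ModelWithCorners ℝ EX HX} {X : Type*} [TopologicalSpace X] [ChartedSpace HX X]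
  {EP HP : Type*} [NormedAddCommGroup EP] [NormedSpace ℝ EP] [TopologicalSpace HP]
  {K : ModelWithCorners ℝ EP HP} {P : Type*} [TopologicalSpace P] [ChartedSpace HP P]
  {FV : Type*} [NormedAddCommGroup FV] [NormedSpace ℝ FV] {V : X → Type*}
  [TopologicalSpace (TotalSpace FV V)]
  [∀ x, TopologicalSpace (V x)] [FiberBundle FV V] {p₀ : P} {b : P → X}

theorem eventually_mem_baseSet (hb : ContMDiffAt K I ∞ b p₀) :
    ∀ᶠ p in 𝓝 p₀, b p ∈ (trivializationAt FV V (b p₀)).baseSet :=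
  hb.continuousAt.eventually ((trivializationAt FV V (b p₀)).open_baseSet.mem_nhds
    (FiberBundle.mem_baseSet_trivializationAt' (b p₀)))

variable [∀ x, AddCommGroup (V x)] [∀ x, Module ℝ (V x)] [VectorBundle ℝ FV V]

/-- Linear combinations of smooth families of vectors, with smooth coefficients, are smooth. -/
theorem contMDiffAt_sum_smul {ι : Type*} (s : Finset ι) {c : ι → P → ℝ} {z : ι → ∀ p, V (b p)}
    (hb : ContMDiffAt K I ∞ b p₀) (hc : ∀ i ∈ s, ContMDiffAt K 𝓘(ℝ, ℝ) ∞ (c i) p₀)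
    (hz : ∀ i ∈ s, ContMDiffAt K (I.prod 𝓘(ℝ, FV)) ∞
      (fun p => (⟨b p, z i p⟩ : TotalSpace FV V)) p₀) :
    ContMDiffAt K (I.prod 𝓘(ℝ, FV)) ∞
      (fun p => (⟨b p, ∑ i ∈ s, c i p • z i p⟩ : TotalSpace FV V)) p₀ := by
  refine contMDiffAt_totalSpace.2 ⟨hb, ?_⟩
  have h1 : ContMDiffAt K 𝓘(ℝ, FV) ∞ (fun p => ∑ i ∈ s,
      c i p • (trivializationAt FV V (b p₀) ⟨b p, z i p⟩).2) p₀ :=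
    contMDiffAt_finsetSum fun i hi => (hc i hi).smul (contMDiffAt_totalSpace.1 (hz i hi)).2
  refine h1.congr_of_eventuallyEq ?_
  filter_upwards [eventually_mem_baseSet (V := V) (FV := FV) hb] with p hp
  have hlin := Trivialization.linear ℝ (trivializationAt FV V (b p₀)) hp
  exact (map_sum (hlin.mk' _) (fun i => c i p • z i p) s).trans
    (Finset.sum_congr rfl fun i _ => map_smul (hlin.mk' _) (c i p) (z i p))

/-- The coefficients of a smooth family of vectors with respect to smooth families of bases
are smooth: they solve a linear system with smooth coefficients. -/
theorem contMDiffAt_coeff [FiniteDimensional ℝ FV] {ι : Type*} [Fintype ι] {c : ι → P → ℝ}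
    {t : ι → ∀ p, V (b p)}
    {z : ∀ p, V (b p)} (hcard : Module.finrank ℝ FV = Fintype.card ι)
    (hz : ContMDiffAt K (I.prod 𝓘(ℝ, FV)) ∞ (fun p => (⟨b p, z p⟩ : TotalSpace FV V)) p₀)
    (ht : ∀ i, ContMDiffAt K (I.prod 𝓘(ℝ, FV)) ∞
      (fun p => (⟨b p, t i p⟩ : TotalSpace FV V)) p₀)
    (hli : ∀ᶠ p in 𝓝 p₀, LinearIndependent ℝ fun i => t i p)
    (hzt : ∀ᶠ p in 𝓝 p₀, z p = ∑ i, c i p • t i p) (i : ι) :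
    ContMDiffAt K 𝓘(ℝ, ℝ) ∞ (c i) p₀ := by
  classical
  have hb : ContMDiffAt K I ∞ b p₀ := (contMDiffAt_totalSpace.1 hz).1
  let β : Module.Basis ι ℝ FV := (Module.finBasisOfFinrankEq ℝ FV hcard).reindex
    (Fintype.equivFin ι).symm
  have hβ : ∀ (w : ∀ p, V (b p)),
      ContMDiffAt K (I.prod 𝓘(ℝ, FV)) ∞ (fun p => (⟨b p, w p⟩ : TotalSpace FV V)) p₀ →
      ∀ k, ContMDiffAt K 𝓘(ℝ, ℝ) ∞
        (fun p => β.equivFunL (trivializationAt FV V (b p₀) ⟨b p, w p⟩).2 k) p₀ := by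
    intro w hw k
    exact ((ContinuousLinearMap.proj k : (ι → ℝ) →L[ℝ] ℝ).contMDiff.contMDiffAt).comp p₀
      ((β.equivFunL : FV →L[ℝ] ι → ℝ).contMDiff.contMDiffAt.comp p₀
        (contMDiffAt_totalSpace.1 hw).2)
  let S : P → Matrix ι ι ℝ := fun p => Matrix.of fun k i =>
    β.equivFunL (trivializationAt FV V (b p₀) ⟨b p, t i p⟩).2 k
  let ζ : ι → P → ℝ := fun k p => β.equivFunL (trivializationAt FV V (b p₀) ⟨b p, z p⟩).2 k
  have hS : ∀ᶠ p in 𝓝 p₀, IsUnit (S p) ∧ (fun k => ζ k p) = (S p).mulVec fun i => c i p := by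
    filter_upwards [eventually_mem_baseSet (V := V) (FV := FV) hb, hli, hzt]
      with p hp hlip hzp
    let L : V (b p) ≃L[ℝ] FV :=
      (trivializationAt FV V (b p₀)).continuousLinearEquivAt ℝ (b p) hp
    have hL : ∀ v, (trivializationAt FV V (b p₀) ⟨b p, v⟩).2 = L v := fun v => rfl
    constructor
    · rw [← Matrix.linearIndependent_cols_iff_isUnit]
      have := (hlip.map' (L : V (b p) →ₗ[ℝ] FV) (LinearMap.ker_eq_bot.2 L.injective)).map'
        (β.equivFunL : FV →ₗ[ℝ] ι → ℝ) (LinearMap.ker_eq_bot.2 β.equivFunL.injective)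
      exact this
    · ext k
      simp only [ζ, S, Matrix.mulVec, dotProduct, Matrix.of_apply, hL, hzp, map_sum, map_smul,
        Finset.sum_apply, Pi.smul_apply, smul_eq_mul]
      exact Finset.sum_congr rfl fun i _ => mul_comm _ _
  have hsm : ContMDiffAt K 𝓘(ℝ, ℝ) ∞ (fun p => ∑ k, (S p)⁻¹ i k * ζ k p) p₀ :=
    contMDiffAt_finsetSum fun k _ =>
      (contMDiffAt_matrix_inv (fun k i => hβ _ (ht i) k) hS.self_of_nhds.1 i k).mul (hβ _ hz k)
  refine hsm.congr_of_eventuallyEq ?_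
  filter_upwards [hS] with p hp
  have h1 : (S p)⁻¹.mulVec (fun k => ζ k p) = fun i => c i p := by
    rw [hp.2, Matrix.mulVec_mulVec,
      Matrix.nonsing_inv_mul _ ((Matrix.isUnit_iff_isUnit_det _).1 hp.1), Matrix.one_mulVec]
  exact (congrFun h1 i).symm

end Families

/-! ### The anchor and the bracket of a generalized Lie algebroid -/

section Algebroid

variable {m r : ℕ}
  {M : Type*} [TopologicalSpace M] [ChartedSpace (BaseModel m) M] [IsManifold (𝓡 m) ∞ M]
  {N : Type*} [TopologicalSpace N] [ChartedSpace (BaseModel m) N] [IsManifold (𝓡 m) ∞ N]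
  {h : M ≃ₘ^∞⟮𝓡 m, 𝓡 m⟯ N} {η : N ≃ₘ^∞⟮𝓡 m, 𝓡 m⟯ M}
  {F : N → Type*} [TopologicalSpace (TotalSpace (FibModel r) F)]
  [∀ y, AddCommGroup (F y)] [∀ y, Module ℝ (F y)] [∀ y, TopologicalSpace (F y)]
  [FiberBundle (FibModel r) F] [VectorBundle ℝ (FibModel r) F]

theorem section_sum_apply {ι : Type*} (I : Finset ι) (t : ι → Cₛ^∞⟮𝓡 m; FibModel r, F⟯) (y : N) :
    (∑ i ∈ I, t i : Cₛ^∞⟮𝓡 m; FibModel r, F⟯) y = ∑ i ∈ I, t i y :=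
  (congrFun (map_sum (ContMDiffSection.coeAddHom (𝓡 m) (FibModel r) ∞ F) t I) y).trans
    (Finset.sum_apply _ _ _)

namespace GenLieAlgebroid

variable (A : GenLieAlgebroid r h η F)

/-- At `h x`, the vector field `Γ(Th ∘ ρ, h ∘ η)(s)` of `N` is the image under `Th` of the field
`anchorField s` of `M`. -/
theorem anchorAct_apply (s : ∀ κ, F κ) (f : N → ℝ) (x : M) :
    anchorAct h η A.ρ s f (h x) = dirDeriv (𝓡 m) (f ∘ h) x (A.anchorField s x) := by
  -- `h.symm (h x)` and `η (η.symm x)` are only propositionally equal to `x`, so the base points are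
  -- generalized before they are identified.
  have key : ∀ (x₁ x₂ : M) (_ : x₁ = x₂) (κ : N) (hκ : η κ = x₁) (hκ' : η.symm x₂ = κ),
      dirDeriv (𝓡 m) (f ∘ h) (η κ) (A.ρ κ (s κ))
        = dirDeriv (𝓡 m) (f ∘ h) x₂ (A.anchorField s x₂) := by
    rintro x₁ x₂ h12 κ rfl rfl
    unfold anchorField dirDeriv
    rw [h12]
  have hx : h.symm (h x) = x := h.symm_apply_apply x
  refine key x x rfl _ ?_ ?_
  · rw [η.apply_symm_apply, hx]
  · rw [hx]

theorem anchorField_smooth (s : Cₛ^∞⟮𝓡 m; FibModel r, F⟯) :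
    ContMDiff (𝓡 m) (𝓡 m).tangent ∞
      (fun x => (⟨x, A.anchorField s x⟩ : TangentBundle (𝓡 m) M)) := by
  have h1 := A.ρ_smooth.comp (s.contMDiff.comp η.symm.contMDiff)
  have h2 : ∀ (x₁ x₂ : M) (_ : x₁ = x₂) (v : BaseModel m),
      (⟨x₁, v⟩ : TangentBundle (𝓡 m) M) = ⟨x₂, v⟩ := by
    rintro x₁ _ rfl v
    rfl
  convert h1 using 1
  ext1 x
  exact (h2 _ _ (η.apply_symm_apply x) _).symm

theorem bracket_zero (s : Cₛ^∞⟮𝓡 m; FibModel r, F⟯) : A.bracket s 0 = 0 := by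
  have := A.bracket_smul 0 s 0
  simpa using this

theorem bracket_sum {ι : Type*} (I : Finset ι) (s : Cₛ^∞⟮𝓡 m; FibModel r, F⟯)
    (t : ι → Cₛ^∞⟮𝓡 m; FibModel r, F⟯) :
    A.bracket s (∑ i ∈ I, t i) = ∑ i ∈ I, A.bracket s (t i) := by
  classical
  induction I using Finset.induction_on with
  | empty => simpa using A.bracket_zero s
  | insert i I hi ih => rw [Finset.sum_insert hi, Finset.sum_insert hi, A.bracket_add, ih]

theorem bracket_skew_apply (s t : Cₛ^∞⟮𝓡 m; FibModel r, F⟯) (y : N) :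
    A.bracket s t y = - A.bracket t s y := by
  rw [A.bracket_skew s t, ContMDiffSection.coe_neg, Pi.neg_apply]

theorem anchorField_sum {ι : Type*} (I : Finset ι) (c : ι → ℝ)
    (t : ι → Cₛ^∞⟮𝓡 m; FibModel r, F⟯) (x : M) :
    A.anchorField (∑ i ∈ I, c i • t i : Cₛ^∞⟮𝓡 m; FibModel r, F⟯) x
      = ∑ i ∈ I, c i • A.anchorField (t i) x := by
  classical
  induction I using Finset.induction_on with
  | empty => simpa using A.anchorField_zero x
  | insert i I hi ih =>
    rw [Finset.sum_insert hi, Finset.sum_insert hi, ContMDiffSection.coe_add, A.anchorField_add,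
      ih, ContMDiffSection.coe_smul, A.anchorField_smul]

variable [T2Space N]

/-- The anchor at `x` only depends on the value of the section at `h x`. By definition it depends
on the value at `η⁻¹ x`; if `η⁻¹ x ≠ h x`, then evaluating `[g s, f t]` in two ways by means of
the Leibniz rule, with `g` separating the two points, shows that the anchor vanishes. -/
theorem anchorField_eq_zero [T2Space M] [ContMDiffVectorBundle ∞ (FibModel r) F (𝓡 m)]
    {s : Cₛ^∞⟮𝓡 m; FibModel r, F⟯} {x : M} (hs : s (h x) = 0) : A.anchorField s x = 0 := by
  by_cases hκ : η.symm x = h x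
  · have h1 : s (η.symm x) = 0 := by rw [hκ]; exact hs
    unfold anchorField
    rw [h1]
    exact map_zero (A.ρ (η.symm x))
  rcases subsingleton_or_nontrivial (FibModel r) with hr | hr
  · have hF : ∀ y (v : F y), v = 0 := fun y v =>
      ((trivializationAt (FibModel r) F y).continuousLinearEquivAt ℝ y
        (FiberBundle.mem_baseSet_trivializationAt' y)).injective (Subsingleton.elim _ _)
    unfold anchorField
    rw [hF _ (s (η.symm x))]
    exact map_zero (A.ρ (η.symm x))
  obtain ⟨t, ht⟩ : ∃ t : Cₛ^∞⟮𝓡 m; FibModel r, F⟯, t (h x) ≠ 0 := by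
    obtain ⟨z, hz⟩ := exists_ne (0 : FibModel r)
    let L := (trivializationAt (FibModel r) F (h x)).continuousLinearEquivAt ℝ (h x)
        (FiberBundle.mem_baseSet_trivializationAt' (h x))
    obtain ⟨t, ht⟩ := exists_section_apply_eq (I := 𝓡 m) (FV := FibModel r) (V := F) (h x)
      (L.symm z)
    refine ⟨t, fun h0 => hz ?_⟩
    rw [ht] at h0
    exact L.symm.injective (h0.trans (map_zero L.symm).symm)
  refine eq_zero_of_dirDeriv_eq_zero fun f hf => ?_
  have hff : (f ∘ h.symm) ∘ h = f := by
    ext z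
    simp
  rw [← hff, ← A.anchorAct_apply s (f ∘ h.symm)]
  have hf' : ContMDiff (𝓡 m) 𝓘(ℝ, ℝ) ∞ (f ∘ h.symm) := hf.comp h.symm.contMDiff
  generalize f ∘ h.symm = f' at hf'
  obtain ⟨g, hg, hg1, hg2⟩ := exists_smooth_cutoff (I := 𝓡 m)
    (isOpen_compl_singleton.mem_nhds (fun h' => hκ h'.symm : h x ∈ ({η.symm x}ᶜ : Set N)))
  have hgx : g (h x) = 1 := hg1.self_of_nhds
  have hgκ : g (η.symm x) = 0 := by
    by_contra h0
    exact hg2 (subset_tsupport g h0) rfl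
  let gs : Cₛ^∞⟮𝓡 m; FibModel r, F⟯ := ⟨g • ⇑s, hg.smul_section s.contMDiff⟩
  let ft : Cₛ^∞⟮𝓡 m; FibModel r, F⟯ := ⟨f' • ⇑t, hf'.smul_section t.contMDiff⟩
  have h0 : anchorAct h η A.ρ gs f' (h x) = 0 := by
    have h1 : gs (η.symm x) = 0 := by
      change g (η.symm x) • s (η.symm x) = 0
      rw [hgκ, zero_smul]
    rw [A.anchorAct_apply]
    unfold anchorField
    rw [h1, map_zero]
    exact dirDeriv_vec_zero
  have hgs : ∀ w : Cₛ^∞⟮𝓡 m; FibModel r, F⟯, A.bracket gs w (h x) = A.bracket s w (h x) := by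
    intro w
    rw [A.bracket_skew_apply, A.leibniz w s gs g hg (fun _ => rfl), hs, hgx, smul_zero, one_smul,
      add_zero, ← A.bracket_skew_apply]
  -- `[g s, f t]` at `h x`, by the Leibniz rule for `f t`: for `g s` there is no anchor term, and
  -- for `s` there is one, although `[g s, ·] = [s, ·]` there.
  have e1 := A.leibniz gs t ft f' hf' (fun _ => rfl) (h x)
  have e2 := A.leibniz s t ft f' hf' (fun _ => rfl) (h x)
  rw [h0, hgs, hgs, e2] at e1
  have e3 : anchorAct h η A.ρ s f' (h x) • t (h x) = 0 := by simpa using e1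
  exact (smul_eq_zero.1 e3).resolve_right ht

theorem anchorField_congr [T2Space M] [ContMDiffVectorBundle ∞ (FibModel r) F (𝓡 m)]
    {s t : Cₛ^∞⟮𝓡 m; FibModel r, F⟯} {x : M} (hst : s (h x) = t (h x)) :
    A.anchorField s x = A.anchorField t x := by
  have h1 : (s + (-1 : ℝ) • t) (h x) = 0 := by
    simp [hst]
  have h2 := A.anchorField_eq_zero h1
  rw [ContMDiffSection.coe_add, ContMDiffSection.coe_smul, A.anchorField_add,
    A.anchorField_smul, neg_one_smul] at h2
  exact add_neg_eq_zero.1 h2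

/-- The bracket is local. -/
theorem bracket_congr_right {s t t' : Cₛ^∞⟮𝓡 m; FibModel r, F⟯} {y : N}
    (htt' : ∀ᶠ z in 𝓝 y, t z = t' z) : A.bracket s t y = A.bracket s t' y := by
  obtain ⟨χ, hχ, hχ1, hχ2⟩ := exists_smooth_cutoff (I := 𝓡 m) htt'
  have h1 : ∀ z, (t + (-1 : ℝ) • t') z = (1 - χ z) • (t + (-1 : ℝ) • t') z := by
    intro z
    by_cases hz : t z = t' z
    · simp [hz]
    · have : χ z = 0 := by
        by_contra h0
        exact hz (hχ2 (subset_tsupport χ h0))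
      simp [this]
  have h2 := A.leibniz s (t + (-1 : ℝ) • t') (t + (-1 : ℝ) • t') (fun z => 1 - χ z)
    (contMDiff_const.sub hχ) h1 y
  have h3 : χ y = 1 := hχ1.self_of_nhds
  rw [h3, A.bracket_add, A.bracket_smul] at h2
  simp [htt'.self_of_nhds] at h2
  exact add_neg_eq_zero.1 h2

/-- The Leibniz rule for a section that is given only locally as a linear combination. -/
theorem bracket_apply_of_eq_sum {ι : Type*} [Fintype ι] (s : Cₛ^∞⟮𝓡 m; FibModel r, F⟯)
    {w : Cₛ^∞⟮𝓡 m; FibModel r, F⟯} {t : ι → Cₛ^∞⟮𝓡 m; FibModel r, F⟯} {U : Set M}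
    (hU : IsOpen U) {x : M} (hx : x ∈ U) {τ : ι → M → ℝ}
    (hτ : ∀ i, ContMDiffOn (𝓡 m) 𝓘(ℝ, ℝ) ∞ (τ i) U)
    (hw : ∀ x ∈ U, w (h x) = ∑ i, τ i x • t i (h x)) :
    A.bracket s w (h x) = ∑ i, (τ i x • A.bracket s (t i) (h x)
      + dirDeriv (𝓡 m) (τ i) x (A.anchorField s x) • t i (h x)) := by
  have hV : IsOpen (h.symm ⁻¹' U) := hU.preimage h.symm.continuous
  have hxV : h x ∈ h.symm ⁻¹' U := by simpa using hx
  have hτ' : ∀ i, ContMDiffOn (𝓡 m) 𝓘(ℝ, ℝ) ∞ (τ i ∘ h.symm) (h.symm ⁻¹' U) := fun i =>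
    (hτ i).comp h.symm.contMDiff.contMDiffOn fun _ hz => hz
  choose T hT hTe using fun i => exists_smooth_extension hV hxV (hτ' i)
  let W : ι → Cₛ^∞⟮𝓡 m; FibModel r, F⟯ := fun i =>
    ⟨T i • ⇑(t i), (hT i).smul_section (t i).contMDiff⟩
  have h1 : ∀ᶠ z in 𝓝 (h x), w z = (∑ i, W i : Cₛ^∞⟮𝓡 m; FibModel r, F⟯) z := by
    filter_upwards [hV.mem_nhds hxV, eventually_all.2 hTe] with z hz hTz
    rw [section_sum_apply]
    have h3 := hw (h.symm z) hz
    rw [h.apply_symm_apply] at h3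
    rw [h3]
    refine Finset.sum_congr rfl fun i _ => ?_
    change _ = T i z • t i z
    rw [hTz i]
    rfl
  rw [A.bracket_congr_right h1, A.bracket_sum, section_sum_apply]
  refine Finset.sum_congr rfl fun i _ => ?_
  rw [A.leibniz s (t i) (W i) (T i) (hT i) (fun _ => rfl), A.anchorAct_apply]
  have h4 : T i ∘ h =ᶠ[𝓝 x] τ i := by
    filter_upwards [h.continuous.continuousAt.eventually (hTe i)] with z hz
    simp only [Function.comp_apply] at hz ⊢
    rw [hz, h.symm_apply_apply]
  rw [dirDeriv_congr h4, ← h4.self_of_nhds]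
  rfl

/-- The bracket of two sections that are given locally as linear combinations. -/
theorem bracket_apply_of_eq_sum_sum [T2Space M] [ContMDiffVectorBundle ∞ (FibModel r) F (𝓡 m)]
    {ι : Type*} [Fintype ι] {s w : Cₛ^∞⟮𝓡 m; FibModel r, F⟯}
    {t : ι → Cₛ^∞⟮𝓡 m; FibModel r, F⟯} {U : Set M} (hU : IsOpen U) {x : M} (hx : x ∈ U)
    {σ τ : ι → M → ℝ} (hσ : ∀ i, ContMDiffOn (𝓡 m) 𝓘(ℝ, ℝ) ∞ (σ i) U)
    (hτ : ∀ i, ContMDiffOn (𝓡 m) 𝓘(ℝ, ℝ) ∞ (τ i) U)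
    (hs : ∀ x ∈ U, s (h x) = ∑ i, σ i x • t i (h x))
    (hw : ∀ x ∈ U, w (h x) = ∑ i, τ i x • t i (h x)) :
    A.bracket s w (h x) = ∑ i, ∑ j, (σ i x * τ j x) • A.bracket (t i) (t j) (h x)
      + ∑ i, (dirDeriv (𝓡 m) (τ i) x (A.anchorField s x)
        - dirDeriv (𝓡 m) (σ i) x (A.anchorField w x)) • t i (h x) := by
  have h1 : A.anchorField w x = ∑ i, τ i x • A.anchorField (t i) x := by
    rw [← A.anchorField_sum]
    apply A.anchorField_congr
    rw [hw x hx, section_sum_apply]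
    rfl
  have h2 : ∀ i, dirDeriv (𝓡 m) (σ i) x (A.anchorField w x)
      = ∑ j, τ j x * dirDeriv (𝓡 m) (σ i) x (A.anchorField (t j) x) := by
    intro i
    rw [h1]
    unfold dirDeriv
    refine (map_sum (mfderiv (𝓡 m) 𝓘(ℝ, ℝ) (σ i) x) _ _).trans (Finset.sum_congr rfl fun j _ => ?_)
    exact map_smul (mfderiv (𝓡 m) 𝓘(ℝ, ℝ) (σ i) x) _ _
  have h3 : ∀ j, A.bracket s (t j) (h x) = ∑ i, (σ i x • A.bracket (t i) (t j) (h x)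
      - dirDeriv (𝓡 m) (σ i) x (A.anchorField (t j) x) • t i (h x)) := by
    intro j
    rw [A.bracket_skew_apply, A.bracket_apply_of_eq_sum (t j) hU hx hσ hs, ← Finset.sum_neg_distrib]
    refine Finset.sum_congr rfl fun i _ => ?_
    rw [A.bracket_skew_apply (t i) (t j)]
    module
  rw [A.bracket_apply_of_eq_sum s hU hx hτ hw]
  simp only [h2, h3, sub_smul, Finset.sum_add_distrib, Finset.sum_sub_distrib, Finset.smul_sum,
    Finset.sum_smul, smul_sub, smul_smul]
  rw [Finset.sum_comm (f := fun i j => (τ i x * σ j x) • A.bracket (t j) (t i) (h x)),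
    Finset.sum_comm (f := fun i j => (τ i x * dirDeriv (𝓡 m) (σ j) x (A.anchorField (t i) x))
      • t j (h x))]
  simp only [mul_comm (τ _ x) (σ _ x)]
  abel

end GenLieAlgebroid

end Algebroid

/-! ### The tangent bundle of the dual bundle -/

section Dual

variable {m r : ℕ}
  {M : Type*} [TopologicalSpace M] [ChartedSpace (BaseModel m) M]
  {E : M → Type*} [TopologicalSpace (TotalSpace (FibModel r) E)]
  [∀ x, AddCommGroup (E x)] [∀ x, Module ℝ (E x)] [∀ x, TopologicalSpace (E x)]
  [FiberBundle (FibModel r) E] [VectorBundle ℝ (FibModel r) E]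
  [ContMDiffVectorBundle ∞ (FibModel r) E (𝓡 m)]

theorem finrank_dualModel : Module.finrank ℝ (DualModel r) = r := by
  have h1 : Module.finrank ℝ (DualModel r) = Module.finrank ℝ (FibModel r →ₗ[ℝ] ℝ) :=
    (LinearMap.toContinuousLinearMap (𝕜 := ℝ) (E := FibModel r) (F' := ℝ)).finrank_eq.symm
  rw [h1, Module.finrank_linearMap]
  simp

theorem dualProj_contMDiff : ContMDiff (DualI m r) (𝓡 m) ∞ (dualProj (r := r) E) :=
  Bundle.contMDiff_proj (DualFib E) (IB := 𝓡 m)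

/-- The curves `τ ↦ u + τ s (π u)` depend smoothly on `u`. -/
theorem vertCurve_smooth (s : Cₛ^∞⟮𝓡 m; DualModel r, DualFib E⟯) (p : DualTot r E × ℝ) :
    ContMDiffAt ((DualI m r).prod 𝓘(ℝ, ℝ)) (DualI m r) ∞
      (fun p : DualTot r E × ℝ => (⟨p.1.1, p.1.2 + p.2 • s p.1.1⟩ : DualTot r E)) p := by
  have hb : ContMDiffAt ((DualI m r).prod 𝓘(ℝ, ℝ)) (𝓡 m) ∞ (fun p : DualTot r E × ℝ => p.1.1) p :=
    dualProj_contMDiff.contMDiffAt.comp p contMDiffAt_fst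
  have h1 := contMDiffAt_sum_smul (V := DualFib E) (FV := DualModel r) (ι := Fin 2) Finset.univ
    (c := fun i p => if i = 0 then 1 else p.2)
    (z := fun i p => if i = 0 then p.1.2 else s p.1.1) hb
    (by
      intro i _
      fin_cases i
      · exact contMDiffAt_const
      · exact contMDiffAt_snd)
    (by
      intro i _
      fin_cases i
      · exact contMDiffAt_fst
      · exact (s.contMDiff.contMDiffAt (x := p.1.1)).comp p hb)
  simpa [Fin.sum_univ_two] using h1

/-- Tangent vectors at equal points with the same coordinates are equal: the tangent spaces at all
points are the same type by definition. -/
theorem tangentBundle_mk_congr {EX HX : Type*} [NormedAddCommGroup EX] [NormedSpace ℝ EX]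
    [TopologicalSpace HX] {I : ModelWithCorners ℝ EX HX} {X : Type*} [TopologicalSpace X]
    [ChartedSpace HX X] {x₁ x₂ : X} (hx : x₁ = x₂) (v : EX) :
    (⟨x₁, v⟩ : TangentBundle I X) = ⟨x₂, v⟩ := by
  subst hx
  rfl

/-- Vertical lifts of smooth sections of `E*` are smooth vector fields on `E*`. -/
theorem vertVec_smooth [IsManifold (𝓡 m) ∞ M] (s : Cₛ^∞⟮𝓡 m; DualModel r, DualFib E⟯)
    (u : DualTot r E) :
    ContMDiffAt (DualI m r) (DualI m r).tangent ∞
      (fun v => (⟨v, vertVec m v (s v.1)⟩ : TangentBundle (DualI m r) (DualTot r E))) u := by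
  have h1 := contMDiffAt_mfderiv_family (K := DualI m r) (I := 𝓘(ℝ, ℝ)) (J := DualI m r)
    (p₀ := u) (f := fun (v : DualTot r E) (τ : ℝ) => (⟨v.1, v.2 + τ • s v.1⟩ : DualTot r E))
    (c := fun _ => 0) (vertCurve_smooth s (u, 0)) contMDiffAt_const (v := fun _ => (1 : ℝ))
    contMDiffAt_const
  convert h1 using 1
  ext1 v
  exact tangentBundle_mk_congr (by simp) _

theorem dirDeriv_curve {EX HX : Type*} [NormedAddCommGroup EX] [NormedSpace ℝ EX]
    [TopologicalSpace HX] {I : ModelWithCorners ℝ EX HX} {X : Type*} [TopologicalSpace X]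
    [ChartedSpace HX X] {c : ℝ → X} {u : X} (hu : c 0 = u) {q : X → ℝ}
    (hq : MDifferentiableAt I 𝓘(ℝ, ℝ) q u) (hc : MDifferentiableAt 𝓘(ℝ, ℝ) I c 0) {b : ℝ}
    (hqc : ∀ τ, q (c τ) = q u + τ * b) :
    dirDeriv I q u ((mfderiv 𝓘(ℝ, ℝ) I c 0 (1 : ℝ) :) : TangentSpace I u) = b := by
  subst hu
  have h1 := dirDeriv_comp hq hc (1 : ℝ)
  have h2 : HasDerivAt (q ∘ c) b 0 := by
    have : q ∘ c = fun τ => q (c 0) + τ * b := funext hqc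
    rw [this]
    simpa using ((hasDerivAt_id (0 : ℝ)).mul_const b).const_add (q (c 0))
  have h3 : mfderiv 𝓘(ℝ, ℝ) 𝓘(ℝ, ℝ) (q ∘ c) 0 = fderiv ℝ (q ∘ c) 0 := mfderiv_eq_fderiv
  exact h1.symm.trans ((congrArg (fun L : ℝ →L[ℝ] ℝ => L 1) (h3.trans h2.hasFDerivAt.fderiv)).trans
    (by simp))

/-- A function that is affine along the line `u + τ s (π u)` has the slope as its derivative along
the vertical lift. -/
theorem dirDeriv_vertVec (s : Cₛ^∞⟮𝓡 m; DualModel r, DualFib E⟯) {u : DualTot r E}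
    {q : DualTot r E → ℝ} (hq : MDifferentiableAt (DualI m r) 𝓘(ℝ, ℝ) q u) {b : ℝ}
    (hqc : ∀ τ : ℝ, q ⟨u.1, u.2 + τ • s u.1⟩ = q u + τ * b) :
    dirDeriv (DualI m r) q u (vertVec m u (s u.1)) = b := by
  refine dirDeriv_curve (c := fun τ : ℝ => (⟨u.1, u.2 + τ • s u.1⟩ : DualTot r E)) (by simp) hq
    ?_ hqc
  have h1 : ContMDiffAt 𝓘(ℝ, ℝ) (DualI m r) ∞
      (fun τ : ℝ => (⟨u.1, u.2 + τ • s u.1⟩ : DualTot r E)) 0 :=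
    (vertCurve_smooth s (u, 0)).comp (0 : ℝ) (contMDiffAt_const.prodMk contMDiffAt_id)
  exact h1.mdifferentiableAt (by simp)

theorem finrank_fibre (x : M) : Module.finrank ℝ (E x) = r ∧ FiniteDimensional ℝ (E x) := by
  have L := ((trivializationAt (FibModel r) E x).continuousLinearEquivAt ℝ x
    (FiberBundle.mem_baseSet_trivializationAt' x)).toLinearEquiv
  exact ⟨by rw [L.finrank_eq]; simp, L.symm.finiteDimensional⟩

/-- Vectors `ν a` that are dual to functionals `q a` form a basis of a kernel of dimension `r`. -/
theorem eq_sum_of_mem_ker {V W : Type*} [AddCommGroup V] [Module ℝ V] [FiniteDimensional ℝ V]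
    [AddCommGroup W] [Module ℝ W] (T : V →ₗ[ℝ] W) (hT : Function.Surjective T)
    (hrank : Module.finrank ℝ V = Module.finrank ℝ W + r) (ν : Fin r → V) (hν : ∀ a, T (ν a) = 0)
    (q : Fin r → V →ₗ[ℝ] ℝ) (hqν : ∀ a b, q a (ν b) = if b = a then (1 : ℝ) else 0) {w : V}
    (hw : T w = 0) : w = ∑ a, q a w • ν a := by
  have hrank : Module.finrank ℝ (LinearMap.ker T) = r := by
    have h1 := T.finrank_range_add_finrank_ker
    rw [LinearMap.range_eq_top.2 hT, finrank_top] at h1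
    omega
  let ν' : Fin r → LinearMap.ker T := fun a => ⟨ν a, hν a⟩
  have hli : LinearIndependent ℝ ν' := by
    rw [Fintype.linearIndependent_iff]
    intro c hc a
    have h1 := congrArg (fun v : LinearMap.ker T => q a v) hc
    simp only [Submodule.coe_sum, Submodule.coe_smul, map_sum, map_smul, ν', hqν] at h1
    simpa using h1
  have hspan := hli.span_eq_top_of_card_eq_finrank' (by rw [hrank, Fintype.card_fin])
  have hv : (⟨w, hw⟩ : LinearMap.ker T) ∈ Submodule.span ℝ (Set.range ν') := by
    rw [hspan]
    trivial
  obtain ⟨c, hc⟩ := (Submodule.mem_span_range_iff_exists_fun ℝ).1 hv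
  have hc' : w = ∑ a, c a • ν a := by
    have := congrArg Subtype.val hc
    simpa [ν'] using this.symm
  conv_lhs => rw [hc']
  refine Finset.sum_congr rfl fun a _ => ?_
  rw [hc']
  simp [map_sum, hqν]

variable [T2Space M] [IsManifold (𝓡 m) ∞ M]

/-- The projection `E* → M` is a submersion, since there is a section through every point. -/
theorem mfderiv_dualProj_surjective (u : DualTot r E) :
    Function.Surjective (mfderiv (DualI m r) (𝓡 m) (dualProj (r := r) E) u) := by
  obtain ⟨S, hS⟩ := exists_section_apply_eq (I := 𝓡 m) (FV := DualModel r) (V := DualFib E) u.1 u.2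
  obtain ⟨x, φ⟩ := u
  simp only at hS
  subst hS
  intro v
  have h1 := mfderiv_comp_apply x
    ((dualProj_contMDiff.contMDiffAt (x := (⟨x, S x⟩ : DualTot r E))).mdifferentiableAt (by simp))
    ((S.contMDiff.contMDiffAt (x := x)).mdifferentiableAt (by simp)) v
  have h2 : dualProj (r := r) E ∘ (fun x => (⟨x, S x⟩ : DualTot r E)) = id := rfl
  rw [h2, mfderiv_id] at h1
  exact ⟨_, h1.symm⟩

/-- Smooth sections of `E*` that are dual to some frame of `E`, not assumed smooth, over `U`. -/
structure DualPair (U : Set M) (s : Fin r → Cₛ^∞⟮𝓡 m; DualModel r, DualFib E⟯)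
    (e : ∀ x, Fin r → E x) : Prop where
  isOpen : IsOpen U
  dual : ∀ x ∈ U, ∀ a b, s a x (e x b) = if a = b then (1 : ℝ) else 0

/-- The fibre coordinates `p_a` on `E*`. -/
def fibreCoord (e : ∀ x, Fin r → E x) (a : Fin r) (u : DualTot r E) : ℝ := u.2 (e u.1 a)

namespace DualPair

variable {U : Set M} {s : Fin r → Cₛ^∞⟮𝓡 m; DualModel r, DualFib E⟯} {e : ∀ x, Fin r → E x}

theorem linearIndependent (P : DualPair U s e) {x : M} (hx : x ∈ U) :
    LinearIndependent ℝ (e x) := by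
  rw [Fintype.linearIndependent_iff]
  intro c hc a
  have h1 := congrArg (fun v => (s a x v : ℝ)) hc
  simp only [map_sum, map_smul, P.dual x hx, map_zero] at h1
  simpa using h1

theorem expand (P : DualPair U s e) {x : M} (hx : x ∈ U) (v : E x) :
    v = ∑ a, (s a x v : ℝ) • e x a := by
  obtain ⟨hr, hfin⟩ := finrank_fibre (r := r) (E := E) x
  have hspan := (P.linearIndependent hx).span_eq_top_of_card_eq_finrank' (by
    rw [hr, Fintype.card_fin])
  have hv : v ∈ Submodule.span ℝ (Set.range (e x)) := by
    rw [hspan]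
    trivial
  obtain ⟨c, hc⟩ := (Submodule.mem_span_range_iff_exists_fun ℝ).1 hv
  rw [← hc]
  refine Finset.sum_congr rfl fun a _ => ?_
  congr 1
  simp only [map_sum, map_smul, P.dual x hx]
  simp

theorem dual_expand (P : DualPair U s e) {x : M} (hx : x ∈ U) (φ : DualFib E x) :
    φ = ∑ a, (φ (e x a) : ℝ) • s a x := by
  ext v
  conv_lhs => rw [P.expand hx v]
  simp only [map_sum, map_smul, sum_apply, smul_apply,
    smul_eq_mul]
  exact Finset.sum_congr rfl fun a _ => mul_comm _ _

theorem dual_linearIndependent (P : DualPair U s e) {x : M} (hx : x ∈ U) :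
    LinearIndependent ℝ (fun a => s a x) := by
  rw [Fintype.linearIndependent_iff]
  intro c hc a
  have h1 := congrArg (fun φ : DualFib E x => (φ (e x a) : ℝ)) hc
  simp only [sum_apply, smul_apply, P.dual x hx] at h1
  simpa using h1

theorem eventually_mem (P : DualPair U s e) {u : DualTot r E} (hu : u.1 ∈ U) :
    ∀ᶠ v : DualTot r E in 𝓝 u, v.1 ∈ U :=
  (dualProj_contMDiff (m := m) (E := E)).continuous.continuousAt.eventually
    (P.isOpen.mem_nhds hu)

theorem fibreCoord_smooth (P : DualPair U s e) {u : DualTot r E} (hu : u.1 ∈ U) (a : Fin r) :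
    ContMDiffAt (DualI m r) 𝓘(ℝ, ℝ) ∞ (fibreCoord e a) u := by
  have hev := P.eventually_mem hu
  refine contMDiffAt_coeff (V := DualFib E) (FV := DualModel r) (I := 𝓡 m)
    (b := fun v : DualTot r E => v.1) (c := fibreCoord e) (t := fun a v => s a v.1)
    (z := fun v => v.2) (by rw [finrank_dualModel, Fintype.card_fin]) contMDiffAt_id ?_ ?_ ?_ a
  · intro b
    exact ((s b).contMDiff.contMDiffAt (x := u.1)).comp u dualProj_contMDiff.contMDiffAt
  · exact hev.mono fun v hv => P.dual_linearIndependent hv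
  · exact hev.mono fun v hv => P.dual_expand hv v.2

theorem dirDeriv_fibreCoord (P : DualPair U s e) {u : DualTot r E} (hu : u.1 ∈ U) (a : Fin r)
    (σ : Cₛ^∞⟮𝓡 m; DualModel r, DualFib E⟯) :
    dirDeriv (DualI m r) (fibreCoord e a) u (vertVec m u (σ u.1)) = σ u.1 (e u.1 a) :=
  dirDeriv_vertVec σ ((P.fibreCoord_smooth hu a).mdifferentiableAt (by simp)) fun τ => by
    simp [fibreCoord]

/-- A vertical vector is determined by its derivatives of the fibre coordinates. -/
theorem expand_vertical (P : DualPair U s e) {u : DualTot r E} (hu : u.1 ∈ U)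
    {w : TangentSpace (DualI m r) u}
    (hw : mfderiv (DualI m r) (𝓡 m) (dualProj (r := r) E) u w = 0) :
    w = ∑ a, dirDeriv (DualI m r) (fibreCoord e a) u w • vertVec m u (s a u.1) := by
  have hfr : Module.finrank ℝ (BaseModel m × DualModel r) = Module.finrank ℝ (BaseModel m) + r := by
    rw [Module.finrank_prod, finrank_dualModel]
  let T₀ : (BaseModel m × DualModel r) →L[ℝ] BaseModel m :=
    mfderiv (DualI m r) (𝓡 m) (dualProj (r := r) E) u
  let q : Fin r → (BaseModel m × DualModel r) →L[ℝ] ℝ := fun a =>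
    mfderiv (DualI m r) 𝓘(ℝ, ℝ) (fibreCoord e a) u
  exact eq_sum_of_mem_ker (T₀ : (BaseModel m × DualModel r) →ₗ[ℝ] BaseModel m)
    (mfderiv_dualProj_surjective u) hfr (fun a => vertVec m u (s a u.1))
    (fun a => dualProj_vertVec m u (s a u.1)) (fun a => (q a : _ →ₗ[ℝ] ℝ))
    (fun a b => (P.dirDeriv_fibreCoord hu a (s b)).trans (P.dual u.1 hu b a)) hw

/-- A vector field on `M` lifts locally to a smooth vector field on `E*`: move a covector with
constant coefficients with respect to the frame. -/
theorem exists_lift (P : DualPair U s e) {X : ∀ x, TangentSpace (𝓡 m) x}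
    (hX : ContMDiff (𝓡 m) (𝓡 m).tangent ∞ (fun x => (⟨x, X x⟩ : TangentBundle (𝓡 m) M)))
    {u : DualTot r E} (hu : u.1 ∈ U) :
    ∃ W : ∀ v : DualTot r E, TangentSpace (DualI m r) v,
      ContMDiffAt (DualI m r) (DualI m r).tangent ∞
        (fun v => (⟨v, W v⟩ : TangentBundle (DualI m r) (DualTot r E))) u ∧
      ∀ v : DualTot r E, v.1 ∈ U →
        mfderiv (DualI m r) (𝓡 m) (dualProj (r := r) E) v (W v) = X v.1 := by
  let f : DualTot r E → M → DualTot r E := fun v x => ⟨x, ∑ a, fibreCoord e a v • s a x⟩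
  have hfv : ∀ v : DualTot r E, v.1 ∈ U → f v v.1 = v := by
    intro v hv
    change (⟨v.1, ∑ a, (v.2 (e v.1 a) : ℝ) • s a v.1⟩ : DualTot r E) = v
    rw [← P.dual_expand hv v.2]
  have hsm : ∀ v : DualTot r E, v.1 ∈ U → ∀ x,
      ContMDiffAt ((DualI m r).prod (𝓡 m)) (DualI m r) ∞ (Function.uncurry f) (v, x) := by
    intro v hv x
    refine contMDiffAt_sum_smul (V := DualFib E) (FV := DualModel r) Finset.univ
      (b := fun p : DualTot r E × M => p.2) (c := fun a p => fibreCoord e a p.1)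
      (z := fun a p => s a p.2) contMDiffAt_snd ?_ ?_
    · intro a _
      have h2 : ContMDiffAt ((DualI m r).prod (𝓡 m)) (DualI m r) ∞
          (fun p : DualTot r E × M => p.1) (v, x) := contMDiffAt_fst
      exact ContMDiffAt.comp (v, x) (P.fibreCoord_smooth hv a) h2
    · intro a _
      have h2 : ContMDiffAt ((DualI m r).prod (𝓡 m)) (𝓡 m) ∞
          (fun p : DualTot r E × M => p.2) (v, x) := contMDiffAt_snd
      exact ContMDiffAt.comp (v, x) ((s a).contMDiff.contMDiffAt (x := x)) h2
  refine ⟨fun v => (mfderiv (𝓡 m) (DualI m r) (f v) v.1 (X v.1) :), ?_, ?_⟩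
  · have h1 := contMDiffAt_mfderiv_family (K := DualI m r) (I := 𝓡 m) (J := DualI m r)
      (p₀ := u) (f := f) (c := fun v => v.1) (hsm u hu u.1) dualProj_contMDiff.contMDiffAt
      (v := fun v => X v.1) (hX.contMDiffAt.comp u dualProj_contMDiff.contMDiffAt)
    refine h1.congr_of_eventuallyEq ?_
    filter_upwards [P.eventually_mem hu] with v hv
    exact tangentBundle_mk_congr (hfv v hv).symm _
  · intro v hv
    have hfd : MDifferentiableAt (𝓡 m) (DualI m r) (f v) v.1 :=
      ((hsm v hv v.1).comp v.1 (contMDiffAt_const.prodMk contMDiffAt_id)).mdifferentiableAt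
        (by simp)
    have h1 := mfderiv_comp_apply v.1
      (((dualProj_contMDiff (m := m) (E := E)).contMDiffAt (x := f v v.1)).mdifferentiableAt
        (by simp)) hfd (X v.1)
    have h2 : dualProj (r := r) E ∘ f v = id := rfl
    rw [h2, mfderiv_id] at h1
    have h3 : ∀ (v₁ v₂ : DualTot r E) (_ : v₁ = v₂) (w : BaseModel m × DualModel r),
        (mfderiv (DualI m r) (𝓡 m) (dualProj (r := r) E) v₁ w : BaseModel m)
          = mfderiv (DualI m r) (𝓡 m) (dualProj (r := r) E) v₂ w := by
      rintro v₁ _ rfl w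
      rfl
    exact (h3 _ _ (hfv v hv).symm _).trans h1.symm

end DualPair

end Dual

section Tangent

variable {m r : ℕ}
  {M : Type*} [TopologicalSpace M] [ChartedSpace (BaseModel m) M] [IsManifold (𝓡 m) ∞ M]
  [T2Space M]
  {N : Type*} [TopologicalSpace N] [ChartedSpace (BaseModel m) N] [IsManifold (𝓡 m) ∞ N]
  [T2Space N]
  {h : M ≃ₘ^∞⟮𝓡 m, 𝓡 m⟯ N} {η : N ≃ₘ^∞⟮𝓡 m, 𝓡 m⟯ M}
  {E : M → Type*} [TopologicalSpace (TotalSpace (FibModel r) E)]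
  [∀ x, AddCommGroup (E x)] [∀ x, Module ℝ (E x)] [∀ x, TopologicalSpace (E x)]
  [FiberBundle (FibModel r) E] [VectorBundle ℝ (FibModel r) E]
  [ContMDiffVectorBundle ∞ (FibModel r) E (𝓡 m)]
  {F : N → Type*} [TopologicalSpace (TotalSpace (FibModel r) F)]
  [∀ y, AddCommGroup (F y)] [∀ y, Module ℝ (F y)] [∀ y, TopologicalSpace (F y)]
  [FiberBundle (FibModel r) F] [VectorBundle ℝ (FibModel r) F]
  [ContMDiffVectorBundle ∞ (FibModel r) F (𝓡 m)]
  {A : GenLieAlgebroid r h η F}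

/-! ### Sections of the generalized tangent bundle -/

theorem GT.ext {u : DualTot r E} {p q : GT E A u} (hz : zPart u p = zPart u q)
    (hw : wPart u p = wPart u q) : p = q :=
  Subtype.ext (Prod.ext hz hw)

/-- The anchor of a vector of `(ρ, η)TE*` lies over the anchor of its component in `F`. -/
theorem mfderiv_dualProj_wPart {u : DualTot r E} (p : GT E A u) {s : Cₛ^∞⟮𝓡 m; FibModel r, F⟯}
    (hs : s (h u.1) = zPart u p) :
    mfderiv (DualI m r) (𝓡 m) (dualProj (r := r) E) u (wPart u p) = A.anchorField s u.1 := by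
  obtain ⟨t, ht, ht'⟩ := p.2
  exact ht'.trans (A.anchorField_congr (ht.trans hs.symm))

theorem mem_vert_iff {u : DualTot r E} {p : GT E A u} : p ∈ Vert A u ↔ zPart u p = 0 :=
  LinearMap.mem_ker

theorem mfderiv_dualProj_wPart_of_mem_vert {u : DualTot r E} {p : GT E A u} (hp : p ∈ Vert A u) :
    mfderiv (DualI m r) (𝓡 m) (dualProj (r := r) E) u (wPart u p) = 0 := by
  rw [mfderiv_dualProj_wPart p (s := 0) (mem_vert_iff.1 hp).symm, ContMDiffSection.coe_zero]
  exact A.anchorField_zero u.1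

/-- The derivative of a function along a vector of `(ρ, η)TE*`, as a linear form. -/
def actAt (f : DualTot r E → ℝ) (u : DualTot r E) : GT E A u →ₗ[ℝ] ℝ where
  toFun p := dirDeriv (DualI m r) f u (wPart u p)
  map_add' p q := by rw [map_add, dirDeriv_vec_add]
  map_smul' c p := by rw [map_smul, dirDeriv_vec_smul]; rfl

theorem act_eq_actAt (X : RawSection E A) (f : DualTot r E → ℝ) (u : DualTot r E) :
    act X f u = actAt f u (X u) := rfl

theorem SmoothAt.congr {X Y : RawSection E A} {u : DualTot r E} (hX : SmoothAt X u)
    (hXY : ∀ᶠ v in 𝓝 u, Y v = X v) : SmoothAt Y u :=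
  ⟨hX.1.congr_of_eventuallyEq (hXY.mono fun v hv => by simp only [hv]),
    hX.2.congr_of_eventuallyEq (hXY.mono fun v hv => by simp only [hv])⟩

theorem base_contMDiff : ContMDiff (DualI m r) (𝓡 m) ∞ (fun v : DualTot r E => h v.1) :=
  h.contMDiff.comp dualProj_contMDiff

theorem SmoothAt.sum_smul {ι : Type*} (I : Finset ι) {c : ι → DualTot r E → ℝ}
    {X : ι → RawSection E A} {u : DualTot r E}
    (hc : ∀ i ∈ I, ContMDiffAt (DualI m r) 𝓘(ℝ, ℝ) ∞ (c i) u)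
    (hX : ∀ i ∈ I, SmoothAt (X i) u) : SmoothAt (fun v => ∑ i ∈ I, c i v • X i v) u := by
  constructor
  · have h1 := contMDiffAt_sum_smul (V := F) (FV := FibModel r) I (z := fun i v => zPart v (X i v))
      (base_contMDiff (h := h)).contMDiffAt hc fun i hi => (hX i hi).1
    simpa only [map_sum, map_smul] using h1
  · have h1 := contMDiffAt_sum_smul (V := TangentSpace (DualI m r) (M := DualTot r E)) I
      (z := fun i v => wPart v (X i v)) contMDiffAt_id hc fun i hi => (hX i hi).2
    simpa only [map_sum, map_smul] using h1

theorem SmoothAt.add {X Y : RawSection E A} {u : DualTot r E} (hX : SmoothAt X u)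
    (hY : SmoothAt Y u) : SmoothAt (fun v => X v + Y v) u := by
  have h1 := SmoothAt.sum_smul (Finset.univ : Finset (Fin 2)) (c := fun _ _ => 1) (X := ![X, Y])
    (u := u) (fun _ _ => contMDiffAt_const) (by intro i _; fin_cases i <;> assumption)
  simpa [Fin.sum_univ_two] using h1

theorem SmoothAt.smul {f : DualTot r E → ℝ} {X : RawSection E A} {u : DualTot r E}
    (hf : ContMDiffAt (DualI m r) 𝓘(ℝ, ℝ) ∞ f u) (hX : SmoothAt X u) :
    SmoothAt (fun v => f v • X v) u := by
  have h1 := SmoothAt.sum_smul (Finset.univ : Finset (Fin 1)) (c := fun _ => f) (X := fun _ => X)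
    (u := u) (fun _ _ => hf) (fun _ _ => hX)
  simpa using h1

theorem SmoothAt.sub {X Y : RawSection E A} {u : DualTot r E} (hX : SmoothAt X u)
    (hY : SmoothAt Y u) : SmoothAt (fun v => X v - Y v) u := by
  have h1 := hX.add (SmoothAt.smul (f := fun _ => -1) contMDiffAt_const hY)
  refine h1.congr (Eventually.of_forall fun v => ?_)
  exact (sub_eq_add_neg _ _).trans (congrArg (X v + ·) (neg_one_smul ℝ (Y v)).symm)

theorem SmoothAt.act {X : RawSection E A} {f : DualTot r E → ℝ} {u : DualTot r E}
    (hX : SmoothAt X u) (hf : ContMDiffAt (DualI m r) 𝓘(ℝ, ℝ) ∞ f u) :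
    ContMDiffAt (DualI m r) 𝓘(ℝ, ℝ) ∞ (GenHamilton.act X f) u :=
  contMDiffAt_dirDeriv hf hX.2

namespace Connection

variable (C : Connection E A)

theorem sub_proj_mem_hor (u : DualTot r E) (p : GT E A u) : p - C.proj u p ∈ C.Hor u := by
  refine LinearMap.mem_ker.2 ?_
  rw [map_sub, C.proj_of_mem u _ (C.proj_mem u p), sub_self]

theorem proj_of_mem_hor {u : DualTot r E} {p : GT E A u} (hp : p ∈ C.Hor u) : C.proj u p = 0 :=
  LinearMap.mem_ker.1 hp

variable {C} in
theorem hor_ext {u : DualTot r E} {p q : GT E A u} (hp : p ∈ C.Hor u) (hq : q ∈ C.Hor u)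
    (hz : zPart u p = zPart u q) : p = q := by
  have h1 : p - q ∈ C.Hor u := Submodule.sub_mem _ hp hq
  have h2 : p - q ∈ Vert A u := mem_vert_iff.2 (by rw [map_sub, hz, sub_self])
  have h3 := C.proj_of_mem u _ h2
  rw [C.proj_of_mem_hor h1] at h3
  exact sub_eq_zero.1 h3.symm

theorem zPart_proj (u : DualTot r E) (p : GT E A u) : zPart u (C.proj u p) = 0 :=
  mem_vert_iff.1 (C.proj_mem u p)

end Connection

namespace AdaptedFrame

variable {Φ : BundleIso r h F E} {C : Connection E A} (fr : AdaptedFrame Φ C)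

/-! ### Coordinates in an adapted frame -/

/-- The frame of `E` over `U`, dual to the frame `s^a` of `E*`. -/
def e (x : M) (a : Fin r) : E x := (Φ.equiv x).symm (fr.t a (h x))

theorem dualPair : DualPair fr.U fr.s fr.e := ⟨fr.isOpen_U, fr.dual⟩

/-- The coordinates of a vector of `(ρ, η)TE*` with respect to the `δ_a`. -/
def zc (a : Fin r) (u : DualTot r E) : GT E A u →ₗ[ℝ] ℝ where
  toFun p := fr.s a u.1 ((Φ.equiv u.1).symm (zPart u p))
  map_add' p q := by simp only [map_add]
  map_smul' c p := by simp only [map_smul]; rfl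

/-- The coordinates of a vector of `(ρ, η)TE*` with respect to the `∂^a`: the derivatives of the
fibre coordinates `p_a` along the vertical part. -/
def vc (a : Fin r) (u : DualTot r E) : GT E A u →ₗ[ℝ] ℝ :=
  (actAt (fibreCoord fr.e a) u).comp (C.proj u)

/-- The components of a section with respect to the `∂^a`. -/
def vCoord (X : RawSection E A) (a : Fin r) (u : DualTot r E) : ℝ := fr.vc a u (X u)

theorem zCoord_eq_zc (X : RawSection E A) (a : Fin r) (u : DualTot r E) :
    fr.zCoord X a u = fr.zc a u (X u) := rfl

theorem vCoord_eq_vc (X : RawSection E A) (a : Fin r) (u : DualTot r E) :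
    fr.vCoord X a u = fr.vc a u (X u) := rfl

theorem vdot_mem (a : Fin r) (u : DualTot r E) : fr.vdot a u ∈ Vert A u :=
  (vertLift A u (fr.s a u.1)).2

theorem zPart_vdot (a : Fin r) (u : DualTot r E) : zPart u (fr.vdot a u) = 0 :=
  mem_vert_iff.1 (fr.vdot_mem a u)

theorem wPart_vdot (a : Fin r) (u : DualTot r E) :
    wPart u (fr.vdot a u) = vertVec m u (fr.s a u.1) := rfl

variable {fr} in
theorem eventually_mem {u : DualTot r E} (hu : u.1 ∈ fr.U) :
    ∀ᶠ v : DualTot r E in 𝓝 u, v.1 ∈ fr.U :=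
  fr.dualPair.eventually_mem hu

section At

variable {fr} {u : DualTot r E}

theorem zc_of_mem_vert {p : GT E A u} (hp : p ∈ Vert A u) (a : Fin r) : fr.zc a u p = 0 := by
  change (fr.s a u.1 ((Φ.equiv u.1).symm (zPart u p)) : ℝ) = 0
  rw [mem_vert_iff.1 hp, map_zero, map_zero]

theorem zc_vdot (a b : Fin r) : fr.zc a u (fr.vdot b u) = 0 := zc_of_mem_vert (fr.vdot_mem b u) a

theorem vc_of_mem_hor {p : GT E A u} (hp : p ∈ C.Hor u) (a : Fin r) : fr.vc a u p = 0 := by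
  unfold vc
  rw [LinearMap.comp_apply, C.proj_of_mem_hor hp, map_zero]

theorem vc_δ (a b : Fin r) : fr.vc a u (fr.δ b u) = 0 := vc_of_mem_hor (fr.δ_mem b u) a

theorem vc_of_mem_vert {p : GT E A u} (hp : p ∈ Vert A u) (a : Fin r) :
    fr.vc a u p = actAt (fibreCoord fr.e a) u p := by
  unfold vc
  rw [LinearMap.comp_apply, C.proj_of_mem u p hp]

variable (hu : u.1 ∈ fr.U)

include hu

theorem expand_F (z : F (h u.1)) :
    z = ∑ a, (fr.s a u.1 ((Φ.equiv u.1).symm z) : ℝ) • fr.t a (h u.1) := by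
  have h1 := congrArg (Φ.equiv u.1) (fr.dualPair.expand hu ((Φ.equiv u.1).symm z))
  simpa [map_sum, e] using h1

theorem linearIndependent_t : LinearIndependent ℝ fun a => fr.t a (h u.1) := by
  have h1 := (fr.dualPair.linearIndependent hu).map' (Φ.equiv u.1).toLinearEquiv.toLinearMap
    (LinearMap.ker_eq_bot.2 (Φ.equiv u.1).injective)
  have h2 : (fun a => fr.t a (h u.1)) = (Φ.equiv u.1).toLinearEquiv.toLinearMap ∘ fr.e u.1 := by
    ext a
    simp [e]
  rw [h2]
  exact h1

theorem zc_δ (a b : Fin r) : fr.zc a u (fr.δ b u) = if a = b then 1 else 0 := by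
  refine Eq.trans ?_ (fr.dual u.1 hu a b)
  change (fr.s a u.1 ((Φ.equiv u.1).symm (zPart u (fr.δ b u))) : ℝ) = _
  rw [fr.zPart_δ]

/-- The vertical coordinates of the vertical lift of a covector are its components. -/
theorem vc_vertLift (a : Fin r) (σ : Cₛ^∞⟮𝓡 m; DualModel r, DualFib E⟯) :
    fr.vc a u (vertLift A u (σ u.1)) = σ u.1 (fr.e u.1 a) :=
  (vc_of_mem_vert (vertLift A u (σ u.1)).2 a).trans (fr.dualPair.dirDeriv_fibreCoord hu a σ)

theorem vc_vdot (a b : Fin r) : fr.vc a u (fr.vdot b u) = if a = b then 1 else 0 := by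
  refine (vc_vertLift hu a (fr.s b)).trans ((fr.dual u.1 hu b a).trans ?_)
  simp only [eq_comm]

/-- Expansion of a vector of `(ρ, η)TE*` in the adapted base. -/
theorem expand (p : GT E A u) :
    p = ∑ a, fr.zc a u p • fr.δ a u + ∑ a, fr.vc a u p • fr.vdot a u := by
  have hver : C.proj u p = ∑ a, fr.vc a u p • fr.vdot a u := by
    refine GT.ext ?_ ?_
    · rw [C.zPart_proj, map_sum]
      simp [fr.zPart_vdot]
    · have h1 := fr.dualPair.expand_vertical hu
        (mfderiv_dualProj_wPart_of_mem_vert (C.proj_mem u p))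
      rw [map_sum]
      refine h1.trans (Finset.sum_congr rfl fun a _ => ?_)
      rw [map_smul]
      rfl
  have hhor : p - C.proj u p = ∑ a, fr.zc a u p • fr.δ a u := by
    refine Connection.hor_ext (C.sub_proj_mem_hor u p)
      (Submodule.sum_mem _ fun a _ => Submodule.smul_mem _ _ (fr.δ_mem a u)) ?_
    rw [map_sub, C.zPart_proj, sub_zero, map_sum]
    refine (expand_F hu (zPart u p)).trans (Finset.sum_congr rfl fun a _ => ?_)
    rw [map_smul, fr.zPart_δ]
    rfl
  rw [← hhor, ← hver, sub_add_cancel]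

theorem smoothAt_vdot (a : Fin r) : SmoothAt (fr.vdot a) u := by
  constructor
  · have h1 := contMDiffAt_sum_smul (V := F) (FV := FibModel r) (∅ : Finset (Fin 0))
      (c := fun _ _ => 0) (z := fun _ v => 0) (base_contMDiff (h := h) (E := E)).contMDiffAt
      (p₀ := u) (by simp) (by simp)
    convert h1 using 1
    ext1 v
    rw [fr.zPart_vdot]
    rfl
  · exact vertVec_smooth (fr.s a) u

/-- The horizontal lift `δ_a` is smooth: it is the horizontal part of a section assembled from
`t_a` and a lift of its anchor. -/
theorem smoothAt_δ (a : Fin r) : SmoothAt (fr.δ a) u := by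
  classical
  obtain ⟨W, hW, hWπ⟩ := fr.dualPair.exists_lift (A.anchorField_smooth (fr.t a)) hu
  let X : RawSection E A := fun v => if hv : v.1 ∈ fr.U then
    ⟨(fr.t a (h v.1), W v), fr.t a, rfl, hWπ v hv⟩ else 0
  have hXz : ∀ v : DualTot r E, v.1 ∈ fr.U → zPart v (X v) = fr.t a (h v.1) := by
    intro v hv
    simp only [X, dif_pos hv]
    rfl
  have hXw : ∀ v : DualTot r E, v.1 ∈ fr.U → wPart v (X v) = W v := by
    intro v hv
    simp only [X, dif_pos hv]
    rfl
  have hX : SmoothAt X u := by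
    constructor
    · have h1 := ((fr.t a).contMDiff.contMDiffAt (x := h u.1)).comp u
        (base_contMDiff (h := h)).contMDiffAt
      refine h1.congr_of_eventuallyEq ((eventually_mem hu).mono fun v hv => ?_)
      simp only [hXz v hv]
      rfl
    · exact hW.congr_of_eventuallyEq ((eventually_mem hu).mono fun v hv => by
        simp only [hXw v hv])
  refine (hX.sub (C.smooth X u hX)).congr ((eventually_mem hu).mono fun v hv => ?_)
  refine Connection.hor_ext (fr.δ_mem a v) (C.sub_proj_mem_hor v _) ?_
  rw [fr.zPart_δ, map_sub, C.zPart_proj, sub_zero, hXz v hv]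

/-- Components with respect to the frame `t_a` of a family of vectors of `F` along `E*`. -/
theorem contMDiffAt_coeff_F {z : ∀ v : DualTot r E, F (h v.1)}
    (hz : ContMDiffAt (DualI m r) ((𝓡 m).prod 𝓘(ℝ, FibModel r)) ∞
      (fun v => (⟨h v.1, z v⟩ : TotalSpace (FibModel r) F)) u) (a : Fin r) :
    ContMDiffAt (DualI m r) 𝓘(ℝ, ℝ) ∞
      (fun v => (fr.s a v.1 ((Φ.equiv v.1).symm (z v)) : ℝ)) u := by
  have hev := eventually_mem hu
  refine contMDiffAt_coeff (V := F) (FV := FibModel r)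
    (c := fun a v => (fr.s a v.1 ((Φ.equiv v.1).symm (z v)) : ℝ))
    (t := fun a v => fr.t a (h v.1)) (by simp) hz (fun b => ?_) ?_ ?_ a
  · exact ((fr.t b).contMDiff.contMDiffAt (x := h u.1)).comp u
      (base_contMDiff (h := h)).contMDiffAt
  · exact hev.mono fun v hv => linearIndependent_t hv
  · exact hev.mono fun v hv => expand_F hv (z v)

theorem contMDiffAt_zCoord {X : RawSection E A} (hX : SmoothAt X u) (a : Fin r) :
    ContMDiffAt (DualI m r) 𝓘(ℝ, ℝ) ∞ (fr.zCoord X a) u :=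
  contMDiffAt_coeff_F hu hX.1 a

theorem contMDiffAt_vCoord {X : RawSection E A} (hX : SmoothAt X u) (a : Fin r) :
    ContMDiffAt (DualI m r) 𝓘(ℝ, ℝ) ∞ (fr.vCoord X a) u :=
  (C.smooth X u hX).act (fr.dualPair.fibreCoord_smooth hu a)

theorem contMDiffAt_L (c a b : Fin r) : ContMDiffAt (DualI m r) 𝓘(ℝ, ℝ) ∞ (fr.L c a b) u :=
  contMDiffAt_coeff_F hu (((A.bracket (fr.t a) (fr.t b)).contMDiff.contMDiffAt (x := h u.1)).comp u
    (base_contMDiff (h := h)).contMDiffAt) c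

end At

end AdaptedFrame

/-! ### Existence of adapted frames -/

theorem contMDiff_dual_apply (σ : Cₛ^∞⟮𝓡 m; DualModel r, DualFib E⟯)
    (ε : Cₛ^∞⟮𝓡 m; FibModel r, E⟯) : ContMDiff (𝓡 m) 𝓘(ℝ, ℝ) ∞ (fun x => (σ x (ε x) : ℝ)) := by
  intro x
  have h1 := ContMDiffAt.clm_bundle_apply (𝕜 := ℝ) (F₁ := FibModel r) (F₂ := ℝ) (E₁ := E)
    (E₂ := Bundle.Trivial M ℝ) (IB := 𝓡 m) (IM := 𝓡 m) (n := ∞) (b := fun x : M => x)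
    (ϕ := fun x => σ x) (v := fun x => ε x) (x := x) (σ.contMDiff x) (ε.contMDiff x)
  have h2 := (contMDiffAt_totalSpace.1 h1).2
  simpa using h2

/-- A section of `E`, transported to `F` by a bundle isomorphism over `h`. -/
theorem BundleIso.exists_transport (Φ : BundleIso r h F E) (ε : Cₛ^∞⟮𝓡 m; FibModel r, E⟯) :
    ∃ t : Cₛ^∞⟮𝓡 m; FibModel r, F⟯, ∀ x, t (h x) = Φ.equiv x (ε x) := by
  have hy : ∀ y, h (h.symm y) = y := h.apply_symm_apply
  -- The fibre over `y` is that over `h (h.symm y)` only up to a cast, which does not change the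
  -- point of the total space.
  have hcast : ∀ y y' (hyy : y = y') (z : F y),
      (⟨y', hyy ▸ z⟩ : TotalSpace (FibModel r) F) = ⟨y, z⟩ := by
    rintro y _ rfl z
    rfl
  refine ⟨⟨fun y => (hy y) ▸ Φ.equiv (h.symm y) (ε (h.symm y)), ?_⟩, fun x => ?_⟩
  · have h1 : ContMDiff (𝓡 m) ((𝓡 m).prod 𝓘(ℝ, FibModel r)) ∞
        (fun y =>
          (⟨h (h.symm y), Φ.equiv (h.symm y) (ε (h.symm y))⟩ : TotalSpace (FibModel r) F)) :=
      Φ.smooth.comp (ε.contMDiff.comp h.symm.contMDiff)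
    exact h1.congr fun y => hcast _ _ (hy y) _
  · have h2 : ∀ x' (hx : x' = x), (congrArg h hx) ▸ Φ.equiv x' (ε x') = Φ.equiv x (ε x) := by
      rintro _ rfl
      rfl
    exact h2 (h.symm (h x)) (h.symm_apply_apply x)

/-- Near every point there are mutually dual frames of `E` and `E*`. -/
theorem exists_dualPair (x₀ : M) : ∃ (U : Set M) (s : Fin r → Cₛ^∞⟮𝓡 m; DualModel r, DualFib E⟯)
    (ε : Fin r → Cₛ^∞⟮𝓡 m; FibModel r, E⟯), x₀ ∈ U ∧ DualPair U s fun x a => ε a x := by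
  let T := (trivializationAt (FibModel r) E x₀).continuousLinearEquivAt ℝ x₀
    (FiberBundle.mem_baseSet_trivializationAt' x₀)
  choose ε hε using fun a : Fin r => exists_section_apply_eq (I := 𝓡 m) (FV := FibModel r) (V := E)
    x₀ (T.symm (EuclideanSpace.single a 1))
  choose σ hσ using fun a : Fin r => exists_section_apply_eq (I := 𝓡 m) (FV := DualModel r)
    (V := DualFib E) x₀
    ((EuclideanSpace.proj a : FibModel r →L[ℝ] ℝ).comp (T : E x₀ →L[ℝ] FibModel r))
  -- The sections `σ` and `ε` are dual at `x₀`. Near `x₀` the `σ` are corrected by the inverse of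
  -- the matrix `σ^a (ε_b)`.
  let S : M → Matrix (Fin r) (Fin r) ℝ := fun x => Matrix.of fun a b => (σ a x (ε b x) : ℝ)
  have hS : ∀ a b, ContMDiff (𝓡 m) 𝓘(ℝ, ℝ) ∞ (fun x => S x a b) := fun a b =>
    contMDiff_dual_apply (σ a) (ε b)
  have hS0 : S x₀ = 1 := by
    ext a b
    simp only [S, Matrix.of_apply, hσ, hε]
    change (EuclideanSpace.proj a : FibModel r →L[ℝ] ℝ) (T (T.symm (EuclideanSpace.single b 1))) = _
    rw [T.apply_symm_apply]
    simp [Matrix.one_apply]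
  let U₁ : Set M := {x | (S x).det ≠ 0}
  have hU₁ : IsOpen U₁ := isOpen_ne_fun (by
    refine Continuous.matrix_det ?_
    exact continuous_matrix fun a b => (hS a b).continuous) continuous_const
  have hx₀ : x₀ ∈ U₁ := by
    change (S x₀).det ≠ 0
    rw [hS0, Matrix.det_one]
    exact one_ne_zero
  have hsm : ∀ a, ContMDiffOn (𝓡 m) ((𝓡 m).prod 𝓘(ℝ, DualModel r)) ∞
      (fun x => (⟨x, ∑ c, (S x)⁻¹ a c • σ c x⟩ : DualTot r E)) U₁ := fun a x hx =>
    (contMDiffAt_sum_smul (V := DualFib E) (FV := DualModel r) Finset.univ contMDiffAt_id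
      (fun c _ => contMDiffAt_matrix_inv (fun i j => hS i j x)
        ((Matrix.isUnit_iff_isUnit_det _).2 (isUnit_iff_ne_zero.2 hx)) a c)
      fun c _ => (σ c).contMDiff x).contMDiffWithinAt
  choose s hs using fun a => exists_section_extension hU₁ hx₀ (hsm a)
  let D : Set M := {x | ∀ a b, (s a x (ε b x) : ℝ) = if a = b then 1 else 0}
  refine ⟨interior D, s, ε, mem_interior_iff_mem_nhds.2 ?_, isOpen_interior,
    fun x hx => interior_subset hx⟩
  filter_upwards [eventually_all.2 hs, hU₁.mem_nhds hx₀] with x hx hxU a b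
  rw [hx a]
  have h1 := congrFun (congrFun (Matrix.nonsing_inv_mul (S x) (isUnit_iff_ne_zero.2 hxU)) a) b
  rw [Matrix.one_apply, Matrix.mul_apply] at h1
  rw [← h1]
  simp only [sum_apply, smul_apply, smul_eq_mul]
  rfl

/-- Every vector of `F` at `h (π u)` is the component in `F` of a horizontal vector at `u`. -/
theorem Connection.exists_hor_lift (C : Connection E A) (u : DualTot r E)
    (t : Cₛ^∞⟮𝓡 m; FibModel r, F⟯) : ∃ p ∈ C.Hor u, zPart u p = t (h u.1) := by
  obtain ⟨w, hw⟩ := mfderiv_dualProj_surjective u (A.anchorField t u.1)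
  let p : GT E A u := ⟨(t (h u.1), w), t, rfl, hw⟩
  refine ⟨p - C.proj u p, C.sub_proj_mem_hor u p, ?_⟩
  rw [map_sub, C.zPart_proj, sub_zero]
  rfl

/-- Near every point there is an adapted frame. -/
theorem exists_adaptedFrame (Φ : BundleIso r h F E) (C : Connection E A) (x₀ : M) :
    ∃ fr : AdaptedFrame Φ C, x₀ ∈ fr.U := by
  obtain ⟨U, s, ε, hx₀, P⟩ := exists_dualPair (m := m) (r := r) (E := E) x₀
  choose t ht using fun a => Φ.exists_transport (ε a)
  choose δ hδ hδt using fun (a : Fin r) (u : DualTot r E) => C.exists_hor_lift u (t a)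
  exact ⟨⟨U, P.isOpen, t, s, fun x hx a b => by
    rw [ht, ContinuousLinearEquiv.symm_apply_apply]
    exact P.dual x hx a b, δ, hδt, hδ⟩, hx₀⟩

namespace AdaptedFrame

open Matrix

variable {Φ : BundleIso r h F E} {C : Connection E A} (fr : AdaptedFrame Φ C)

section At

variable {fr} {u : DualTot r E} (hu : u.1 ∈ fr.U)

include hu

theorem frame_ext {p q : GT E A u} (hz : ∀ a, fr.zc a u p = fr.zc a u q)
    (hv : ∀ a, fr.vc a u p = fr.vc a u q) : p = q := by
  rw [expand hu p, expand hu q]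
  simp only [hz, hv]

theorem frame_induction {P : GT E A u → Prop} (h0 : P 0) (hadd : ∀ p q, P p → P q → P (p + q))
    (hsmul : ∀ (c : ℝ) p, P p → P (c • p)) (hδ : ∀ a, P (fr.δ a u)) (hv : ∀ a, P (fr.vdot a u))
    (p : GT E A u) : P p := by
  rw [expand hu p]
  exact hadd _ _ (Finset.sum_induction _ P hadd h0 fun a _ => hsmul _ _ (hδ a))
    (Finset.sum_induction _ P hadd h0 fun a _ => hsmul _ _ (hv a))

end At

/-! ### The metric in an adapted frame -/

variable (g : VertPseudoMetric E A)

/-- The matrix `(g^{ab})`. -/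
def up (u : DualTot r E) : Matrix (Fin r) (Fin r) ℝ := of fun a b => fr.gUp g a b u

/-- The matrix `(g̃_{ab})`. -/
def down (u : DualTot r E) : Matrix (Fin r) (Fin r) ℝ := of fun a b => fr.gDown g a b u

theorem gUp_symm (a b : Fin r) : fr.gUp g a b = fr.gUp g b a :=
  funext fun u => g.symm u _ _

theorem up_transpose (u : DualTot r E) : (fr.up g u)ᵀ = fr.up g u := by
  ext a b
  exact congrFun (fr.gUp_symm g b a) u

theorem down_eq_inv (u : DualTot r E) : fr.down g u = (fr.up g u)⁻¹ := rfl

theorem down_transpose (u : DualTot r E) : (fr.down g u)ᵀ = fr.down g u := by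
  rw [down_eq_inv, transpose_nonsing_inv, up_transpose]

theorem gDown_symm (a b : Fin r) : fr.gDown g a b = fr.gDown g b a :=
  funext fun u => congrFun (congrFun (fr.down_transpose g u) b) a

theorem L_skew (c a b : Fin r) (u : DualTot r E) : fr.L c a b u = - fr.L c b a u := by
  unfold L
  rw [A.bracket_skew_apply, map_neg, map_neg]

section At

variable {fr} {g} {u : DualTot r E} (hu : u.1 ∈ fr.U)

include hu

theorem contMDiffAt_gUp (a b : Fin r) : ContMDiffAt (DualI m r) 𝓘(ℝ, ℝ) ∞ (fr.gUp g a b) u :=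
  g.smooth (fun v => vertLift A v (fr.s a v.1)) (fun v => vertLift A v (fr.s b v.1)) u
    (smoothAt_vdot hu a) (smoothAt_vdot hu b)

/-- The matrix `(g^{ab})` is invertible because `g` is nondegenerate and the `∂^a` span the vertical
subspace; hence `g̃`, which is defined through Mathlib's matrix inverse, is a true inverse. -/
theorem isUnit_up : IsUnit (fr.up g u) := by
  rw [← mulVec_injective_iff_isUnit]
  refine (injective_iff_map_eq_zero (fr.up g u).mulVecLin).2 fun c hc => ?_
  let ν : Fin r → Vert A u := fun a => vertLift A u (fr.s a u.1)
  have hspan : ∀ p : Vert A u, p = ∑ a, fr.vc a u p • ν a := by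
    intro p
    apply Subtype.ext
    rw [Submodule.coe_sum]
    conv_lhs => rw [expand hu p.1]
    simp only [zc_of_mem_vert p.2, zero_smul, Finset.sum_const_zero, zero_add]
    rfl
  have hy : ∀ y, (∀ a, g.form u (ν a) y = 0) → y = 0 := by
    intro y hy
    refine g.nondeg u y fun q => ?_
    rw [g.symm, hspan q, map_sum, LinearMap.sum_apply]
    exact Finset.sum_eq_zero fun a _ => by rw [map_smul, LinearMap.smul_apply, hy, smul_zero]
  have h0 : ∑ a, c a • ν a = 0 := by
    refine hy _ fun a => ?_
    have h2 := congrFun hc a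
    simp only [mulVecLin_apply, mulVec, dotProduct, up, of_apply, Pi.zero_apply] at h2
    rw [map_sum]
    simp only [map_smul, smul_eq_mul]
    exact (Finset.sum_congr rfl fun b _ => mul_comm _ _).trans h2
  ext b
  let k : Vert A u →ₗ[ℝ] ℝ := (fr.vc b u).comp (Vert A u).subtype
  have h3 : k (∑ a, c a • ν a) = 0 := by rw [h0, map_zero]
  rw [map_sum] at h3
  simp only [map_smul] at h3
  have h4 : ∀ a, k (ν a) = if b = a then 1 else 0 := fun a => vc_vdot hu b a
  simpa [h4] using h3

theorem up_mul_down : fr.up g u * fr.down g u = 1 :=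
  mul_nonsing_inv _ ((isUnit_iff_isUnit_det _).1 (isUnit_up hu))

theorem down_mul_up : fr.down g u * fr.up g u = 1 :=
  nonsing_inv_mul _ ((isUnit_iff_isUnit_det _).1 (isUnit_up hu))

theorem contMDiffAt_gDown (a b : Fin r) : ContMDiffAt (DualI m r) 𝓘(ℝ, ℝ) ∞ (fr.gDown g a b) u :=
  contMDiffAt_matrix_inv (S := fun v => fr.up g v) (fun a b => contMDiffAt_gUp hu a b)
    (isUnit_up hu) a b

/-- The derivative of `g g̃ = 1`. -/
theorem act_inv (p : GT E A u) :
    fr.up g u * (of fun a b => actAt (fr.gDown g a b) u p)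
      + (of fun a b => actAt (fr.gUp g a b) u p) * fr.down g u = 0 := by
  ext a b
  have h1 : (fun v => ∑ c, fr.gUp g a c v * fr.gDown g c b v) =ᶠ[𝓝 u]
      fun _ => (1 : Matrix (Fin r) (Fin r) ℝ) a b := by
    filter_upwards [eventually_mem hu] with v hv
    exact congrFun (congrFun (up_mul_down hv) a) b
  have h2 := (dirDeriv_congr h1 (wPart u p)).trans (dirDeriv_const _ _)
  have hup := fun a b => (contMDiffAt_gUp (g := g) hu a b).mdifferentiableAt (by simp)
  have hdn := fun a b => (contMDiffAt_gDown (g := g) hu a b).mdifferentiableAt (by simp)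
  have hmul : ∀ c ∈ Finset.univ, MDifferentiableAt (DualI m r) 𝓘(ℝ, ℝ)
      (fun v => fr.gUp g a c v * fr.gDown g c b v) u := fun c _ => (hup a c).mul (hdn c b)
  rw [dirDeriv_sum _ hmul] at h2
  simp only [dirDeriv_mul (hup _ _) (hdn _ _), Finset.sum_add_distrib] at h2
  simp only [Matrix.add_apply, mul_apply, of_apply, Matrix.zero_apply]
  refine Eq.trans ?_ h2
  congr 1
  exact Finset.sum_congr rfl fun c _ => mul_comm _ _

end At

/-! ### The connection form -/

/-- The matrix `ω^a_b(p) = H^a_{bc} p^c - V_b^{ac} p_c` of the connection in the direction `p`. -/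
def conn (u : DualTot r E) (p : GT E A u) : Matrix (Fin r) (Fin r) ℝ :=
  of fun a b => ∑ c,
    (fr.leviCivitaH g a b c u * fr.zc c u p - fr.leviCivitaV g b a c u * fr.vc c u p)

theorem conn_add (u : DualTot r E) (p q : GT E A u) :
    fr.conn g u (p + q) = fr.conn g u p + fr.conn g u q := by
  ext a b
  simp only [conn, of_apply, Matrix.add_apply, map_add, ← Finset.sum_add_distrib]
  exact Finset.sum_congr rfl fun c _ => by ring

theorem conn_smul (u : DualTot r E) (k : ℝ) (p : GT E A u) :
    fr.conn g u (k • p) = k • fr.conn g u p := by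
  ext a b
  simp only [conn, of_apply, Matrix.smul_apply, map_smul, smul_eq_mul, Finset.mul_sum]
  exact Finset.sum_congr rfl fun c _ => by ring

section At

variable {fr} {g} {u : DualTot r E} (hu : u.1 ∈ fr.U)

include hu

theorem conn_δ (a b c : Fin r) : fr.conn g u (fr.δ c u) a b = fr.leviCivitaH g a b c u := by
  simp [conn, zc_δ hu, vc_δ]

theorem conn_vdot (a b c : Fin r) : fr.conn g u (fr.vdot c u) a b = - fr.leviCivitaV g b a c u := by
  simp [conn, vc_vdot hu, zc_vdot]

/-- The Koszul expression `2 g̃_{ea} H^a_{bc}`. -/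
theorem down_mul_leviCivitaH (e b c : Fin r) :
    ∑ a, fr.gDown g e a u * fr.leviCivitaH g a b c u = (1 / 2) *
      (act (fr.δ b) (fr.gDown g e c) u + act (fr.δ c) (fr.gDown g b e) u
      - act (fr.δ e) (fr.gDown g b c) u
      - ∑ d, fr.gDown g c d u * fr.L d b e u
      + ∑ d, fr.gDown g b d u * fr.L d e c u
      - ∑ d, fr.gDown g e d u * fr.L d b c u) := by
  unfold leviCivitaH
  generalize hk : (fun e => act (fr.δ b) (fr.gDown g e c) u + act (fr.δ c) (fr.gDown g b e) u
      - act (fr.δ e) (fr.gDown g b c) u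
      - ∑ d, fr.gDown g c d u * fr.L d b e u
      + ∑ d, fr.gDown g b d u * fr.L d e c u
      - ∑ d, fr.gDown g e d u * fr.L d b c u) = k
  have hk' := fun e => congrFun hk e
  simp only [hk']
  have h1 : (fr.down g u *ᵥ (fr.up g u *ᵥ k)) e = k e := by
    rw [mulVec_mulVec, down_mul_up hu, one_mulVec]
  simp only [mulVec, dotProduct, down, up, of_apply] at h1
  rw [← h1, Finset.mul_sum]
  exact Finset.sum_congr rfl fun a _ => by ring

/-- The Koszul expression `2 g^{eb} V_b^{ac}`. -/
theorem up_mul_leviCivitaV (e a c : Fin r) :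
    ∑ b, fr.gUp g e b u * fr.leviCivitaV g b a c u = (1 / 2) *
      (act (fr.vdot c) (fr.gUp g e a) u + act (fr.vdot a) (fr.gUp g e c) u
      - act (fr.vdot e) (fr.gUp g a c) u) := by
  unfold leviCivitaV
  generalize hk : (fun e => act (fr.vdot c) (fr.gUp g e a) u + act (fr.vdot a) (fr.gUp g e c) u
      - act (fr.vdot e) (fr.gUp g a c) u) = k
  have hk' := fun e => congrFun hk e
  simp only [hk']
  have h1 : (fr.up g u *ᵥ (fr.down g u *ᵥ k)) e = k e := by
    rw [mulVec_mulVec, up_mul_down hu, one_mulVec]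
  simp only [mulVec, dotProduct, down, up, of_apply] at h1
  rw [← h1, Finset.mul_sum]
  exact Finset.sum_congr rfl fun a _ => by ring

/-- The coefficients `H` are torsion free. -/
theorem leviCivitaH_sub (a b c : Fin r) :
    fr.leviCivitaH g a b c u - fr.leviCivitaH g a c b u = fr.L a c b u := by
  have h1 : ∀ e, ∑ a, fr.gDown g e a u * (fr.leviCivitaH g a b c u - fr.leviCivitaH g a c b u)
      = ∑ d, fr.gDown g e d u * fr.L d c b u := by
    intro e
    simp only [mul_sub, Finset.sum_sub_distrib, down_mul_leviCivitaH hu]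
    rw [fr.gDown_symm g c b, fr.gDown_symm g e c, fr.gDown_symm g b e]
    have h2 : ∀ x y z : Fin r, ∑ d, fr.gDown g x d u * fr.L d y z u
        = - ∑ d, fr.gDown g x d u * fr.L d z y u := by
      intro x y z
      rw [← Finset.sum_neg_distrib]
      exact Finset.sum_congr rfl fun d _ => by rw [fr.L_skew d y z]; ring
    rw [h2 c b e, h2 b e c, h2 e b c]
    ring
  have h3 : fr.down g u *ᵥ (fun a => fr.leviCivitaH g a b c u - fr.leviCivitaH g a c b u)
      = fr.down g u *ᵥ fun a => fr.L a c b u := funext h1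
  have h4 := congrArg (fr.up g u *ᵥ ·) h3
  simp only [mulVec_mulVec, up_mul_down hu, one_mulVec] at h4
  exact congrFun h4 a

omit hu in
theorem leviCivitaV_symm (b a c : Fin r) : fr.leviCivitaV g b a c u = fr.leviCivitaV g b c a u := by
  unfold leviCivitaV
  rw [fr.gUp_symm g c a]
  congr 1
  exact Finset.sum_congr rfl fun e _ => by ring

/-- By the choice of `H`, `g̃` is parallel along the `δ_c`. -/
theorem act_gDown_δ (c : Fin r) : (of fun a b => actAt (fr.gDown g a b) u (fr.δ c u))
    = (fr.conn g u (fr.δ c u))ᵀ * fr.down g u + fr.down g u * fr.conn g u (fr.δ c u) := by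
  ext b e
  simp only [Matrix.add_apply, mul_apply, transpose_apply, conn_δ hu, of_apply, down]
  have h1 : ∑ a, fr.leviCivitaH g a b c u * fr.gDown g a e u
      = ∑ a, fr.gDown g e a u * fr.leviCivitaH g a b c u :=
    Finset.sum_congr rfl fun a _ => by rw [fr.gDown_symm g a e, mul_comm]
  rw [h1, down_mul_leviCivitaH hu, down_mul_leviCivitaH hu]
  have h2 : ∑ d, fr.gDown g c d u * fr.L d b e u = - ∑ d, fr.gDown g c d u * fr.L d e b u := by
    rw [← Finset.sum_neg_distrib]
    exact Finset.sum_congr rfl fun d _ => by rw [fr.L_skew d b e]; ring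
  rw [h2, fr.gDown_symm g e b, fr.gDown_symm g b c, fr.gDown_symm g e c, ← act_eq_actAt]
  ring

/-- By the choice of `V`, `g` is parallel along the `∂^c`. -/
theorem act_gUp_vdot (c : Fin r) : (of fun a b => actAt (fr.gUp g a b) u (fr.vdot c u))
    = - (fr.conn g u (fr.vdot c u) * fr.up g u
      + fr.up g u * (fr.conn g u (fr.vdot c u))ᵀ) := by
  ext a b
  simp only [Matrix.add_apply, Matrix.neg_apply, mul_apply, transpose_apply, conn_vdot hu, of_apply,
    up, mul_neg, neg_mul, Finset.sum_neg_distrib]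
  have h1 : ∑ e, fr.leviCivitaV g e a c u * fr.gUp g e b u
      = ∑ e, fr.gUp g b e u * fr.leviCivitaV g e a c u :=
    Finset.sum_congr rfl fun e _ => by rw [fr.gUp_symm g e b, mul_comm]
  rw [h1, up_mul_leviCivitaV hu, up_mul_leviCivitaV hu, fr.gUp_symm g b a, ← act_eq_actAt]
  ring

/-- If `g̃` is parallel in some direction, so is its inverse `g`. -/
theorem act_gUp_of_gDown {p : GT E A u}
    (key : (of fun a b => actAt (fr.gDown g a b) u p)
      = (fr.conn g u p)ᵀ * fr.down g u + fr.down g u * fr.conn g u p) :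
    (of fun a b => actAt (fr.gUp g a b) u p)
      = - (fr.conn g u p * fr.up g u + fr.up g u * (fr.conn g u p)ᵀ) := by
  have h1 := act_inv (g := g) hu p
  rw [key] at h1
  generalize (of fun a b => actAt (fr.gUp g a b) u p) = S at h1 ⊢
  have h2 := congrArg (· * fr.up g u) h1
  simp only [Matrix.add_mul, Matrix.mul_add, Matrix.zero_mul, Matrix.mul_assoc,
    down_mul_up (g := g) hu, Matrix.mul_one] at h2
  rw [← Matrix.mul_assoc (fr.up g u) (fr.down g u), up_mul_down hu, Matrix.one_mul] at h2
  rw [eq_neg_of_add_eq_zero_right h2, add_comm]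

/-- If `g` is parallel in some direction, so is its inverse `g̃`. -/
theorem act_gDown_of_gUp {p : GT E A u}
    (key : (of fun a b => actAt (fr.gUp g a b) u p)
      = - (fr.conn g u p * fr.up g u + fr.up g u * (fr.conn g u p)ᵀ)) :
    (of fun a b => actAt (fr.gDown g a b) u p)
      = (fr.conn g u p)ᵀ * fr.down g u + fr.down g u * fr.conn g u p := by
  have h1 := act_inv (g := g) hu p
  rw [key] at h1
  generalize (of fun a b => actAt (fr.gDown g a b) u p) = S at h1 ⊢
  have h2 := congrArg (fr.down g u * ·) h1
  simp only [Matrix.mul_add, Matrix.mul_neg, Matrix.neg_mul, Matrix.add_mul, Matrix.mul_zero,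
    ← Matrix.mul_assoc, down_mul_up (g := g) hu, Matrix.one_mul] at h2
  rw [Matrix.mul_assoc (fr.down g u * fr.conn g u p) (fr.up g u), up_mul_down hu,
    Matrix.mul_one] at h2
  rw [eq_neg_of_add_eq_zero_left h2, neg_neg, add_comm]

/-- `∇ g̃ = 0` and `∇ g = 0` in terms of the connection form. On `δ_c` the first equation holds by
the choice of `H`, on `∂^c` the second one by the choice of `V`; each of them implies the other
because `g̃` is inverse to `g`. -/
theorem act_metric (p : GT E A u) :
    (of fun a b => actAt (fr.gDown g a b) u p)
        = (fr.conn g u p)ᵀ * fr.down g u + fr.down g u * fr.conn g u p ∧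
      (of fun a b => actAt (fr.gUp g a b) u p)
        = - (fr.conn g u p * fr.up g u + fr.up g u * (fr.conn g u p)ᵀ) := by
  refine and_iff_left_of_imp (act_gUp_of_gDown hu) |>.2 ?_
  refine frame_induction (P := fun p => (of fun a b => actAt (fr.gDown g a b) u p)
        = (fr.conn g u p)ᵀ * fr.down g u + fr.down g u * fr.conn g u p) hu ?_ ?_ ?_
    (fun c => act_gDown_δ hu c) (fun c => act_gDown_of_gUp hu (act_gUp_vdot hu c)) p
  · ext a b
    simp [conn, mul_apply]
  · intro p q hp hq
    have hadd : (of fun a b => actAt (fr.gDown g a b) u (p + q))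
        = (of fun a b => actAt (fr.gDown g a b) u p)
          + of fun a b => actAt (fr.gDown g a b) u q := by
      ext a b
      exact map_add (actAt (fr.gDown g a b) u) p q
    rw [hadd, hp, hq, conn_add, transpose_add, Matrix.add_mul, Matrix.mul_add]
    abel
  · intro k p hp
    have hsmul : (of fun a b => actAt (fr.gDown g a b) u (k • p))
        = k • of fun a b => actAt (fr.gDown g a b) u p := by
      ext a b
      exact map_smul (actAt (fr.gDown g a b) u) k p
    rw [hsmul, hp, conn_smul, transpose_smul, Matrix.smul_mul, Matrix.mul_smul, smul_add]

end At

end AdaptedFrame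

/-! ### Derivatives of bilinear expressions -/

open Matrix

theorem dirDeriv_dotProduct_mulVec {S : DualTot r E → Matrix (Fin r) (Fin r) ℝ}
    {y z : DualTot r E → Fin r → ℝ} {u : DualTot r E}
    (hS : ∀ a b, MDifferentiableAt (DualI m r) 𝓘(ℝ, ℝ) (fun v => S v a b) u)
    (hy : ∀ a, MDifferentiableAt (DualI m r) 𝓘(ℝ, ℝ) (fun v => y v a) u)
    (hz : ∀ a, MDifferentiableAt (DualI m r) 𝓘(ℝ, ℝ) (fun v => z v a) u)
    (w : TangentSpace (DualI m r) u) :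
    MDifferentiableAt (DualI m r) 𝓘(ℝ, ℝ) (fun v => y v ⬝ᵥ (S v *ᵥ z v)) u ∧
    dirDeriv (DualI m r) (fun v => y v ⬝ᵥ (S v *ᵥ z v)) u w
      = y u ⬝ᵥ ((of fun a b => dirDeriv (DualI m r) (fun v => S v a b) u w) *ᵥ z u)
        + (fun a => dirDeriv (DualI m r) (fun v => y v a) u w) ⬝ᵥ (S u *ᵥ z u)
        + y u ⬝ᵥ (S u *ᵥ fun a => dirDeriv (DualI m r) (fun v => z v a) u w) := by
  have h1 : ∀ a b, MDifferentiableAt (DualI m r) 𝓘(ℝ, ℝ) (fun v => S v a b * z v b) u :=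
    fun a b => (hS a b).mul (hz b)
  have h2 : ∀ a, MDifferentiableAt (DualI m r) 𝓘(ℝ, ℝ) (fun v => ∑ b, S v a b * z v b) u :=
    fun a => mdifferentiableAt_sum _ fun b _ => h1 a b
  have h3 : ∀ a, MDifferentiableAt (DualI m r) 𝓘(ℝ, ℝ)
      (fun v => y v a * ∑ b, S v a b * z v b) u := fun a => (hy a).mul (h2 a)
  refine ⟨mdifferentiableAt_sum _ fun a _ => h3 a, ?_⟩
  simp only [mulVec, dotProduct, of_apply]
  rw [dirDeriv_sum _ fun a _ => h3 a, ← Finset.sum_add_distrib, ← Finset.sum_add_distrib]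
  refine Finset.sum_congr rfl fun a _ => ?_
  rw [dirDeriv_mul (hy a) (h2 a), dirDeriv_sum _ fun b _ => h1 a b,
    Finset.sum_congr rfl fun b _ => dirDeriv_mul (hS a b) (hz b) w, Finset.sum_add_distrib]
  simp only [mul_comm (z u _)]
  ring

/-- The derivative of `y ⬝ᵥ S z`, if that of `S` is `Wᵀ S + S W`, in terms of the covariant
derivatives `dy + W y` and `dz + W z`. -/
theorem dotProduct_mulVec_add {ι : Type*} [Fintype ι] (S W : Matrix ι ι ℝ) (y z dy dz : ι → ℝ) :
    y ⬝ᵥ ((Wᵀ * S + S * W) *ᵥ z) + dy ⬝ᵥ (S *ᵥ z) + y ⬝ᵥ (S *ᵥ dz)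
      = (dy + W *ᵥ y) ⬝ᵥ (S *ᵥ z) + y ⬝ᵥ (S *ᵥ (dz + W *ᵥ z)) := by
  have h1 : y ⬝ᵥ (Wᵀ *ᵥ (S *ᵥ z)) = (W *ᵥ y) ⬝ᵥ (S *ᵥ z) := by
    rw [dotProduct_mulVec, vecMul_transpose]
  rw [add_mulVec, dotProduct_add, ← mulVec_mulVec, ← mulVec_mulVec, h1, mulVec_add, add_dotProduct,
    dotProduct_add]
  ring

namespace AdaptedFrame

variable {Φ : BundleIso r h F E} {C : Connection E A} (fr : AdaptedFrame Φ C)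
  (g : VertPseudoMetric E A)

/-! ### The covariant derivative in an adapted frame -/

/-- The components of `D_ξ Y` with respect to the `δ_a`, for a vector `ξ` at `u`. -/
def covZ (u : DualTot r E) (ξ : GT E A u) (Y : RawSection E A) : Fin r → ℝ :=
  (fun a => actAt (fr.zCoord Y a) u ξ) + fr.conn g u ξ *ᵥ fun a => fr.zc a u (Y u)

/-- The components of `D_ξ Y` with respect to the `∂^a`, for a vector `ξ` at `u`. -/
def covV (u : DualTot r E) (ξ : GT E A u) (Y : RawSection E A) : Fin r → ℝ :=
  (fun a => actAt (fr.vCoord Y a) u ξ) + (- (fr.conn g u ξ)ᵀ) *ᵥ fun a => fr.vc a u (Y u)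

/-- The covariant derivative `D_ξ Y`, for a vector `ξ` at `u`, in terms of an adapted frame. -/
def cov (u : DualTot r E) (ξ : GT E A u) (Y : RawSection E A) : GT E A u :=
  ∑ a, fr.covZ g u ξ Y a • fr.δ a u + ∑ a, fr.covV g u ξ Y a • fr.vdot a u

theorem cov_congr {u : DualTot r E} {Y Y' : RawSection E A} (hY : ∀ᶠ v in 𝓝 u, Y v = Y' v)
    (ξ : GT E A u) : fr.cov g u ξ Y = fr.cov g u ξ Y' := by
  have h1 : ∀ a, actAt (A := A) (fr.zCoord Y a) u = actAt (fr.zCoord Y' a) u := fun a =>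
    LinearMap.ext fun p => dirDeriv_congr (hY.mono fun v hv => by
      rw [zCoord_eq_zc, zCoord_eq_zc, hv]) _
  have h2 : ∀ a, actAt (A := A) (fr.vCoord Y a) u = actAt (fr.vCoord Y' a) u := fun a =>
    LinearMap.ext fun p => dirDeriv_congr (hY.mono fun v hv => by
      rw [vCoord_eq_vc, vCoord_eq_vc, hv]) _
  simp only [cov, covZ, covV, h1, h2, hY.self_of_nhds]

section At

variable {fr} {g} {u : DualTot r E}

theorem covV_of_mem_hor {ξ : GT E A u} {Y : RawSection E A} (hY : ∀ᶠ v in 𝓝 u, Y v ∈ C.Hor v) :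
    fr.covV g u ξ Y = 0 := by
  have h1 : ∀ a, actAt (fr.vCoord Y a) u ξ = 0 := fun a =>
    (dirDeriv_congr (hY.mono fun v hv => vc_of_mem_hor hv a) _).trans (dirDeriv_const 0 _)
  have h2 : (fun a => fr.vc a u (Y u)) = 0 := funext fun a => vc_of_mem_hor hY.self_of_nhds a
  unfold covV
  rw [h2, mulVec_zero, add_zero]
  exact funext h1

theorem covZ_of_mem_vert {ξ : GT E A u} {Y : RawSection E A} (hY : ∀ᶠ v in 𝓝 u, Y v ∈ Vert A v) :
    fr.covZ g u ξ Y = 0 := by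
  have h1 : ∀ a, actAt (fr.zCoord Y a) u ξ = 0 := fun a =>
    (dirDeriv_congr (hY.mono fun v hv => zc_of_mem_vert hv a) _).trans (dirDeriv_const 0 _)
  have h2 : (fun a => fr.zc a u (Y u)) = 0 := funext fun a => zc_of_mem_vert hY.self_of_nhds a
  unfold covZ
  rw [h2, mulVec_zero, add_zero]
  exact funext h1

theorem cov_mem_hor {ξ : GT E A u} {Y : RawSection E A} (hY : ∀ᶠ v in 𝓝 u, Y v ∈ C.Hor v) :
    fr.cov g u ξ Y ∈ C.Hor u := by
  unfold cov
  rw [covV_of_mem_hor hY]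
  simp only [Pi.zero_apply, zero_smul, Finset.sum_const_zero, add_zero]
  exact Submodule.sum_mem _ fun a _ => Submodule.smul_mem _ _ (fr.δ_mem a u)

theorem cov_mem_vert {ξ : GT E A u} {Y : RawSection E A} (hY : ∀ᶠ v in 𝓝 u, Y v ∈ Vert A v) :
    fr.cov g u ξ Y ∈ Vert A u := by
  unfold cov
  rw [covZ_of_mem_vert hY]
  simp only [Pi.zero_apply, zero_smul, Finset.sum_const_zero, zero_add]
  exact Submodule.sum_mem _ fun a _ => Submodule.smul_mem _ _ (fr.vdot_mem a u)

variable (hu : u.1 ∈ fr.U)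

include hu

theorem zc_cov (ξ : GT E A u) (Y : RawSection E A) (a : Fin r) :
    fr.zc a u (fr.cov g u ξ Y) = fr.covZ g u ξ Y a := by
  simp [cov, zc_δ hu, zc_vdot]

theorem vc_cov (ξ : GT E A u) (Y : RawSection E A) (a : Fin r) :
    fr.vc a u (fr.cov g u ξ Y) = fr.covV g u ξ Y a := by
  simp [cov, vc_vdot hu, vc_δ]

theorem cov_vec_add (ξ ξ' : GT E A u) (Y : RawSection E A) :
    fr.cov g u (ξ + ξ') Y = fr.cov g u ξ Y + fr.cov g u ξ' Y := by
  refine frame_ext hu (fun a => ?_) fun a => ?_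
  · rw [map_add, zc_cov hu, zc_cov hu, zc_cov hu]
    simp only [covZ, conn_add, add_mulVec, Pi.add_apply, map_add]
    ring
  · rw [map_add, vc_cov hu, vc_cov hu, vc_cov hu]
    simp only [covV, conn_add, transpose_add, neg_mulVec, add_mulVec, Pi.add_apply, Pi.neg_apply,
      map_add]
    ring

theorem cov_vec_smul (k : ℝ) (ξ : GT E A u) (Y : RawSection E A) :
    fr.cov g u (k • ξ) Y = k • fr.cov g u ξ Y := by
  refine frame_ext hu (fun a => ?_) fun a => ?_
  · rw [map_smul, zc_cov hu, zc_cov hu]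
    simp only [covZ, conn_smul, smul_mulVec, Pi.add_apply, Pi.smul_apply, map_smul, smul_eq_mul]
    ring
  · rw [map_smul, vc_cov hu, vc_cov hu]
    simp only [covV, conn_smul, transpose_smul, neg_mulVec, smul_mulVec, Pi.add_apply,
      Pi.neg_apply, Pi.smul_apply, map_smul, smul_eq_mul]
    ring

theorem cov_add (ξ : GT E A u) {Y Y' : RawSection E A} (hY : SmoothAt Y u) (hY' : SmoothAt Y' u) :
    fr.cov g u ξ (Y + Y') = fr.cov g u ξ Y + fr.cov g u ξ Y' := by
  have hz := fun a => (contMDiffAt_zCoord hu hY a).mdifferentiableAt (by simp)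
  have hz' := fun a => (contMDiffAt_zCoord hu hY' a).mdifferentiableAt (by simp)
  have hv := fun a => (contMDiffAt_vCoord hu hY a).mdifferentiableAt (by simp)
  have hv' := fun a => (contMDiffAt_vCoord hu hY' a).mdifferentiableAt (by simp)
  have h1 : ∀ a, actAt (fr.zCoord (Y + Y') a) u ξ
      = actAt (fr.zCoord Y a) u ξ + actAt (fr.zCoord Y' a) u ξ := fun a =>
    (dirDeriv_congr (Eventually.of_forall fun v => map_add (fr.zc a v) (Y v) (Y' v)) _).trans
      (dirDeriv_add (hz a) (hz' a) _)
  have h2 : ∀ a, actAt (fr.vCoord (Y + Y') a) u ξ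
      = actAt (fr.vCoord Y a) u ξ + actAt (fr.vCoord Y' a) u ξ := fun a =>
    (dirDeriv_congr (Eventually.of_forall fun v => map_add (fr.vc a v) (Y v) (Y' v)) _).trans
      (dirDeriv_add (hv a) (hv' a) _)
  have h3 : (fun a => fr.zc a u (Y u + Y' u))
      = (fun a => fr.zc a u (Y u)) + fun a => fr.zc a u (Y' u) :=
    funext fun a => map_add (fr.zc a u) (Y u) (Y' u)
  have h4 : (fun a => fr.vc a u (Y u + Y' u))
      = (fun a => fr.vc a u (Y u)) + fun a => fr.vc a u (Y' u) :=
    funext fun a => map_add (fr.vc a u) (Y u) (Y' u)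
  refine frame_ext hu (fun a => ?_) fun a => ?_
  · rw [map_add, zc_cov hu, zc_cov hu, zc_cov hu]
    simp only [covZ, h1, h3, mulVec_add, Pi.add_apply]
    ring
  · rw [map_add, vc_cov hu, vc_cov hu, vc_cov hu]
    simp only [covV, h2, h4, mulVec_add, Pi.add_apply]
    ring

theorem cov_smul (ξ : GT E A u) {f : DualTot r E → ℝ} {Y : RawSection E A}
    (hf : ContMDiffAt (DualI m r) 𝓘(ℝ, ℝ) ∞ f u) (hY : SmoothAt Y u) :
    fr.cov g u ξ (fun v => f v • Y v) = f u • fr.cov g u ξ Y + actAt f u ξ • Y u := by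
  have hf' := hf.mdifferentiableAt (by simp)
  have hz := fun a => (contMDiffAt_zCoord hu hY a).mdifferentiableAt (by simp)
  have hv := fun a => (contMDiffAt_vCoord hu hY a).mdifferentiableAt (by simp)
  have h1 : ∀ a, actAt (fr.zCoord (fun v => f v • Y v) a) u ξ
      = f u * actAt (fr.zCoord Y a) u ξ + fr.zc a u (Y u) * actAt f u ξ := fun a =>
    (dirDeriv_congr (Eventually.of_forall fun v => map_smul (fr.zc a v) (f v) (Y v)) _).trans
      (dirDeriv_mul hf' (hz a) _)
  have h2 : ∀ a, actAt (fr.vCoord (fun v => f v • Y v) a) u ξ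
      = f u * actAt (fr.vCoord Y a) u ξ + fr.vc a u (Y u) * actAt f u ξ := fun a =>
    (dirDeriv_congr (Eventually.of_forall fun v => map_smul (fr.vc a v) (f v) (Y v)) _).trans
      (dirDeriv_mul hf' (hv a) _)
  have h3 : (fun a => fr.zc a u (f u • Y u)) = f u • fun a => fr.zc a u (Y u) :=
    funext fun a => map_smul (fr.zc a u) (f u) (Y u)
  have h4 : (fun a => fr.vc a u (f u • Y u)) = f u • fun a => fr.vc a u (Y u) :=
    funext fun a => map_smul (fr.vc a u) (f u) (Y u)
  refine frame_ext hu (fun a => ?_) fun a => ?_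
  · rw [map_add, map_smul, map_smul, zc_cov hu, zc_cov hu]
    simp only [covZ, h1, h3, mulVec_smul, Pi.add_apply, Pi.smul_apply, smul_eq_mul]
    ring
  · rw [map_add, map_smul, map_smul, vc_cov hu, vc_cov hu]
    simp only [covV, h2, h4, mulVec_smul, Pi.add_apply, Pi.smul_apply, smul_eq_mul]
    ring

theorem cov_sum (ξ : GT E A u) {ι : Type*} (I : Finset ι) {Y : ι → RawSection E A}
    (hY : ∀ i ∈ I, SmoothAt (Y i) u) :
    fr.cov g u ξ (fun v => ∑ i ∈ I, Y i v) = ∑ i ∈ I, fr.cov g u ξ (Y i) := by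
  classical
  induction I using Finset.induction_on with
  | empty =>
    simp only [Finset.sum_empty]
    refine frame_ext hu (fun a => ?_) fun a => ?_
    · rw [zc_cov hu, covZ_of_mem_vert (Eventually.of_forall fun v => Submodule.zero_mem _),
        map_zero]
      rfl
    · rw [vc_cov hu, covV_of_mem_hor (Eventually.of_forall fun v => Submodule.zero_mem _), map_zero]
      rfl
  | insert i I hi ih =>
    have h1 : SmoothAt (fun v => ∑ i ∈ I, Y i v) u := by
      have h2 := SmoothAt.sum_smul I (c := fun _ _ => 1) (fun _ _ => contMDiffAt_const)
        fun i hi => hY i (Finset.mem_insert_of_mem hi)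
      simpa only [one_smul] using h2
    rw [Finset.sum_insert hi, ← ih fun i hi => hY i (Finset.mem_insert_of_mem hi),
      ← cov_add hu ξ (hY i (Finset.mem_insert_self i I)) h1]
    exact congrArg _ (funext fun v => Finset.sum_insert hi)

theorem cov_δ (ξ : GT E A u) (b : Fin r) :
    fr.cov g u ξ (fr.δ b) = ∑ a, fr.conn g u ξ a b • fr.δ a u := by
  have h1 : fr.covZ g u ξ (fr.δ b) = fun a => fr.conn g u ξ a b := by
    funext a
    have h2 : actAt (fr.zCoord (fr.δ b) a) u ξ = 0 :=
      (dirDeriv_congr ((eventually_mem hu).mono fun v hv => zc_δ hv a b) _).trans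
        (dirDeriv_const _ _)
    simp [covZ, h2, mulVec, dotProduct, zc_δ hu]
  unfold cov
  rw [h1, covV_of_mem_hor (Eventually.of_forall fun v => fr.δ_mem b v)]
  simp

theorem cov_vdot (ξ : GT E A u) (a : Fin r) :
    fr.cov g u ξ (fr.vdot a) = ∑ b, (- fr.conn g u ξ a b) • fr.vdot b u := by
  have h1 : fr.covV g u ξ (fr.vdot a) = fun b => - fr.conn g u ξ a b := by
    funext b
    have h2 : actAt (fr.vCoord (fr.vdot a) b) u ξ = 0 :=
      (dirDeriv_congr ((eventually_mem hu).mono fun v hv => vc_vdot hv b a) _).trans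
        (dirDeriv_const _ _)
    simp [covV, h2, mulVec, dotProduct, vc_vdot hu]
  unfold cov
  rw [h1, covZ_of_mem_vert (Eventually.of_forall fun v => fr.vdot_mem a v)]
  simp

/-! ### Smoothness of the covariant derivative -/

theorem contMDiffAt_leviCivitaH (a b c : Fin r) :
    ContMDiffAt (DualI m r) 𝓘(ℝ, ℝ) ∞ (fr.leviCivitaH g a b c) u := by
  have hδ := fun x y z => (smoothAt_δ hu x).act (contMDiffAt_gDown (g := g) hu y z)
  have hgL : ∀ x y w, ContMDiffAt (DualI m r) 𝓘(ℝ, ℝ) ∞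
      (fun v => ∑ d, fr.gDown g x d v * fr.L d y w v) u := fun x y w =>
    contMDiffAt_finsetSum fun d _ => (contMDiffAt_gDown hu x d).mul (contMDiffAt_L hu d y w)
  exact contMDiffAt_const.mul (contMDiffAt_finsetSum fun e _ => (contMDiffAt_gUp hu a e).mul
    ((((((hδ b e c).add (hδ c b e)).sub (hδ e b c)).sub (hgL c b e)).add (hgL b e c)).sub
      (hgL e b c)))

theorem contMDiffAt_leviCivitaV (b a c : Fin r) :
    ContMDiffAt (DualI m r) 𝓘(ℝ, ℝ) ∞ (fr.leviCivitaV g b a c) u := by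
  have hv := fun x y z => (smoothAt_vdot hu x).act (contMDiffAt_gUp (g := g) hu y z)
  exact contMDiffAt_const.mul (contMDiffAt_finsetSum fun e _ => (contMDiffAt_gDown hu b e).mul
    (((hv c e a).add (hv a e c)).sub (hv e a c)))

theorem contMDiffAt_conn {X : RawSection E A} (hX : SmoothAt X u) (a b : Fin r) :
    ContMDiffAt (DualI m r) 𝓘(ℝ, ℝ) ∞ (fun v => fr.conn g v (X v) a b) u := by
  have h1 : ContMDiffAt (DualI m r) 𝓘(ℝ, ℝ) ∞ (fun v => ∑ c, (fr.leviCivitaH g a b c v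
      * fr.zCoord X c v - fr.leviCivitaV g b a c v * fr.vCoord X c v)) u :=
    contMDiffAt_finsetSum fun c _ =>
      ((contMDiffAt_leviCivitaH hu a b c).mul (contMDiffAt_zCoord hu hX c)).sub
        ((contMDiffAt_leviCivitaV hu b a c).mul (contMDiffAt_vCoord hu hX c))
  exact h1

theorem smoothAt_cov {X Y : RawSection E A} (hX : SmoothAt X u) (hY : SmoothAt Y u) :
    SmoothAt (fun v => fr.cov g v (X v) Y) u := by
  have hz : ∀ a, ContMDiffAt (DualI m r) 𝓘(ℝ, ℝ) ∞
      (fun v => ∑ b, fr.conn g v (X v) a b * fr.zCoord Y b v) u := fun a =>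
    contMDiffAt_finsetSum fun b _ => (contMDiffAt_conn hu hX a b).mul (contMDiffAt_zCoord hu hY b)
  have hv : ∀ a, ContMDiffAt (DualI m r) 𝓘(ℝ, ℝ) ∞
      (fun v => ∑ b, - fr.conn g v (X v) b a * fr.vCoord Y b v) u := fun a =>
    contMDiffAt_finsetSum fun b _ =>
      (contMDiffAt_conn hu hX b a).neg.mul (contMDiffAt_vCoord hu hY b)
  exact SmoothAt.add
    (SmoothAt.sum_smul _ (fun a _ => (hX.act (contMDiffAt_zCoord hu hY a)).add (hz a))
      fun a _ => smoothAt_δ hu a)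
    (SmoothAt.sum_smul _ (fun a _ => (hX.act (contMDiffAt_vCoord hu hY a)).add (hv a))
      fun a _ => smoothAt_vdot hu a)

/-! ### Metric compatibility -/

/-- In an adapted frame `G = g̃ ⊕ g`. -/
theorem form_eq {G : PseudoMetric C} (hG : G.IsDeterminedBy Φ g) (p q : GT E A u) :
    G.form u p q = (fun a => fr.zc a u p) ⬝ᵥ (fr.down g u *ᵥ fun a => fr.zc a u q)
      + (fun a => fr.vc a u p) ⬝ᵥ (fr.up g u *ᵥ fun a => fr.vc a u q) := by
  have h1 : ∀ a b, G.form u (fr.δ a u) (fr.vdot b u) = 0 := fun a b =>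
    G.orth u _ (fr.δ_mem a u) _ (fr.vdot_mem b u)
  have h2 : ∀ a b, G.form u (fr.vdot a u) (fr.δ b u) = 0 := fun a b => by rw [G.symm, h1]
  conv_lhs => rw [expand hu p, expand hu q]
  simp only [map_add, map_sum, map_smul, LinearMap.add_apply, LinearMap.sum_apply,
    LinearMap.smul_apply, smul_eq_mul, h1, h2, (hG fr u hu _ _).1, (hG fr u hu _ _).2, mul_zero,
    Finset.sum_const_zero, add_zero, zero_add]
  simp only [dotProduct, mulVec, down, up, of_apply, Finset.mul_sum]
  congr 1 <;> exact Finset.sum_comm.trans (Finset.sum_congr rfl fun a _ =>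
    Finset.sum_congr rfl fun b _ => by ring)

/-- The horizontal part of `G` is parallel. -/
theorem dirDeriv_down (ξ : GT E A u) {Y Z : RawSection E A} (hY : SmoothAt Y u)
    (hZ : SmoothAt Z u) :
    MDifferentiableAt (DualI m r) 𝓘(ℝ, ℝ) (fun v => (fun a => fr.zc a v (Y v)) ⬝ᵥ
      (fr.down g v *ᵥ fun a => fr.zc a v (Z v))) u ∧
    dirDeriv (DualI m r) (fun v => (fun a => fr.zc a v (Y v)) ⬝ᵥ
        (fr.down g v *ᵥ fun a => fr.zc a v (Z v))) u (wPart u ξ)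
      = fr.covZ g u ξ Y ⬝ᵥ (fr.down g u *ᵥ fun a => fr.zc a u (Z u))
        + (fun a => fr.zc a u (Y u)) ⬝ᵥ (fr.down g u *ᵥ fr.covZ g u ξ Z) := by
  have hzY := fun a => (contMDiffAt_zCoord hu hY a).mdifferentiableAt (by simp)
  have hzZ := fun a => (contMDiffAt_zCoord hu hZ a).mdifferentiableAt (by simp)
  have hdn := fun a b => (contMDiffAt_gDown (g := g) hu a b).mdifferentiableAt (by simp)
  have h1 := dirDeriv_dotProduct_mulVec (S := fun v => fr.down g v)
    (y := fun v a => fr.zc a v (Y v)) (z := fun v a => fr.zc a v (Z v)) hdn hzY hzZ (wPart u ξ)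
  refine ⟨h1.1, h1.2.trans ?_⟩
  have hd : (of fun a b => dirDeriv (DualI m r) (fun v => fr.down g v a b) u (wPart u ξ))
      = (fr.conn g u ξ)ᵀ * fr.down g u + fr.down g u * fr.conn g u ξ := (act_metric hu ξ).1
  rw [hd]
  exact dotProduct_mulVec_add _ _ _ _ _ _

/-- The vertical part of `G` is parallel. -/
theorem dirDeriv_up (ξ : GT E A u) {Y Z : RawSection E A} (hY : SmoothAt Y u)
    (hZ : SmoothAt Z u) :
    MDifferentiableAt (DualI m r) 𝓘(ℝ, ℝ) (fun v => (fun a => fr.vc a v (Y v)) ⬝ᵥ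
      (fr.up g v *ᵥ fun a => fr.vc a v (Z v))) u ∧
    dirDeriv (DualI m r) (fun v => (fun a => fr.vc a v (Y v)) ⬝ᵥ
        (fr.up g v *ᵥ fun a => fr.vc a v (Z v))) u (wPart u ξ)
      = fr.covV g u ξ Y ⬝ᵥ (fr.up g u *ᵥ fun a => fr.vc a u (Z u))
        + (fun a => fr.vc a u (Y u)) ⬝ᵥ (fr.up g u *ᵥ fr.covV g u ξ Z) := by
  have hvY := fun a => (contMDiffAt_vCoord hu hY a).mdifferentiableAt (by simp)
  have hvZ := fun a => (contMDiffAt_vCoord hu hZ a).mdifferentiableAt (by simp)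
  have hup := fun a b => (contMDiffAt_gUp (g := g) hu a b).mdifferentiableAt (by simp)
  have h1 := dirDeriv_dotProduct_mulVec (S := fun v => fr.up g v)
    (y := fun v a => fr.vc a v (Y v)) (z := fun v a => fr.vc a v (Z v)) hup hvY hvZ (wPart u ξ)
  refine ⟨h1.1, h1.2.trans ?_⟩
  have hd : (of fun a b => dirDeriv (DualI m r) (fun v => fr.up g v a b) u (wPart u ξ))
      = - (fr.conn g u ξ * fr.up g u + fr.up g u * (fr.conn g u ξ)ᵀ) := (act_metric hu ξ).2
  have h4 : - (fr.conn g u ξ * fr.up g u + fr.up g u * (fr.conn g u ξ)ᵀ)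
      = (-(fr.conn g u ξ)ᵀ)ᵀ * fr.up g u + fr.up g u * (-(fr.conn g u ξ)ᵀ) := by
    rw [transpose_neg, transpose_transpose, Matrix.neg_mul, Matrix.mul_neg, neg_add]
  rw [hd, h4]
  exact dotProduct_mulVec_add _ _ _ _ _ _

/-- `D G = 0`. -/
theorem actAt_form {G : PseudoMetric C} (hG : G.IsDeterminedBy Φ g) (ξ : GT E A u)
    {Y Z : RawSection E A} (hY : SmoothAt Y u) (hZ : SmoothAt Z u) :
    actAt (fun v => G.form v (Y v) (Z v)) u ξ
      = G.form u (fr.cov g u ξ Y) (Z u) + G.form u (Y u) (fr.cov g u ξ Z) := by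
  have h1 := dirDeriv_down (g := g) hu ξ hY hZ
  have h2 := dirDeriv_up (g := g) hu ξ hY hZ
  refine ((dirDeriv_congr ((eventually_mem hu).mono fun v hv => form_eq hv hG (Y v) (Z v)) _).trans
    (dirDeriv_add h1.1 h2.1 _)).trans ?_
  rw [h1.2, h2.2, form_eq hu hG, form_eq hu hG]
  simp only [zc_cov hu, vc_cov hu]
  exact add_add_add_comm _ _ _ _

/-! ### Torsion -/

theorem zc_torsion {X Y : RawSection E A} (hX : X u ∈ C.Hor u) (hY : Y u ∈ C.Hor u) (c : Fin r) :
    fr.zc c u (fr.cov g u (X u) Y - fr.cov g u (Y u) X)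
      = (∑ a, ∑ b, fr.zCoord X a u * fr.zCoord Y b u * fr.L c a b u)
        + act X (fr.zCoord Y c) u - act Y (fr.zCoord X c) u := by
  rw [map_sub, zc_cov hu, zc_cov hu]
  have h1 : ∑ a, ∑ b, fr.zCoord X a u * fr.zCoord Y b u * fr.L c a b u
      = (fr.conn g u (X u) *ᵥ fun a => fr.zc a u (Y u)) c
        - (fr.conn g u (Y u) *ᵥ fun a => fr.zc a u (X u)) c := by
    simp only [mulVec, dotProduct, conn, of_apply, vc_of_mem_hor hX, vc_of_mem_hor hY, mul_zero,
      sub_zero, Finset.sum_mul, zCoord_eq_zc]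
    rw [Finset.sum_comm
        (f := fun b e => fr.leviCivitaH g c b e u * fr.zc e u (X u) * fr.zc b u (Y u)),
      ← Finset.sum_sub_distrib]
    refine Finset.sum_congr rfl fun a _ => ?_
    rw [← Finset.sum_sub_distrib]
    refine Finset.sum_congr rfl fun b _ => ?_
    rw [← leviCivitaH_sub (g := g) hu c b a]
    ring
  rw [h1]
  simp only [covZ, Pi.add_apply, act_eq_actAt]
  ring

/-- The `H(HH)`-torsion vanishes. -/
theorem zPart_torsion {X Y : RawSection E A} (hX : X u ∈ C.Hor u) (hY : Y u ∈ C.Hor u) :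
    zPart u (fr.cov g u (X u) Y) - zPart u (fr.cov g u (Y u) X) = (fr.bracket X Y u).1 := by
  rw [← map_sub, expand_F hu (zPart u (fr.cov g u (X u) Y - fr.cov g u (Y u) X))]
  exact Finset.sum_congr rfl fun c _ => congrArg (· • _) (zc_torsion hu hX hY c)

omit hu in
/-- The Lie bracket of vertical vector fields is vertical. -/
theorem mfderiv_dualProj_mlieBracket {V W : ∀ v : DualTot r E, TangentSpace (DualI m r) v}
    (hV : ContMDiffAt (DualI m r) (DualI m r).tangent ∞
      (fun v => (⟨v, V v⟩ : TangentBundle (DualI m r) (DualTot r E))) u)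
    (hW : ContMDiffAt (DualI m r) (DualI m r).tangent ∞
      (fun v => (⟨v, W v⟩ : TangentBundle (DualI m r) (DualTot r E))) u)
    (hV0 : ∀ᶠ v in 𝓝 u, mfderiv (DualI m r) (𝓡 m) (dualProj (r := r) E) v (V v) = 0)
    (hW0 : ∀ᶠ v in 𝓝 u, mfderiv (DualI m r) (𝓡 m) (dualProj (r := r) E) v (W v) = 0) :
    mfderiv (DualI m r) (𝓡 m) (dualProj (r := r) E) u
      (VectorField.mlieBracket (DualI m r) V W u) = 0 := by
  refine eq_zero_of_dirDeriv_eq_zero fun f hf => ?_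
  have hcomp : ∀ (v : DualTot r E) (w : TangentSpace (DualI m r) v),
      dirDeriv (DualI m r) (f ∘ dualProj (r := r) E) v w
        = dirDeriv (𝓡 m) f v.1 (mfderiv (DualI m r) (𝓡 m) (dualProj (r := r) E) v w) := fun v w =>
    dirDeriv_comp (hf.mdifferentiableAt (by simp))
      (dualProj_contMDiff.mdifferentiableAt (by simp)) w
  have h0 : ∀ (Z : ∀ v : DualTot r E, TangentSpace (DualI m r) v) (w : TangentSpace (DualI m r) u),
      (∀ᶠ v in 𝓝 u, mfderiv (DualI m r) (𝓡 m) (dualProj (r := r) E) v (Z v) = 0) →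
      dirDeriv (DualI m r) (fun v => dirDeriv (DualI m r) (f ∘ dualProj (r := r) E) v (Z v)) u w
        = 0 := fun Z w hZ =>
    (dirDeriv_congr (hZ.mono fun v hv => by
      rw [hcomp, hv]
      exact dirDeriv_vec_zero) w).trans (dirDeriv_const 0 w)
  have h1 := dirDeriv_mlieBracket (f := f ∘ dualProj (r := r) E)
    ((hf.comp dualProj_contMDiff).contMDiffAt) hV hW
  rw [h0 _ _ hV0, h0 _ _ hW0, sub_zero] at h1
  exact (hcomp u _).symm.trans h1

/-- The `V(VV)`-torsion vanishes. The bracket of vertical fields is vertical, and its derivatives of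
the fibre coordinates are commutators; the terms with `V_b^{ac}`, symmetric in `a` and `c`,
cancel. -/
theorem wPart_torsion {X Y : RawSection E A} (hX : SmoothAt X u) (hY : SmoothAt Y u)
    (hXv : ∀ᶠ v in 𝓝 u, X v ∈ Vert A v) (hYv : ∀ᶠ v in 𝓝 u, Y v ∈ Vert A v) :
    wPart u (fr.cov g u (X u) Y) - wPart u (fr.cov g u (Y u) X)
      = VectorField.mlieBracket (DualI m r) (fun v => wPart v (X v))
        (fun v => wPart v (Y v)) u := by
  have hvert := mfderiv_dualProj_mlieBracket hX.2 hY.2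
    (hXv.mono fun v hv => mfderiv_dualProj_wPart_of_mem_vert hv)
    (hYv.mono fun v hv => mfderiv_dualProj_wPart_of_mem_vert hv)
  rw [fr.dualPair.expand_vertical hu hvert, ← map_sub,
    expand hu (fr.cov g u (X u) Y - fr.cov g u (Y u) X)]
  have hz : ∀ a, fr.zc a u (fr.cov g u (X u) Y - fr.cov g u (Y u) X) = 0 := fun a => by
    rw [map_sub, zc_of_mem_vert (cov_mem_vert hYv), zc_of_mem_vert (cov_mem_vert hXv), sub_zero]
  simp only [hz, zero_smul, Finset.sum_const_zero, zero_add]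
  rw [map_sum]
  refine Finset.sum_congr rfl fun b _ => ?_
  rw [map_smul, wPart_vdot]
  refine congrArg (· • _) ?_
  rw [dirDeriv_mlieBracket (fr.dualPair.fibreCoord_smooth hu b) hX.2 hY.2, map_sub, vc_cov hu,
    vc_cov hu]
  have h1 : ∀ Z : RawSection E A, (∀ᶠ v in 𝓝 u, Z v ∈ Vert A v) →
      fr.vCoord Z b =ᶠ[𝓝 u] fun v => dirDeriv (DualI m r) (fibreCoord fr.e b) v (wPart v (Z v)) :=
    fun Z hZ => hZ.mono fun v hv => vc_of_mem_vert hv b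
  rw [← dirDeriv_congr (h1 X hXv), ← dirDeriv_congr (h1 Y hYv)]
  have h2 : ((-(fr.conn g u (X u))ᵀ) *ᵥ fun a => fr.vc a u (Y u)) b
      = ((-(fr.conn g u (Y u))ᵀ) *ᵥ fun a => fr.vc a u (X u)) b := by
    simp only [mulVec, dotProduct, Matrix.neg_apply, transpose_apply, conn, of_apply,
      zc_of_mem_vert hXv.self_of_nhds, zc_of_mem_vert hYv.self_of_nhds, mul_zero, zero_sub,
      Finset.sum_neg_distrib, neg_neg, Finset.sum_mul]
    rw [Finset.sum_comm]
    refine Finset.sum_congr rfl fun a _ => Finset.sum_congr rfl fun c _ => ?_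
    rw [leviCivitaV_symm]
    ring
  simp only [covV, Pi.add_apply, h2]
  change actAt _ u (X u) + _ - (actAt _ u (Y u) + _) = actAt _ u (X u) - actAt _ u (Y u)
  ring

end At

end AdaptedFrame

namespace AdaptedFrame

open Matrix

variable {Φ : BundleIso r h F E} {C : Connection E A} {fr fr' : AdaptedFrame Φ C}
  {g : VertPseudoMetric E A}

/-! ### The duality of the horizontal and the vertical bundle -/

variable (fr) in
/-- The pairing `∑ₐ zᵃ(p) pₐ(q)` of horizontal and vertical parts, which comes from the
identifications of the horizontal bundle with `π* E` and of the vertical bundle with `π* E*`. -/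
def pair (u : DualTot r E) (p q : GT E A u) : ℝ :=
  (fun a => fr.zc a u p) ⬝ᵥ fun a => fr.vc a u q

section At

variable {u : DualTot r E} (hu : u.1 ∈ fr.U) (hu' : u.1 ∈ fr'.U)

include hu

/-- A normal connection preserves the pairing: the connection forms on the two factors are
`ω` and `-ωᵀ`. -/
theorem actAt_pair (ξ : GT E A u) {Z Y : RawSection E A} (hZ : SmoothAt Z u) (hY : SmoothAt Y u) :
    actAt (fun v => fr.pair v (Z v) (Y v)) u ξ
      = fr.pair u (fr.cov g u ξ Z) (Y u) + fr.pair u (Z u) (fr.cov g u ξ Y) := by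
  have hz := fun a => (contMDiffAt_zCoord hu hZ a).mdifferentiableAt (by simp)
  have hv := fun a => (contMDiffAt_vCoord hu hY a).mdifferentiableAt (by simp)
  have hzv : ∀ a ∈ Finset.univ, MDifferentiableAt (DualI m r) 𝓘(ℝ, ℝ)
      (fun v => fr.zCoord Z a v * fr.vCoord Y a v) u := fun a _ => (hz a).mul (hv a)
  have h1 : actAt (fun v => fr.pair v (Z v) (Y v)) u ξ
      = (fun a => actAt (fr.zCoord Z a) u ξ) ⬝ᵥ (fun a => fr.vc a u (Y u))
        + (fun a => fr.zc a u (Z u)) ⬝ᵥ fun a => actAt (fr.vCoord Y a) u ξ := by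
    refine (dirDeriv_sum Finset.univ hzv (wPart u ξ)).trans ?_
    simp only [dotProduct]
    rw [← Finset.sum_add_distrib]
    refine Finset.sum_congr rfl fun a _ => (dirDeriv_mul (hz a) (hv a) _).trans ?_
    change fr.zc a u (Z u) * actAt (fr.vCoord Y a) u ξ + fr.vc a u (Y u) * actAt (fr.zCoord Z a) u ξ
      = _
    ring
  have h2 : (fun a => fr.zc a u (Z u)) ⬝ᵥ ((-(fr.conn g u ξ)ᵀ) *ᵥ fun a => fr.vc a u (Y u))
      = - ((fr.conn g u ξ *ᵥ fun a => fr.zc a u (Z u)) ⬝ᵥ fun a => fr.vc a u (Y u)) := by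
    rw [neg_mulVec, dotProduct_neg, dotProduct_mulVec, vecMul_transpose]
  refine h1.trans ?_
  unfold pair
  simp only [zc_cov hu, vc_cov hu]
  change _ = fr.covZ g u ξ Z ⬝ᵥ _ + _ ⬝ᵥ fr.covV g u ξ Y
  unfold covZ covV
  rw [add_dotProduct, dotProduct_add, h2]
  ring

include hu'

/-- The pairing does not depend on the frame: `s^a` and `t_a` transform contragrediently. -/
theorem pair_eq (p q : GT E A u) : fr.pair u p q = fr'.pair u p q := by
  have h1 : ∀ a, fr.vc a u q = ∑ b, fr'.vc b u q * (fr'.s b u.1 (fr.e u.1 a) : ℝ) := by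
    intro a
    conv_lhs => rw [expand hu' q]
    rw [map_add, map_sum, map_sum]
    have h2 : ∀ b, fr.vc a u (fr'.δ b u) = 0 := fun b => vc_of_mem_hor (fr'.δ_mem b u) a
    have h3 : ∀ b, fr.vc a u (fr'.vdot b u) = fr'.s b u.1 (fr.e u.1 a) := fun b =>
      vc_vertLift hu a (fr'.s b)
    simp [h2, h3]
  have h4 : ∀ b, fr'.zc b u p = ∑ a, fr.zc a u p * (fr'.s b u.1 (fr.e u.1 a) : ℝ) := by
    intro b
    have h5 := congrArg (fun z => (fr'.s b u.1 z : ℝ))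
      (fr.dualPair.expand hu ((Φ.equiv u.1).symm (zPart u p)))
    simp only [map_sum, map_smul] at h5
    exact h5
  simp only [pair, dotProduct, h1, h4, Finset.mul_sum, Finset.sum_mul]
  rw [Finset.sum_comm]
  exact Finset.sum_congr rfl fun b _ => Finset.sum_congr rfl fun a _ => by ring

end At

/-! ### The bracket of sections that come from `F` -/

/-- The `F`-component of the bracket of sections whose `F`-components are pulled back from `F` is
the pull back of their bracket, in all frames. -/
theorem bracket_fst {u : DualTot r E} (hu : u.1 ∈ fr.U) {X Y : RawSection E A}
    {s w : Cₛ^∞⟮𝓡 m; FibModel r, F⟯} (hX : ∀ v : DualTot r E, zPart v (X v) = s (h v.1))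
    (hY : ∀ v : DualTot r E, zPart v (Y v) = w (h v.1)) :
    (fr.bracket X Y u).1 = A.bracket s w (h u.1) := by
  let σ : Fin r → M → ℝ := fun a x => fr.s a x ((Φ.equiv x).symm (s (h x)))
  let τ : Fin r → M → ℝ := fun a x => fr.s a x ((Φ.equiv x).symm (w (h x)))
  have hσ : ∀ a, fr.zCoord X a = σ a ∘ dualProj (r := r) E := fun a => funext fun v => by
    simp only [zCoord, hX]
    rfl
  have hτ : ∀ a, fr.zCoord Y a = τ a ∘ dualProj (r := r) E := fun a => funext fun v => by
    simp only [zCoord, hY]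
    rfl
  have hexp : ∀ (z : Cₛ^∞⟮𝓡 m; FibModel r, F⟯), ∀ x ∈ fr.U, z (h x)
      = ∑ a, (fr.s a x ((Φ.equiv x).symm (z (h x))) : ℝ) • fr.t a (h x) := fun z x hx =>
    expand_F (u := (⟨x, 0⟩ : DualTot r E)) hx (z (h x))
  have hsm : ∀ (z : Cₛ^∞⟮𝓡 m; FibModel r, F⟯) (a : Fin r), ContMDiffOn (𝓡 m) 𝓘(ℝ, ℝ) ∞
      (fun x => (fr.s a x ((Φ.equiv x).symm (z (h x))) : ℝ)) fr.U := by
    intro z a x hx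
    refine (contMDiffAt_coeff (V := F) (FV := FibModel r)
      (c := fun a x => (fr.s a x ((Φ.equiv x).symm (z (h x))) : ℝ))
      (t := fun a x => fr.t a (h x)) (by simp) (z.contMDiff.comp h.contMDiff x)
      (fun b => (fr.t b).contMDiff.comp h.contMDiff x) ?_ ?_ a).contMDiffWithinAt
    · filter_upwards [fr.isOpen_U.mem_nhds hx] with y hy
      exact linearIndependent_t (u := (⟨y, 0⟩ : DualTot r E)) hy
    · filter_upwards [fr.isOpen_U.mem_nhds hx] with y hy
      exact hexp z y hy
  have hact : ∀ (Z : RawSection E A) (z z' : Cₛ^∞⟮𝓡 m; FibModel r, F⟯) (c : Fin r),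
      zPart u (Z u) = z (h u.1) →
      act Z ((fun x => (fr.s c x ((Φ.equiv x).symm (z' (h x))) : ℝ)) ∘ dualProj (r := r) E) u
        = dirDeriv (𝓡 m) (fun x => (fr.s c x ((Φ.equiv x).symm (z' (h x))) : ℝ)) u.1
          (A.anchorField z u.1) := by
    intro Z z z' c hZ
    have h1 := dirDeriv_comp (x := u) (φ := dualProj (r := r) E)
      (((hsm z' c).contMDiffAt (fr.isOpen_U.mem_nhds hu)).mdifferentiableAt (by simp))
      (dualProj_contMDiff.mdifferentiableAt (by simp)) (wPart u (Z u))
    rw [mfderiv_dualProj_wPart (Z u) hZ.symm] at h1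
    exact h1
  rw [A.bracket_apply_of_eq_sum_sum fr.isOpen_U hu (hsm s) (hsm w) (hexp s) (hexp w)]
  have hL : ∀ a b, A.bracket (fr.t a) (fr.t b) (h u.1) = ∑ c, fr.L c a b u • fr.t c (h u.1) :=
    fun a b => expand_F hu _
  simp only [bracket, hσ, hτ]
  simp only [σ, τ, hact X s w _ (hX u), hact Y w s _ (hY u), hL, Finset.smul_sum, smul_smul]
  simp only [add_sub_assoc, add_smul, Finset.sum_add_distrib, Finset.sum_smul]
  congr 1
  rw [Finset.sum_comm]
  refine Finset.sum_congr rfl fun a _ => ?_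
  rw [Finset.sum_comm]
  rfl

/-! ### Independence of the frame -/

/-- A trilinear form that is symmetric in the first two and antisymmetric in the last two arguments
vanishes. -/
theorem eq_zero_of_symm_of_antisymm {ι : Type*} {S : ι → ι → ι → ℝ}
    (h1 : ∀ a b c, S a b c = S b a c) (h2 : ∀ a b c, S a b c = - S a c b) (a b c : ι) :
    S a b c = 0 := by
  linarith [h1 a b c, h2 b a c, h1 b c a, h2 c b a, h1 c a b, h2 a c b]

section At

variable {u : DualTot r E} (hu : u.1 ∈ fr.U) (hu' : u.1 ∈ fr'.U) {G : PseudoMetric C}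
  (hG : G.IsDeterminedBy Φ g)

include hu hu'

/-- The covariant derivatives of two frames differ by an infinitesimal isometry of the pairing. -/
theorem pair_cov_sub (ξ : GT E A u) {Z Y : RawSection E A} (hZ : SmoothAt Z u)
    (hY : SmoothAt Y u) :
    fr'.pair u (fr.cov g u ξ Z) (Y u) + fr'.pair u (Z u) (fr.cov g u ξ Y)
      = fr'.pair u (fr'.cov g u ξ Z) (Y u) + fr'.pair u (Z u) (fr'.cov g u ξ Y) := by
  rw [← pair_eq hu hu', ← pair_eq hu hu', ← actAt_pair hu ξ hZ hY, ← actAt_pair hu' ξ hZ hY]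
  refine dirDeriv_congr ?_ _
  filter_upwards [eventually_mem hu, eventually_mem hu'] with v hv hv'
  exact pair_eq hv hv' _ _

include hG

/-- On horizontal vectors two torsion free metric derivatives agree. -/
theorem cov_δ_δ_eq (a b : Fin r) :
    fr.cov g u (fr'.δ a u) (fr'.δ b) = fr'.cov g u (fr'.δ a u) (fr'.δ b) := by
  have hδ := fun a => smoothAt_δ hu' a
  have hmem : ∀ a b, fr.cov g u (fr'.δ a u) (fr'.δ b)
      - fr'.cov g u (fr'.δ a u) (fr'.δ b) ∈ C.Hor u := fun a b =>
    Submodule.sub_mem _ (cov_mem_hor (Eventually.of_forall fun v => fr'.δ_mem b v))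
      (cov_mem_hor (Eventually.of_forall fun v => fr'.δ_mem b v))
  have hsymm : ∀ a b, fr.cov g u (fr'.δ a u) (fr'.δ b) - fr'.cov g u (fr'.δ a u) (fr'.δ b)
      = fr.cov g u (fr'.δ b u) (fr'.δ a) - fr'.cov g u (fr'.δ b u) (fr'.δ a) := by
    intro a b
    refine Connection.hor_ext (hmem a b) (hmem b a) ?_
    have h1 := zPart_torsion (g := g) hu (fr'.δ_mem a u) (fr'.δ_mem b u)
    have h2 := zPart_torsion (g := g) hu' (fr'.δ_mem a u) (fr'.δ_mem b u)
    rw [bracket_fst hu (fr'.zPart_δ a) (fr'.zPart_δ b)] at h1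
    rw [bracket_fst hu' (fr'.zPart_δ a) (fr'.zPart_δ b), ← h1] at h2
    rw [map_sub, map_sub]
    rw [sub_eq_sub_iff_add_eq_add] at h2 ⊢
    rw [← h2, add_comm]
  have hS := eq_zero_of_symm_of_antisymm
    (S := fun a b c => G.form u (fr.cov g u (fr'.δ a u) (fr'.δ b)
      - fr'.cov g u (fr'.δ a u) (fr'.δ b)) (fr'.δ c u))
    (fun a b c => by rw [hsymm]) (fun a b c => by
      have h1 := actAt_form hu hG (fr'.δ a u) (hδ b) (hδ c)
      have h2 := actAt_form hu' hG (fr'.δ a u) (hδ b) (hδ c)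
      rw [G.symm u _ (fr'.δ b u)]
      simp only [map_sub, LinearMap.sub_apply]
      linarith)
  refine sub_eq_zero.1 (G.nondeg_hor u _ (hmem a b) fun q hq => ?_)
  rw [expand hu' q]
  have h3 : ∀ c, fr'.vc c u q = 0 := fun c => vc_of_mem_hor hq c
  simp only [h3, zero_smul, Finset.sum_const_zero, add_zero]
  rw [map_sum]
  exact Finset.sum_eq_zero fun c _ => by rw [map_smul, hS, smul_zero]

/-- On vertical vectors two torsion free metric derivatives agree. -/
theorem cov_vdot_vdot_eq (a b : Fin r) :
    fr.cov g u (fr'.vdot a u) (fr'.vdot b) = fr'.cov g u (fr'.vdot a u) (fr'.vdot b) := by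
  have hν := fun a => smoothAt_vdot hu' a
  have hνm : ∀ a, ∀ᶠ v in 𝓝 u, fr'.vdot a v ∈ Vert A v := fun a =>
    Eventually.of_forall fun v => fr'.vdot_mem a v
  have hmem : ∀ a b, fr.cov g u (fr'.vdot a u) (fr'.vdot b)
      - fr'.cov g u (fr'.vdot a u) (fr'.vdot b) ∈ Vert A u := fun a b =>
    Submodule.sub_mem _ (cov_mem_vert (hνm b)) (cov_mem_vert (hνm b))
  have hsymm : ∀ a b, fr.cov g u (fr'.vdot a u) (fr'.vdot b)
      - fr'.cov g u (fr'.vdot a u) (fr'.vdot b)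
      = fr.cov g u (fr'.vdot b u) (fr'.vdot a) - fr'.cov g u (fr'.vdot b u) (fr'.vdot a) := by
    intro a b
    refine GT.ext ?_ ?_
    · rw [mem_vert_iff.1 (hmem a b), mem_vert_iff.1 (hmem b a)]
    · have h1 := wPart_torsion (g := g) hu (hν a) (hν b) (hνm a) (hνm b)
      have h2 := wPart_torsion (g := g) hu' (hν a) (hν b) (hνm a) (hνm b)
      rw [← h1] at h2
      rw [map_sub, map_sub]
      rw [sub_eq_sub_iff_add_eq_add] at h2 ⊢
      rw [← h2, add_comm]
  have hS := eq_zero_of_symm_of_antisymm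
    (S := fun a b c => G.form u (fr.cov g u (fr'.vdot a u) (fr'.vdot b)
      - fr'.cov g u (fr'.vdot a u) (fr'.vdot b)) (fr'.vdot c u))
    (fun a b c => by rw [hsymm]) (fun a b c => by
      have h1 := actAt_form hu hG (fr'.vdot a u) (hν b) (hν c)
      have h2 := actAt_form hu' hG (fr'.vdot a u) (hν b) (hν c)
      rw [G.symm u _ (fr'.vdot b u)]
      simp only [map_sub, LinearMap.sub_apply]
      linarith)
  refine sub_eq_zero.1 (G.nondeg_vert u _ (hmem a b) fun q hq => ?_)
  rw [expand hu' q]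
  have h3 : ∀ c, fr'.zc c u q = 0 := fun c => zc_of_mem_vert hq c
  simp only [h3, zero_smul, Finset.sum_const_zero, zero_add]
  rw [map_sum]
  exact Finset.sum_eq_zero fun c _ => by rw [map_smul, hS, smul_zero]

/-- On the horizontal bundle, the derivative along a vertical vector is dual to the derivative of
the vertical bundle along that vector. -/
theorem cov_vdot_δ_eq (a b : Fin r) :
    fr.cov g u (fr'.vdot a u) (fr'.δ b) = fr'.cov g u (fr'.vdot a u) (fr'.δ b) := by
  have hδ : ∀ᶠ v in 𝓝 u, fr'.δ b v ∈ C.Hor v := Eventually.of_forall fun v => fr'.δ_mem b v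
  refine frame_ext hu' (fun c => ?_) fun c => ?_
  · have h1 := pair_cov_sub (g := g) hu hu' (fr'.vdot a u) (smoothAt_δ hu' b) (smoothAt_vdot hu' c)
    rw [cov_vdot_vdot_eq hu hu' hG, add_left_inj] at h1
    simpa [pair, dotProduct, vc_vdot hu'] using h1
  · rw [vc_of_mem_hor (cov_mem_hor hδ), vc_of_mem_hor (cov_mem_hor hδ)]

/-- On the vertical bundle, the derivative along a horizontal vector is dual to the derivative of
the horizontal bundle along that vector. -/
theorem cov_δ_vdot_eq (a b : Fin r) :
    fr.cov g u (fr'.δ a u) (fr'.vdot b) = fr'.cov g u (fr'.δ a u) (fr'.vdot b) := by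
  have hν : ∀ᶠ v in 𝓝 u, fr'.vdot b v ∈ Vert A v := Eventually.of_forall fun v => fr'.vdot_mem b v
  refine frame_ext hu' (fun c => ?_) fun c => ?_
  · rw [zc_of_mem_vert (cov_mem_vert hν), zc_of_mem_vert (cov_mem_vert hν)]
  · have h1 := pair_cov_sub (g := g) hu hu' (fr'.δ a u) (smoothAt_δ hu' c) (smoothAt_vdot hu' b)
    rw [cov_δ_δ_eq hu hu' hG, add_right_inj] at h1
    simpa [pair, dotProduct, zc_δ hu'] using h1

/-- The covariant derivative does not depend on the adapted frame. -/
theorem cov_eq (ξ : GT E A u) {Y : RawSection E A} (hY : SmoothAt Y u) :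
    fr.cov g u ξ Y = fr'.cov g u ξ Y := by
  have hbase : ∀ b, fr.cov g u ξ (fr'.δ b) = fr'.cov g u ξ (fr'.δ b) ∧
      fr.cov g u ξ (fr'.vdot b) = fr'.cov g u ξ (fr'.vdot b) := by
    intro b
    refine frame_induction (P := fun ξ => fr.cov g u ξ (fr'.δ b) = fr'.cov g u ξ (fr'.δ b) ∧
      fr.cov g u ξ (fr'.vdot b) = fr'.cov g u ξ (fr'.vdot b)) hu' ?_ ?_ ?_ ?_ ?_ ξ
    · have h0 : ∀ (f : AdaptedFrame Φ C) (_ : u.1 ∈ f.U) (Z : RawSection E A),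
          f.cov g u 0 Z = 0 := fun f hf Z => by
        have h1 := cov_vec_smul (g := g) hf 0 0 Z
        rwa [zero_smul, zero_smul] at h1
      simp only [h0 fr hu, h0 fr' hu', and_self]
    · rintro p q ⟨h1, h2⟩ ⟨h3, h4⟩
      simp only [cov_vec_add hu, cov_vec_add hu', h1, h2, h3, h4, and_self]
    · rintro k p ⟨h1, h2⟩
      simp only [cov_vec_smul hu, cov_vec_smul hu', h1, h2, and_self]
    · exact fun a => ⟨cov_δ_δ_eq hu hu' hG a b, cov_δ_vdot_eq hu hu' hG a b⟩
    · exact fun a => ⟨cov_vdot_δ_eq hu hu' hG a b, cov_vdot_vdot_eq hu hu' hG a b⟩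
  have hz := fun a => contMDiffAt_zCoord hu' hY a
  have hv := fun a => contMDiffAt_vCoord hu' hY a
  have hδ := fun a => smoothAt_δ hu' a
  have hν := fun a => smoothAt_vdot hu' a
  -- The terms that differentiate the components of `Y` in `fr'` are the same for both derivatives.
  have hexp : ∀ f : AdaptedFrame Φ C, u.1 ∈ f.U → f.cov g u ξ Y
      = ∑ a, (fr'.zCoord Y a u • f.cov g u ξ (fr'.δ a) + actAt (fr'.zCoord Y a) u ξ • fr'.δ a u)
        + ∑ a, (fr'.vCoord Y a u • f.cov g u ξ (fr'.vdot a)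
          + actAt (fr'.vCoord Y a) u ξ • fr'.vdot a u) := by
    intro f hf
    have h1 : f.cov g u ξ Y = f.cov g u ξ ((fun v => ∑ a, fr'.zCoord Y a v • fr'.δ a v)
        + fun v => ∑ a, fr'.vCoord Y a v • fr'.vdot a v) :=
      cov_congr f g ((eventually_mem hu').mono fun v hv => expand hv (Y v)) ξ
    rw [h1, cov_add hf ξ (SmoothAt.sum_smul _ (fun a _ => hz a) fun a _ => hδ a)
      (SmoothAt.sum_smul _ (fun a _ => hv a) fun a _ => hν a),
      cov_sum hf ξ (Y := fun a v => fr'.zCoord Y a v • fr'.δ a v) _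
        fun a _ => SmoothAt.smul (hz a) (hδ a),
      cov_sum hf ξ (Y := fun a v => fr'.vCoord Y a v • fr'.vdot a v) _
        fun a _ => SmoothAt.smul (hv a) (hν a)]
    simp only [cov_smul hf ξ (hz _) (hδ _), cov_smul hf ξ (hv _) (hν _)]
  rw [hexp fr hu, hexp fr' hu']
  simp only [(hbase _).1, (hbase _).2]

end At

end AdaptedFrame

/-! ### The global connection -/

open AdaptedFrame

section Global

variable {Φ : BundleIso r h F E} {C : Connection E A} {g : VertPseudoMetric E A}

variable (Φ C) in
/-- A chosen adapted frame near the point `x`. -/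
def someFrame (x : M) : AdaptedFrame Φ C := (exists_adaptedFrame Φ C x).choose

variable (Φ C) in
theorem mem_someFrame (x : M) : x ∈ (someFrame Φ C x).U := (exists_adaptedFrame Φ C x).choose_spec

variable (Φ C g) in
/-- The covariant derivative, computed at each point in some adapted frame near it. -/
def levi (X Y : RawSection E A) (u : DualTot r E) : GT E A u :=
  (someFrame Φ C u.1).cov g u (X u) Y

variable {G : PseudoMetric C}

theorem levi_eq (hG : G.IsDeterminedBy Φ g) (fr : AdaptedFrame Φ C) {u : DualTot r E}
    (hu : u.1 ∈ fr.U) (X : RawSection E A) {Y : RawSection E A} (hY : SmoothAt Y u) :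
    levi Φ C g X Y u = fr.cov g u (X u) Y :=
  cov_eq (mem_someFrame Φ C u.1) hu hG (X u) hY

/-- The normal distinguished linear connection of Levi-Civita type. -/
def leviConnection (hG : G.IsDeterminedBy Φ g) : DLinearConnection C where
  D := levi Φ C g
  smooth X Y hX hY u := by
    refine (smoothAt_cov (g := g) (mem_someFrame Φ C u.1) (hX u) (hY u)).congr ?_
    exact (eventually_mem (mem_someFrame Φ C u.1)).mono fun v hv => levi_eq hG _ hv X (hY v)
  add_left X X' Y _ _ _ := funext fun u => cov_vec_add (mem_someFrame Φ C u.1) _ _ _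
  smul_left f X Y _ _ _ := funext fun u => cov_vec_smul (mem_someFrame Φ C u.1) _ _ _
  add_right X Y Y' _ hY hY' := funext fun u => cov_add (mem_someFrame Φ C u.1) _ (hY u) (hY' u)
  leibniz f X Y hf _ hY := funext fun u => cov_smul (mem_someFrame Φ C u.1) _ (hf u) (hY u)
  hor X Y _ _ hY u := cov_mem_hor (Eventually.of_forall hY)
  vert X Y _ _ hY u := cov_mem_vert (Eventually.of_forall hY)

theorem leviConnection_hasNormalComponents (hG : G.IsDeterminedBy Φ g) (fr : AdaptedFrame Φ C) :
    (leviConnection hG).HasNormalComponents fr (fr.leviCivitaH g) (fr.leviCivitaV g) := by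
  intro u hu
  refine ⟨fun b c => ?_, fun a c => ?_, fun b c => ?_, fun a c => ?_⟩
  · refine (levi_eq hG fr hu _ (smoothAt_δ hu b)).trans ((cov_δ hu _ b).trans ?_)
    simp only [conn_δ hu]
  · refine (levi_eq hG fr hu _ (smoothAt_vdot hu a)).trans ((cov_vdot hu _ a).trans ?_)
    simp only [conn_δ hu]
    exact (Finset.sum_congr rfl fun _ _ => neg_smul _ _).trans (Finset.sum_neg_distrib _)
  · refine (levi_eq hG fr hu _ (smoothAt_δ hu b)).trans ((cov_δ hu _ b).trans ?_)
    simp only [conn_vdot hu]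
    exact (Finset.sum_congr rfl fun _ _ => neg_smul _ _).trans (Finset.sum_neg_distrib _)
  · refine (levi_eq hG fr hu _ (smoothAt_vdot hu a)).trans ((cov_vdot hu _ a).trans ?_)
    simp only [conn_vdot hu, neg_neg]

theorem leviConnection_hhhTorsionFree (hG : G.IsDeterminedBy Φ g) :
    (leviConnection hG).HHHTorsionFree Φ := by
  intro fr X Y hX hY hXh hYh u hu
  have h1 := zPart_torsion (g := g) hu (hXh u) (hYh u)
  rw [← levi_eq hG fr hu X (hY u), ← levi_eq hG fr hu Y (hX u)] at h1
  exact sub_eq_zero.2 h1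

theorem leviConnection_vvvTorsionFree (hG : G.IsDeterminedBy Φ g) :
    (leviConnection hG).VVVTorsionFree Φ := by
  intro fr X Y hX hY hXv hYv u hu
  have h1 := wPart_torsion (g := g) hu (hX u) (hY u) (Eventually.of_forall hXv)
    (Eventually.of_forall hYv)
  rw [← levi_eq hG fr hu X (hY u), ← levi_eq hG fr hu Y (hX u)] at h1
  refine Prod.ext ?_ (sub_eq_zero.2 h1)
  have hz : ∀ (Z : RawSection E A) (c : Fin r), (∀ u, Z u ∈ Vert A u) →
      fr.zCoord Z c = fun _ => 0 := fun Z c hZ => funext fun v => zc_of_mem_vert (hZ v) c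
  have h2 : (fr.bracket X Y u).1 = 0 := by
    simp only [AdaptedFrame.bracket, hz X _ hXv, hz Y _ hYv, act, dirDeriv_const, zero_mul,
      Finset.sum_const_zero, add_zero, sub_zero, zero_smul]
  have h3 : ∀ Z Z' : RawSection E A, (∀ u, Z' u ∈ Vert A u) → zPart u (levi Φ C g Z Z' u) = 0 :=
    fun Z Z' hZ' => mem_vert_iff.1 (cov_mem_vert (Eventually.of_forall hZ'))
  change zPart u (levi Φ C g X Y u) - zPart u (levi Φ C g Y X u) - (fr.bracket X Y u).1 = 0
  rw [h2, h3 X Y hYv, h3 Y X hXv, sub_zero, sub_zero]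

theorem leviConnection_isMetric (hG : G.IsDeterminedBy Φ g) : (leviConnection hG).IsMetric G :=
  fun X _ _ _ hY hZ u => actAt_form (mem_someFrame Φ C u.1) hG (X u) (hY u) (hZ u)

end Global

end Tangent

end GenHamilton

end

theorem theorem6p1 {m r : ℕ}
    {M : Type*} [TopologicalSpace M] [ChartedSpace (GenHamilton.BaseModel m) M]
    [IsManifold (𝓡 m) ∞ M] [T2Space M]
    {N : Type*} [TopologicalSpace N] [ChartedSpace (GenHamilton.BaseModel m) N]
    [IsManifold (𝓡 m) ∞ N] [T2Space N]
    {h : M ≃ₘ^∞⟮𝓡 m, 𝓡 m⟯ N} {η : N ≃ₘ^∞⟮𝓡 m, 𝓡 m⟯ M}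
    {E : M → Type*} [TopologicalSpace (TotalSpace (GenHamilton.FibModel r) E)]
    [∀ x, AddCommGroup (E x)] [∀ x, Module ℝ (E x)] [∀ x, TopologicalSpace (E x)]
    [FiberBundle (GenHamilton.FibModel r) E] [VectorBundle ℝ (GenHamilton.FibModel r) E]
    [ContMDiffVectorBundle ∞ (GenHamilton.FibModel r) E (𝓡 m)]
    {F : N → Type*} [TopologicalSpace (TotalSpace (GenHamilton.FibModel r) F)]
    [∀ y, AddCommGroup (F y)] [∀ y, Module ℝ (F y)] [∀ y, TopologicalSpace (F y)]
    [FiberBundle (GenHamilton.FibModel r) F] [VectorBundle ℝ (GenHamilton.FibModel r) F]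
    [ContMDiffVectorBundle ∞ (GenHamilton.FibModel r) F (𝓡 m)]
    (A : GenHamilton.GenLieAlgebroid r h η F) (Φ : GenHamilton.BundleIso r h F E)
    (C : GenHamilton.Connection E A)
    (g : GenHamilton.VertPseudoMetric E A) (G : GenHamilton.PseudoMetric C)
    (hG : G.IsDeterminedBy Φ g) :
    ∃ 𝒟 : GenHamilton.DLinearConnection C,
      (∀ fr : GenHamilton.AdaptedFrame Φ C,
        𝒟.HasNormalComponents fr (fr.leviCivitaH g) (fr.leviCivitaV g)) ∧
      𝒟.HHHTorsionFree Φ ∧ 𝒟.VVVTorsionFree Φ ∧ 𝒟.IsGenHamiltonSpace G Φ g :=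
  ⟨GenHamilton.leviConnection hG, GenHamilton.leviConnection_hasNormalComponents hG,
    GenHamilton.leviConnection_hhhTorsionFree hG, GenHamilton.leviConnection_vvvTorsionFree hG,
    GenHamilton.leviConnection_isMetric hG, hG⟩
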